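/- **Setting.** Let $T=\bigcup_{n\ge 0}\{0,1\}^n$ be the infinite complete binary tree with root $\partial$. Let $T^\infty\supset T$ be the tree obtained by adding a line of ancestors $u_{-j}=\mathrm p^j(\partial)$, $j\ge1$ ($u_0=\partial$), and grafting on each $u_{-j}$, $j\geq 1$, a copy of $T$ whose root $\partial^{(j)}$ becomes the second child of $u_{-j}$; every vertex $u$ of $T^\infty$ has one parent $\mathrm p(u)$ and two children. Let $\mathcal U=(\mathcal U_{(-j)})_{j\ge0}$ be independent Bernoulli$(1/2)$ bits with law $\mathbb P_{\mathcal U}$; for $j\ge0$, $u_{-j}$ is the left child of $u_{-j-1}$ if $\mathcal U_{(-j)}=0$ and the right child otherwise (inside $T$ and its copies the order of the children is the usual one). Let $<_{\mathcal U}$ be the breadth-first order of the resulting plane tree, and for $k\ge0$ let $\Delta^*(u,k)$ be the set of descendants $v$ of $\mathrm p^k(u)$ (including $\mathrm p^k(u)$ itself) with $v<_{\mathcal U}u$, and $\Delta(u,k)=\Delta^*(u,k)\cup\{u\}$. Let $\mathcal X,\mathcal Y$ be metric spaces with their Borel $\sigma$-fields, $\Theta\subset\mathbb R^d$ and $\theta^\star\in\Theta$.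 For $\theta\in\Theta$ let $Q_\theta$ be a probability kernel on $\mathcal X$, $G_\theta$ a probability kernel from $\mathcal X$ to $\mathcal Y$, and $\nu_\theta$ a probability measure on $\mathcal X$. Let $(X,Y)=((X_u,Y_u))_{u\in T^\infty}$ be, under $\mathbb P_\theta$, a hidden Markov tree process: for each $k,n\ge 0$, on the finite subtree $S$ of the descendants of $r=\mathrm p^k(\partial)$ at distance at most $n$ from $r$, the law of $X_S$ is $\nu_\theta(\mathrm dx_{r})\prod_{u\in S\setminus\{r\}}Q_\theta(x_{\mathrm p(u)};\mathrm dx_u)$, and given $X_S$ the variables $Y_u$, $u\in S$, are independent with laws $G_\theta(X_u;\cdot)$. $\mathbb E_\theta$ is the expectation under $\mathbb P_\theta$. **Assumptions.** 1. (Stationarity) $\nu_\theta Q_\theta=\nu_\theta$ for every $\theta\in\Theta$. 2. (Domination) There are a probability measure $\lambda$ on $\mathcal X$ and a $\sigma$-finite measure $\mu$ on $\mathcal Y$ such that, for all $\theta,x$, $Q_\theta(x;\mathrm dx')=q_\theta(x,x')\lambda(\mathrm dx')$ and $G_\theta(x;\mathrm dy)=g_\theta(x,y)\mu(\mathrm dy)$,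 with nonnegative jointly measurable densities $q_\theta$, $g_\theta$. 3. (Regularity) There are $0<\sigma^-\le\sigma^+<\infty$ with $\sigma^-\le q_\theta(x,x')\le\sigma^+$ for all $\theta,x,x'$; for every $y$, $\int g_\theta(x,y)\lambda(\mathrm dx)$ is bounded away from $0$ and $\infty$ uniformly in $\theta$; and $g_\theta(x,y)>0$ for all $\theta,x,y$. 4. ($L^1$ regularity) $\sup_{\theta,x,y}g_\theta(x,y)<\infty$ and $\mathbb E_{\theta^\star}|\log b^-(Y_\partial)|<\infty$, where $b^-(y)=\inf_\theta\int g_\theta(x,y)\lambda(\mathrm dx)$. 5. ($L^2$ regularity) $\mathbb E_{\theta^\star}[(\log b^-(Y_\partial))^2]<\infty$. **Contrast function.** For a finite subtree $\Delta$ of $T^\infty$ with root $w$ put $$p_\theta(y_\Delta\mid X_w=x)=g_\theta(x,y_w)\int\prod_{v\in\Delta\setminus\{w\}}q_\theta(x_{\mathrm p(v)},x_v)\,g_\theta(x_v,y_v)\,\lambda(\mathrm dx_v),\qquad x_w=x,$$ and $p_\theta(y_\emptyset\mid X_w=x)=1$. For $k\ge0$ and $x\in\mathcal X$ let $$\mathrm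 h_{\partial,k,x}(\theta)=\log\frac{p_\theta(Y_{\Delta(\partial,k)}\mid X_{\mathrm p^k(\partial)}=x)}{p_\theta(Y_{\Delta^*(\partial,k)}\mid X_{\mathrm p^k(\partial)}=x)}.$$ **Proposition.** For every $\theta\in\Theta$ there is $\mathrm h_{\partial,\infty}(\theta)\in L^1(\mathbb P_{\mathcal U}\otimes\mathbb P_{\theta^\star})$ such that, for all $x\in\mathcal X$, $\mathrm h_{\partial,k,x}(\theta)\to\mathrm h_{\partial,\infty}(\theta)$ as $k\to\infty$, $\mathbb P_{\mathcal U}\otimes\mathbb P_{\theta^\star}$-almost surely and in $L^1(\mathbb P_{\mathcal U}\otimes\mathbb P_{\theta^\star})$; so the contrast function $\ell(\theta)=\mathbb E_{\mathcal U}\otimes\mathbb E_{\theta^\star}[\mathrm h_{\partial,\infty}(\theta)]$ is well defined. A parameter $\theta\in\Theta$ is a global maximum of $\ell$ over $\Theta$ if and only if $\theta$ is equivalent to $\theta^\star$, that is, the process $(Y_u)_{u\in T}$ has the same law under $\mathbb P_\theta$ and under $\mathbb P_{\theta^\star}$. -/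

import Mathlib

open MeasureTheory ProbabilityTheory Filter Topology
open scoped ENNReal

/-! Hidden Markov models indexed by the binary tree, with an infinite past. -/

namespace HMT

/-! ### The extended binary tree -/

/-- The extended binary tree `T^∞`, as a non-plane tree. `node 0 w` is the vertex of the infinite
complete binary tree `T` with word `w` (written from the last letter to the first, so that
`node 0 (b :: w)` is the `b`-th child of `node 0 w`); `spine j` is the ancestor `u_{-(j+1)}` of the
root of `T`; `node (j+1) w` is the vertex with word `w` of the copy of `T` that is grafted on
`u_{-(j+1)} = spine j`. -/
inductive Vertex : Type
  | node (j : ℕ) (w : List Bool) : Vertex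
  | spine (j : ℕ) : Vertex
  deriving DecidableEq

namespace Vertex

/-- The vertex `∂`, root of the complete binary tree `T`. -/
def root : Vertex := node 0 []

/-- The parent of a vertex; every vertex of the extended tree has one. -/
def parent : Vertex → Vertex
  | node j (_ :: w) => node j w
  | node 0 [] => spine 0
  | node (j + 1) [] => spine j
  | spine j => spine (j + 1)

/-- An enumeration of the two children of a vertex (not the plane order, which is random). -/
def child : Vertex → Bool → Vertex
  | node j w, b => node j (b :: w)
  | spine 0, false => root
  | spine (j + 1), false => spine j
  | spine j, true => node (j + 1) []

theorem parent_child (v : Vertex) (b : Bool) : parent (child v b) = v := by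
  rcases v with ⟨j, w⟩ | ⟨_ | j⟩ <;> cases b <;> rfl

theorem exists_child_parent (v : Vertex) : ∃ b, child (parent v) b = v := by
  rcases v with ⟨_ | j, _ | ⟨b, w⟩⟩ | j
  · exact ⟨false, rfl⟩
  · exact ⟨b, rfl⟩
  · exact ⟨true, by cases j <;> rfl⟩
  · exact ⟨b, rfl⟩
  · exact ⟨false, rfl⟩

/-- The height of a vertex; the root `∂` has height `0`, its `j`-th ancestor height `-j`. -/
def height : Vertex → ℤ
  | node 0 w => w.length
  | node (j + 1) w => w.length - j
  | spine j => -(j + 1)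

theorem height_parent (v : Vertex) : height (parent v) = height v - 1 := by
  rcases v with ⟨_ | j, _ | ⟨b, w⟩⟩ | j <;> simp [height, parent] <;> ring

/-- The subtree `T^∞(v, n)`: the descendants of `v` at distance at most `n` from `v`. -/
def subtree : ℕ → Vertex → Finset Vertex
  | 0, v => {v}
  | n + 1, v => insert v (subtree n (child v false) ∪ subtree n (child v true))

/-- The label of a vertex in the plane embedding given by `U`: `false` for a left child, `true` for
a right child. Here `U j` is the bit `𝒰_{(-j)}`, which is the label of the `j`-th ancestor of `∂`
(`j = 0` being `∂` itself); the sibling of that vertex has the opposite label. -/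
def label (U : ℕ → Bool) : Vertex → Bool
  | node _ (b :: _) => b
  | node 0 [] => U 0
  | node (j + 1) [] => !(U j)
  | spine j => U (j + 1)

/-- The strict breadth-first order `u <_U v` of the plane tree: smaller height, or equal heights and
smaller path from the most recent common ancestor in the lexicographic order. The two paths have
equal length and already differ at their first letter, which is `0` for `u` and `1` for `v`. -/
def bfsLT (U : ℕ → Bool) (u v : Vertex) : Prop :=
  height u < height v ∨
    (height u = height v ∧ ∃ n : ℕ, parent^[n + 1] u = parent^[n + 1] v ∧
      label U (parent^[n] u) = false ∧ label U (parent^[n] v) = true)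

open Classical in
/-- `Δ*_U(u, k) = {v ∈ T^∞(p^k(u)) : v <_U u}`. (Such a vertex `v` is at distance at most `k`
from `p^k(u)`.) -/
noncomputable def pastStar (U : ℕ → Bool) (u : Vertex) (k : ℕ) : Finset Vertex :=
  (subtree k (parent^[k] u)).filter fun v => bfsLT U v u

/-- `Δ_U(u, k) = Δ*_U(u, k) ∪ {u}`. -/
noncomputable def past (U : ℕ → Bool) (u : Vertex) (k : ℕ) : Finset Vertex :=
  insert u (pastStar U u k)

end Vertex

open Vertex

/-- The law of the random bits `𝒰`: independent, Bernoulli with parameter `1/2`. -/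
noncomputable def spineLaw : Measure (ℕ → Bool) :=
  Measure.infinitePi fun _ => (PMF.uniformOfFintype Bool).toMeasure

instance : IsProbabilityMeasure spineLaw := by
  unfold spineLaw; infer_instance

/-! ### Branching Markov processes and hidden Markov tree processes -/

section Processes

variable {𝒳 𝒴 Ω : Type*} [MeasurableSpace 𝒳] [MeasurableSpace 𝒴] [MeasurableSpace Ω]

/-- The iterated integral
`∫ 1_{A_v}(x) ∏_{u ∈ T^∞(v,n) ∖ {v}} 1_{A_u}(x_u) Q(x_{p(u)}; dx_u)`, where `x_v = x` is fixed. -/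
noncomputable def branchMass (Q : Kernel 𝒳 𝒳) (A : Vertex → Set 𝒳) : ℕ → Vertex → 𝒳 → ℝ≥0∞
  | 0, v, x => (A v).indicator 1 x
  | n + 1, v, x => (A v).indicator 1 x * ∏ b : Bool, ∫⁻ x', branchMass Q A n (child v b) x' ∂(Q x)

/-- The restriction of `X` to the descendants of `r` is a branching Markov process with root `r`,
transition kernel `Q` and initial distribution `ν`: on every finite subtree `T^∞(r, n)` its law is
`ν(dx_r) ∏_{u ≠ r} Q(x_{p(u)}; dx_u)`. (A finite-dimensional law is given by its values on
measurable rectangles.) -/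
structure IsBranchingMarkov (r : Vertex) (Q : Kernel 𝒳 𝒳) (ν : Measure 𝒳)
    (X : Vertex → Ω → 𝒳) (P : Measure Ω) : Prop where
  measurable : ∀ v, Measurable (X v)
  law : ∀ (n : ℕ) (A : Vertex → Set 𝒳), (∀ v, MeasurableSet (A v)) →
    P {ω | ∀ v ∈ subtree n r, X v ω ∈ A v} = ∫⁻ x, branchMass Q A n r x ∂ν

/-- The restriction of `(X, Y)` to the descendants of `r` is a hidden Markov tree process with root
`r` and parameter `(Q, G, ν)`: `X` is a branching Markov process and, conditionally on `X` on the
subtree `T^∞(r, n)`, the variables `Y_v` are independent with laws `G(X_v; ·)`. -/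
structure IsHMT (r : Vertex) (Q : Kernel 𝒳 𝒳) (G : Kernel 𝒳 𝒴) (ν : Measure 𝒳)
    (X : Vertex → Ω → 𝒳) (Y : Vertex → Ω → 𝒴) (P : Measure Ω) : Prop where
  hidden : IsBranchingMarkov r Q ν X P
  measurable : ∀ v, Measurable (Y v)
  observed : ∀ (n : ℕ) (A : Vertex → Set 𝒳) (B : Vertex → Set 𝒴),
    (∀ v, MeasurableSet (A v)) → (∀ v, MeasurableSet (B v)) →
    P {ω | ∀ v ∈ subtree n r, X v ω ∈ A v ∧ Y v ω ∈ B v} =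
      ∫⁻ ω, ∏ v ∈ subtree n r, (A v).indicator 1 (X v ω) * G (X v ω) (B v) ∂P

/-- `(X, Y)` is a stationary hidden Markov tree process on the whole extended tree: the initial
distribution `ν` is invariant for `Q` and, seen from each ancestor `p^k(∂)`, the process is a hidden
Markov tree process with parameter `(Q, G, ν)`. -/
structure IsStationaryHMT (Q : Kernel 𝒳 𝒳) (G : Kernel 𝒳 𝒴) (ν : Measure 𝒳)
    (X : Vertex → Ω → 𝒳) (Y : Vertex → Ω → 𝒴) (P : Measure Ω) : Prop where
  invariant : Kernel.Invariant Q ν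
  isHMT : ∀ k : ℕ, IsHMT (parent^[k] root) Q G ν X Y P

end Processes

/-! ### Assumptions on the family of models -/

section Assumptions

variable {Θ 𝒳 𝒴 : Type*} [MeasurableSpace 𝒳] [MeasurableSpace 𝒴]

/-- Fully dominated model, with transition densities `q` and observation densities `g`. -/
structure FullyDominated (Q : Θ → Kernel 𝒳 𝒳) (G : Θ → Kernel 𝒳 𝒴) (lam : Measure 𝒳)
    (μ : Measure 𝒴) (q : Θ → 𝒳 → 𝒳 → ℝ) (g : Θ → 𝒳 → 𝒴 → ℝ) : Prop where
  measurable_q : ∀ θ, Measurable fun p : 𝒳 × 𝒳 => q θ p.1 p.2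
  nonneg_q : ∀ θ x x', 0 ≤ q θ x x'
  density_q : ∀ θ x, Q θ x = lam.withDensity fun x' => ENNReal.ofReal (q θ x x')
  measurable_g : ∀ θ, Measurable fun p : 𝒳 × 𝒴 => g θ p.1 p.2
  nonneg_g : ∀ θ x y, 0 ≤ g θ x y
  density_g : ∀ θ x, G θ x = μ.withDensity fun y => ENNReal.ofReal (g θ x y)

/-- Regularity of the densities. (In `integral_g`, a non-integrable function would have integral
`0`, which the positive lower bound excludes.) -/
structure Regular (lam : Measure 𝒳) (q : Θ → 𝒳 → 𝒳 → ℝ) (g : Θ → 𝒳 → 𝒴 → ℝ) : Prop where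
  bounded_q : ∃ σm σp : ℝ, 0 < σm ∧ ∀ θ x x', σm ≤ q θ x x' ∧ q θ x x' ≤ σp
  integral_g : ∀ y, ∃ c C : ℝ, 0 < c ∧ ∀ θ, c ≤ ∫ x, g θ x y ∂lam ∧ ∫ x, g θ x y ∂lam ≤ C
  pos_g : ∀ θ x y, 0 < g θ x y

/-- `b⁻(y) = inf_θ ∫ g_θ(x, y) λ(dx)`. -/
noncomputable def bMinus (lam : Measure 𝒳) (g : Θ → 𝒳 → 𝒴 → ℝ) (y : 𝒴) : ℝ :=
  ⨅ θ, ∫ x, g θ x y ∂lam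

/-- `L¹` regularity; `P` is the law under the true parameter and `Y₀` the observation at the
root. -/
structure L1Regular {Ω : Type*} [MeasurableSpace Ω] (lam : Measure 𝒳) (g : Θ → 𝒳 → 𝒴 → ℝ)
    (Y₀ : Ω → 𝒴) (P : Measure Ω) : Prop where
  bounded_g : ∃ b : ℝ, ∀ θ x y, g θ x y ≤ b
  integrable_log : Integrable (fun ω => Real.log (bMinus lam g (Y₀ ω))) P

/-- `L²` regularity. -/
def L2Regular {Ω : Type*} [MeasurableSpace Ω] (lam : Measure 𝒳) (g : Θ → 𝒳 → 𝒴 → ℝ)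
    (Y₀ : Ω → 𝒴) (P : Measure Ω) : Prop :=
  MemLp (fun ω => Real.log (bMinus lam g (Y₀ ω))) 2 P

end Assumptions

/-! ### Log-likelihood increments and the contrast function -/

section Likelihood

variable {𝒳 𝒴 : Type*} [MeasurableSpace 𝒳]

/-- The conditional density `p(y_Δ | X_w = x)` for a finite subtree `Δ` with root `w`:
`g(x, y_w) ∫ ∏_{v ∈ Δ ∖ {w}} q(x_{p(v)}, x_v) g(x_v, y_v) λ(dx_v)` with `x_w = x`; it is `1` for
`Δ = ∅`. -/
noncomputable def condDensity (lam : Measure 𝒳) (q : 𝒳 → 𝒳 → ℝ) (g : 𝒳 → 𝒴 → ℝ)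
    (Δ : Finset Vertex) (w : Vertex) (x : 𝒳) (y : Vertex → 𝒴) : ℝ :=
  if Δ = ∅ then 1
  else g x (y w) * ∫ z : (Δ.erase w → 𝒳),
    ∏ v : Δ.erase w,
      q (if h : parent v ∈ Δ.erase w then z ⟨parent v, h⟩ else x) (z v) * g (z v) (y v)
    ∂(Measure.pi fun _ => lam)

/-- `H_{u,k,x} = p(y_{Δ(u,k)} | X_{p^k(u)} = x) / p(y_{Δ*(u,k)} | X_{p^k(u)} = x)`. -/
noncomputable def bigH (lam : Measure 𝒳) (q : 𝒳 → 𝒳 → ℝ) (g : 𝒳 → 𝒴 → ℝ)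
    (u : Vertex) (k : ℕ) (x : 𝒳) (U : ℕ → Bool) (y : Vertex → 𝒴) : ℝ :=
  condDensity lam q g (past U u k) (parent^[k] u) x y /
    condDensity lam q g (pastStar U u k) (parent^[k] u) x y

/-- The log-likelihood increment `h_{u,k,x} = log H_{u,k,x}`. -/
noncomputable def smallH (lam : Measure 𝒳) (q : 𝒳 → 𝒳 → ℝ) (g : 𝒳 → 𝒴 → ℝ)
    (u : Vertex) (k : ℕ) (x : 𝒳) (U : ℕ → Bool) (y : Vertex → 𝒴) : ℝ :=
  Real.log (bigH lam q g u k x U y)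

variable {Ω : Type*}

/-- The increment `h_{∂,k,x}` at the root, as a random variable of the bits `𝒰` and the sample
point. -/
noncomputable def rootIncrement (lam : Measure 𝒳) (q : 𝒳 → 𝒳 → ℝ) (g : 𝒳 → 𝒴 → ℝ)
    (Y : Vertex → Ω → 𝒴) (k : ℕ) (x : 𝒳) (s : (ℕ → Bool) × Ω) : ℝ :=
  smallH lam q g root k x s.1 fun v => Y v s.2

/-- The increment `h_{∂,∞}` with infinite past, the limit of `h_{∂,k,x}` as `k → ∞`. -/
noncomputable def limitIncrement (lam : Measure 𝒳) (q : 𝒳 → 𝒳 → ℝ) (g : 𝒳 → 𝒴 → ℝ)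
    (Y : Vertex → Ω → 𝒴) (x : 𝒳) (s : (ℕ → Bool) × Ω) : ℝ :=
  limUnder atTop fun k : ℕ => rootIncrement lam q g Y k x s

variable [MeasurableSpace Ω]

/-- The contrast `ℓ = E_𝒰 ⊗ E[h_{∂,∞}]`, where `P` is the law under the true parameter. -/
noncomputable def contrast (lam : Measure 𝒳) (q : 𝒳 → 𝒳 → ℝ) (g : 𝒳 → 𝒴 → ℝ)
    (Y : Vertex → Ω → 𝒴) (P : Measure Ω) (x : 𝒳) : ℝ :=
  ∫ s, limitIncrement lam q g Y x s ∂(spineLaw.prod P)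

variable [MeasurableSpace 𝒴]

/-- Equality of the laws under `P` and `P'` of the observed process `(Y_u, u ∈ T)`; vertices of `T`
are words. -/
def SameObservedLaw (Y : Vertex → Ω → 𝒴) (P P' : Measure Ω) : Prop :=
  P.map (fun ω (u : List Bool) => Y (node 0 u) ω) =
    P'.map (fun ω (u : List Bool) => Y (node 0 u) ω)

end Likelihood

end HMT

/-!
The lower bound on the transition density makes the hidden chain forget its past at a geometric
rate, so the increments `h_{∂,k,x}(θ)` form a uniformly dominated Cauchy sequence whose limit does
not depend on `x`. The random plane order places the root uniformly among the `2 ^ k` vertices of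
the last generation of a complete tree; the increments along that generation telescope, so the
contrast `ℓ(θ)` is the limit of `2⁻ᵏ` times the expected increment of the log-likelihood when
generation `k` is added. Hence `ℓ(θ⋆) - ℓ(θ)` is the limit of `2⁻ᵏ` times the relative entropy of
the observations on the complete tree with `k` generations, and in particular it is nonnegative.

If it vanishes, consider `2 ^ m` copies of a finite tree `S`, one of them `j` generations below each
vertex of generation `m`. By mixing, for large `j` they are almost independent, so the
Donsker–Varadhan inequality bounds `2 ^ m` times the relative entropy on `S` by that of the whole
tree plus a small multiple of `2 ^ m`. Letting `m` and then `j` tend to infinity shows that the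
relative entropy on `S` is zero: the laws of the observations agree on every finite tree.
-/

open scoped NNReal

namespace HMT

open Vertex

universe u

/-! ### Shapes and their labellings -/

/-- Finite rooted binary trees in which the two children of a vertex are distinguished; `nil` is
the empty tree. -/
inductive Shape : Type
  | nil : Shape
  | node (l r : Shape) : Shape

/-- The complete binary tree with `n` generations of vertices. -/
def Shape.full : ℕ → Shape
  | 0 => .nil
  | n + 1 => .node (full n) (full n)

/-- One exchange of the two children of a vertex of the left branch; the law of the observations
does not see it. -/
inductive Shape.Swap : Shape → Shape → Prop
  | swap (l r : Shape) : Swap (.node l r) (.node r l)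
  | left {s s' : Shape} (t : Shape) (h : Swap s s') : Swap (.node s t) (.node s' t)

/-- Labellings of the vertices of a shape, as nested triples (label of the root, labelling of the
left subtree, labelling of the right subtree). -/
@[reducible] def Labels (α : Type u) : Shape → Type u
  | .nil => PUnit
  | .node l r => α × Labels α l × Labels α r

@[reducible] instance Labels.measurableSpace (α : Type u) [MeasurableSpace α] :
    ∀ s, MeasurableSpace (Labels α s)
  | .nil => (inferInstance : MeasurableSpace PUnit)
  | .node l r => @Prod.instMeasurableSpace _ _ _
      (@Prod.instMeasurableSpace _ _ (Labels.measurableSpace α l) (Labels.measurableSpace α r))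

/-! ### The law of the observations on a shape -/

section ObsLaw

variable {𝒳 𝒴 : Type*} [MeasurableSpace 𝒳] [MeasurableSpace 𝒴]

/-- The law of the observations on a shape, given the hidden state at its root. -/
noncomputable def obsKernel (Q : Kernel 𝒳 𝒳) (G : Kernel 𝒳 𝒴) : ∀ s, Kernel 𝒳 (Labels 𝒴 s)
  | .nil => Kernel.const 𝒳 (Measure.dirac PUnit.unit)
  | .node l r => G ×ₖ ((obsKernel Q G l ∘ₖ Q) ×ₖ (obsKernel Q G r ∘ₖ Q))

instance obsKernel.isMarkovKernel (Q : Kernel 𝒳 𝒳) (G : Kernel 𝒳 𝒴) [IsMarkovKernel Q]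
    [IsMarkovKernel G] : ∀ s, IsMarkovKernel (obsKernel Q G s)
  | .nil => by unfold obsKernel; infer_instance
  | .node l r => by
    have := obsKernel.isMarkovKernel Q G l
    have := obsKernel.isMarkovKernel Q G r
    unfold obsKernel; infer_instance

/-- The law of the observations on a shape, when the hidden state at its root has law `ν`. -/
noncomputable def obsLaw (Q : Kernel 𝒳 𝒳) (G : Kernel 𝒳 𝒴) (ν : Measure 𝒳) (s : Shape) :
    Measure (Labels 𝒴 s) :=
  obsKernel Q G s ∘ₘ ν

instance obsLaw.isProbabilityMeasure (Q : Kernel 𝒳 𝒳) (G : Kernel 𝒳 𝒴) (ν : Measure 𝒳) (s : Shape)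
    [IsMarkovKernel Q] [IsMarkovKernel G] [IsProbabilityMeasure ν] :
    IsProbabilityMeasure (obsLaw Q G ν s) := by
  unfold obsLaw; infer_instance

variable (Q : Kernel 𝒳 𝒳) [IsMarkovKernel Q] (G : Kernel 𝒳 𝒴) [IsMarkovKernel G]

theorem obsKernel_node_apply (l r : Shape) (x : 𝒳) :
    obsKernel Q G (.node l r) x = (G x).prod ((obsLaw Q G (Q x) l).prod (obsLaw Q G (Q x) r)) := by
  unfold obsKernel
  rw [Kernel.prod_apply, Kernel.prod_apply, Kernel.comp_apply, Kernel.comp_apply]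
  rfl

variable (l r : Shape) (ν : Measure 𝒳)

theorem measurePreserving_root_obsLaw :
    MeasurePreserving Prod.fst (obsLaw Q G ν (.node l r)) (G ∘ₘ ν) := by
  refine ⟨measurable_fst, ?_⟩
  have hfst : (obsKernel Q G (.node l r)).map Prod.fst = G := by
    rw [obsKernel, ← Kernel.fst_eq, Kernel.fst_prod]
  rw [obsLaw, Measure.map_comp _ _ measurable_fst, hfst]

theorem measurePreserving_left_obsLaw :
    MeasurePreserving (fun t => t.2.1) (obsLaw Q G ν (.node l r)) (obsLaw Q G (Q ∘ₘ ν) l) := by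
  refine ⟨measurable_snd.fst, ?_⟩
  have hleft : (obsKernel Q G (.node l r)).map (Prod.fst ∘ Prod.snd) = obsKernel Q G l ∘ₖ Q := by
    rw [obsKernel, Kernel.map_comp_right _ measurable_snd measurable_fst, ← Kernel.snd_eq,
      ← Kernel.fst_eq, Kernel.snd_prod, Kernel.fst_prod]
  rw [obsLaw, Measure.map_comp _ _ measurable_snd.fst]
  change (obsKernel Q G (.node l r)).map (Prod.fst ∘ Prod.snd) ∘ₘ ν = _
  rw [hleft, ← Measure.comp_assoc, obsLaw]

theorem measurePreserving_right_obsLaw :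
    MeasurePreserving (fun t => t.2.2) (obsLaw Q G ν (.node l r)) (obsLaw Q G (Q ∘ₘ ν) r) := by
  refine ⟨measurable_snd.snd, ?_⟩
  have hright : (obsKernel Q G (.node l r)).map (Prod.snd ∘ Prod.snd) = obsKernel Q G r ∘ₖ Q := by
    rw [obsKernel, Kernel.map_comp_right _ measurable_snd measurable_snd, ← Kernel.snd_eq,
      ← Kernel.snd_eq, Kernel.snd_prod, Kernel.snd_prod]
  rw [obsLaw, Measure.map_comp _ _ measurable_snd.snd]
  change (obsKernel Q G (.node l r)).map (Prod.snd ∘ Prod.snd) ∘ₘ ν = _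
  rw [hright, ← Measure.comp_assoc, obsLaw]

end ObsLaw

/-! ### Likelihoods -/

section Likelihoods

variable {𝒳 𝒴 : Type*} [MeasurableSpace 𝒳]

/-- The likelihood of the observations on a shape, given the hidden state at its root. Here `g` is
the density of the observations. -/
noncomputable def lik (Q : Kernel 𝒳 𝒳) (g : 𝒳 → 𝒴 → ℝ≥0∞) : ∀ s, 𝒳 → Labels 𝒴 s → ℝ≥0∞
  | .nil, _, _ => 1
  | .node l r, x, t =>
    g x t.1 * ((∫⁻ z, lik Q g l z t.2.1 ∂Q x) * ∫⁻ z, lik Q g r z t.2.2 ∂Q x)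

/-- The likelihood of the observations on a shape, when the hidden state at its root has law
`ν`. -/
noncomputable def meanLik (Q : Kernel 𝒳 𝒳) (g : 𝒳 → 𝒴 → ℝ≥0∞) (ν : Measure 𝒳) (s : Shape)
    (t : Labels 𝒴 s) : ℝ≥0∞ :=
  ∫⁻ z, lik Q g s z t ∂ν

theorem lik_node (Q : Kernel 𝒳 𝒳) (g : 𝒳 → 𝒴 → ℝ≥0∞) (l r : Shape) (x : 𝒳)
    (t : Labels 𝒴 (.node l r)) :
    lik Q g (.node l r) x t = g x t.1 * (meanLik Q g (Q x) l t.2.1 * meanLik Q g (Q x) r t.2.2) :=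
  rfl

variable [MeasurableSpace 𝒴]

/-- The product of the measures `μ` over the vertices of a shape: the reference measure of the
likelihoods. -/
noncomputable def refMeasure (μ : Measure 𝒴) : ∀ s, Measure (Labels 𝒴 s)
  | .nil => Measure.dirac PUnit.unit
  | .node l r => μ.prod ((refMeasure μ l).prod (refMeasure μ r))

instance refMeasure.sigmaFinite (μ : Measure 𝒴) [SigmaFinite μ] :
    ∀ s, SigmaFinite (refMeasure μ s)
  | .nil => by unfold refMeasure; infer_instance
  | .node l r => by
    have := refMeasure.sigmaFinite μ l
    have := refMeasure.sigmaFinite μ r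
    unfold refMeasure; infer_instance

theorem measurable_lintegral_kernel_param {𝒵 : Type*} [MeasurableSpace 𝒵] (Q : Kernel 𝒳 𝒳)
    [IsSFiniteKernel Q] {f : 𝒳 → 𝒵 → ℝ≥0∞} (hf : Measurable fun p : 𝒳 × 𝒵 => f p.1 p.2) :
    Measurable fun p : 𝒳 × 𝒵 => ∫⁻ z, f z p.2 ∂Q p.1 := by
  have hf' : Measurable fun w : (𝒳 × 𝒵) × 𝒳 => f w.2 w.1.2 :=
    hf.comp (measurable_snd.prodMk (measurable_snd.comp measurable_fst))
  exact hf'.lintegral_kernel_prod_right' (κ := Q.comap Prod.fst measurable_fst)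

section Measurability

variable (Q : Kernel 𝒳 𝒳) [IsSFiniteKernel Q] {g : 𝒳 → 𝒴 → ℝ≥0∞}

theorem measurable_lik (hg : Measurable fun p : 𝒳 × 𝒴 => g p.1 p.2) :
    ∀ s, Measurable fun p : 𝒳 × Labels 𝒴 s => lik Q g s p.1 p.2
  | .nil => measurable_const
  | .node l r => by
    have hl := measurable_lintegral_kernel_param Q (measurable_lik hg l)
    have hr := measurable_lintegral_kernel_param Q (measurable_lik hg r)
    exact (hg.comp (measurable_fst.prodMk measurable_snd.fst)).mul
      ((hl.comp (measurable_fst.prodMk measurable_snd.snd.fst)).mul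
        (hr.comp (measurable_fst.prodMk measurable_snd.snd.snd)))

theorem measurable_lik_left (hg : Measurable fun p : 𝒳 × 𝒴 => g p.1 p.2) (s : Shape)
    (t : Labels 𝒴 s) : Measurable fun x => lik Q g s x t :=
  (measurable_lik Q hg s).comp (measurable_id.prodMk measurable_const)

theorem measurable_meanLik (hg : Measurable fun p : 𝒳 × 𝒴 => g p.1 p.2) (ν : Measure 𝒳)
    [SFinite ν] (s : Shape) : Measurable (meanLik Q g ν s) :=
  (measurable_lik Q hg s).lintegral_prod_left'

end Measurability

theorem comp_eq_withDensity {𝒵 : Type*} [MeasurableSpace 𝒵] (m : Measure 𝒳) [SFinite m]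
    (κ : Kernel 𝒳 𝒵) (ref : Measure 𝒵) [SFinite ref] {f : 𝒳 → 𝒵 → ℝ≥0∞}
    (hf : Measurable fun p : 𝒳 × 𝒵 => f p.1 p.2) (hκ : ∀ x, κ x = ref.withDensity (f x)) :
    κ ∘ₘ m = ref.withDensity fun t => ∫⁻ z, f z t ∂m := by
  ext S hS
  rw [Measure.bind_apply hS κ.aemeasurable, withDensity_apply _ hS]
  simp_rw [hκ, withDensity_apply _ hS]
  exact lintegral_lintegral_swap hf.aemeasurable

section Density

variable (Q : Kernel 𝒳 𝒳) [IsMarkovKernel Q] {G : Kernel 𝒳 𝒴} [IsMarkovKernel G]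
  {g : 𝒳 → 𝒴 → ℝ≥0∞} {μ : Measure 𝒴} [SigmaFinite μ]

theorem obsKernel_eq_withDensity (hg : Measurable fun p : 𝒳 × 𝒴 => g p.1 p.2)
    (hG : ∀ x, G x = μ.withDensity (g x)) :
    ∀ s x, obsKernel Q G s x = (refMeasure μ s).withDensity (lik Q g s x)
  | .nil, x => by
    have hone : lik Q g .nil x = 1 := rfl
    rw [hone, withDensity_one]; rfl
  | .node l r, x => by
    have hl : obsLaw Q G (Q x) l = (refMeasure μ l).withDensity (meanLik Q g (Q x) l) :=
      comp_eq_withDensity _ _ _ (measurable_lik Q hg l) (obsKernel_eq_withDensity hg hG l)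
    have hr : obsLaw Q G (Q x) r = (refMeasure μ r).withDensity (meanLik Q g (Q x) r) :=
      comp_eq_withDensity _ _ _ (measurable_lik Q hg r) (obsKernel_eq_withDensity hg hG r)
    have ml := measurable_meanLik Q hg (Q x) l
    have mr := measurable_meanLik Q hg (Q x) r
    have mg : Measurable (g x) := hg.comp (measurable_const.prodMk measurable_id)
    rw [obsKernel_node_apply, hG, hl, hr, prod_withDensity ml mr,
      prod_withDensity mg (by fun_prop)]
    rfl

theorem obsLaw_eq_withDensity (hg : Measurable fun p : 𝒳 × 𝒴 => g p.1 p.2)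
    (hG : ∀ x, G x = μ.withDensity (g x)) (ν : Measure 𝒳) [SFinite ν] (s : Shape) :
    obsLaw Q G ν s = (refMeasure μ s).withDensity (meanLik Q g ν s) :=
  comp_eq_withDensity ν _ _ (measurable_lik Q hg s) (obsKernel_eq_withDensity Q hg hG s)

end Density

end Likelihoods

/-! ### Invariance under exchanges of children -/

section Swap

variable {𝒳 𝒴 : Type*} [MeasurableSpace 𝒳] [MeasurableSpace 𝒴] {s s' : Shape}

/-- The relabelling that follows an exchange of children. -/
structure IsSwapMap (σ : Labels 𝒴 s → Labels 𝒴 s') (𝒳 : Type*) [MeasurableSpace 𝒳] : Prop where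
  measurable : Measurable σ
  map_obsLaw : ∀ (Q : Kernel 𝒳 𝒳) (G : Kernel 𝒳 𝒴) [IsMarkovKernel Q] [IsMarkovKernel G]
    (ν : Measure 𝒳), (obsLaw Q G ν s).map σ = obsLaw Q G ν s'
  meanLik_comp : ∀ (Q : Kernel 𝒳 𝒳) (g : 𝒳 → 𝒴 → ℝ≥0∞) (ν : Measure 𝒳) (t : Labels 𝒴 s),
    meanLik Q g ν s' (σ t) = meanLik Q g ν s t

variable (𝒳) in
theorem Shape.Swap.exists_isSwapMap (h : s.Swap s') :
    ∃ σ : Labels 𝒴 s → Labels 𝒴 s', IsSwapMap σ 𝒳 := by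
  suffices ∃ σ : Labels 𝒴 s → Labels 𝒴 s', Measurable σ ∧
      (∀ (Q : Kernel 𝒳 𝒳) (G : Kernel 𝒳 𝒴) [IsMarkovKernel Q] [IsMarkovKernel G],
        (obsKernel Q G s).map σ = obsKernel Q G s') ∧
      ∀ (Q : Kernel 𝒳 𝒳) (g : 𝒳 → 𝒴 → ℝ≥0∞) (x : 𝒳) (t : Labels 𝒴 s),
        lik Q g s' x (σ t) = lik Q g s x t by
    obtain ⟨σ, hσ, hlaw, hlik⟩ := this
    refine ⟨σ, hσ, fun Q G _ _ ν => ?_, fun Q g ν t => ?_⟩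
    · rw [obsLaw, Measure.map_comp _ _ hσ, hlaw, obsLaw]
    · simp only [meanLik, hlik]
  induction h with
  | swap l r =>
    refine ⟨Prod.map id Prod.swap, by fun_prop, fun Q G _ _ => ?_, fun Q g x t => ?_⟩
    · ext1 x
      rw [Kernel.map_apply _ (by fun_prop), obsKernel_node_apply, obsKernel_node_apply,
        ← Measure.map_prod_map _ _ measurable_id measurable_swap, Measure.map_id,
        Measure.prod_swap]
    · simp only [lik_node, Prod.map_fst, Prod.map_snd, id, Prod.fst_swap, Prod.snd_swap]
      rw [mul_comm (meanLik Q g _ r _)]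
  | left t _ ih =>
    obtain ⟨σ, hσ, hlaw, hlik⟩ := ih
    refine ⟨Prod.map id (Prod.map σ id), by fun_prop, fun Q G _ _ => ?_, fun Q g x t => ?_⟩
    · ext1 x
      rw [Kernel.map_apply _ (by fun_prop), obsKernel_node_apply, obsKernel_node_apply,
        ← Measure.map_prod_map _ _ measurable_id (hσ.prodMap measurable_id), Measure.map_id,
        ← Measure.map_prod_map _ _ hσ measurable_id, Measure.map_id, obsLaw,
        Measure.map_comp _ _ hσ, hlaw, ← obsLaw]
    · simp only [lik, Prod.map_fst, Prod.map_snd, id, hlik]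

end Swap

/-! ### Bounds on the likelihoods -/

section LabelProducts

variable {𝒴 : Type*}

/-- The sum of `f` over the labels. -/
noncomputable def labelSum (f : 𝒴 → ℝ) : ∀ s, Labels 𝒴 s → ℝ
  | .nil, _ => 0
  | .node l r, t => f t.1 + (labelSum f l t.2.1 + labelSum f r t.2.2)

/-- The product of `f` over the labels. -/
noncomputable def labelProd (f : 𝒴 → ℝ≥0∞) : ∀ s, Labels 𝒴 s → ℝ≥0∞
  | .nil, _ => 1
  | .node l r, t => f t.1 * (labelProd f l t.2.1 * labelProd f r t.2.2)

theorem labelSum_mono {f f' : 𝒴 → ℝ} (h : ∀ y, f y ≤ f' y) :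
    ∀ s (t : Labels 𝒴 s), labelSum f s t ≤ labelSum f' s t
  | .nil, _ => le_rfl
  | .node l r, t => add_le_add (h t.1) (add_le_add (labelSum_mono h l _) (labelSum_mono h r _))

theorem labelSum_neg (f : 𝒴 → ℝ) :
    ∀ s (t : Labels 𝒴 s), labelSum (fun y => -f y) s t = -labelSum f s t
  | .nil, _ => neg_zero.symm
  | .node l r, t => by
    simp only [labelSum, labelSum_neg f l, labelSum_neg f r]
    ring

theorem labelProd_ne_zero {f : 𝒴 → ℝ≥0∞} (h : ∀ y, f y ≠ 0) :
    ∀ s (t : Labels 𝒴 s), labelProd f s t ≠ 0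
  | .nil, _ => one_ne_zero
  | .node l r, t => mul_ne_zero (h t.1) (mul_ne_zero (labelProd_ne_zero h l _)
      (labelProd_ne_zero h r _))

theorem labelProd_ne_top {f : 𝒴 → ℝ≥0∞} (h : ∀ y, f y ≠ ∞) :
    ∀ s (t : Labels 𝒴 s), labelProd f s t ≠ ∞
  | .nil, _ => ENNReal.one_ne_top
  | .node l r, t => ENNReal.mul_ne_top (h t.1) (ENNReal.mul_ne_top (labelProd_ne_top h l _)
      (labelProd_ne_top h r _))

theorem log_toReal_labelProd {f : 𝒴 → ℝ≥0∞} (h0 : ∀ y, f y ≠ 0) (h : ∀ y, f y ≠ ∞) :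
    ∀ s (t : Labels 𝒴 s),
      Real.log (labelProd f s t).toReal = labelSum (fun y => Real.log (f y).toReal) s t
  | .nil, _ => by simp [labelProd, labelSum]
  | .node l r, t => by
    have hpos : ∀ s (t : Labels 𝒴 s), (labelProd f s t).toReal ≠ 0 := fun s t =>
      (ENNReal.toReal_pos (labelProd_ne_zero h0 s t) (labelProd_ne_top h s t)).ne'
    rw [labelProd, labelSum, ENNReal.toReal_mul, ENNReal.toReal_mul,
      Real.log_mul (ENNReal.toReal_pos (h0 _) (h _)).ne' (mul_ne_zero (hpos _ _) (hpos _ _)),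
      Real.log_mul (hpos _ _) (hpos _ _), log_toReal_labelProd h0 h l, log_toReal_labelProd h0 h r]

end LabelProducts

section Bounds

variable {𝒳 𝒴 : Type*} [MeasurableSpace 𝒳]

theorem integrable_labelSum [MeasurableSpace 𝒴] {Q : Kernel 𝒳 𝒳} [IsMarkovKernel Q]
    {G : Kernel 𝒳 𝒴} [IsMarkovKernel G] {ν : Measure 𝒳} (hν : Kernel.Invariant Q ν) {f : 𝒴 → ℝ}
    (hf : Integrable f (G ∘ₘ ν)) : ∀ s, Integrable (labelSum f s) (obsLaw Q G ν s)
  | .nil => integrable_zero _ _ _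
  | .node l r => by
    have hleft := measurePreserving_left_obsLaw Q G l r ν
    have hright := measurePreserving_right_obsLaw Q G l r ν
    rw [hν.def] at hleft hright
    exact ((measurePreserving_root_obsLaw Q G l r ν).integrable_comp_of_integrable hf).add
      ((hleft.integrable_comp_of_integrable (integrable_labelSum hν hf l)).add
        (hright.integrable_comp_of_integrable (integrable_labelSum hν hf r)))

theorem smul_le_of_invariant {Q : Kernel 𝒳 𝒳} {lam : Measure 𝒳} {c : ℝ≥0}
    (h : ∀ x, c • lam ≤ Q x) {ν : Measure 𝒳} [IsProbabilityMeasure ν]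
    (hν : Kernel.Invariant Q ν) : c • lam ≤ ν := by
  refine Measure.le_iff.2 fun S hS => ?_
  calc (c • lam) S = ∫⁻ _, (c • lam) S ∂ν := by simp
    _ ≤ ∫⁻ x, Q x S ∂ν := lintegral_mono fun x => h x S
    _ = ν S := by rw [← Measure.bind_apply hS Q.aemeasurable, hν.def]

/-- The likelihood of a single observation when the hidden state has law `lam`. -/
noncomputable def refLik (lam : Measure 𝒳) (g : 𝒳 → 𝒴 → ℝ≥0∞) (y : 𝒴) : ℝ≥0∞ :=
  ∫⁻ x, g x y ∂lam

theorem lik_le_labelProd (Q : Kernel 𝒳 𝒳) [IsMarkovKernel Q] {g : 𝒳 → 𝒴 → ℝ≥0∞} {b : ℝ≥0∞}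
    (hb : ∀ x y, g x y ≤ b) :
    ∀ (s : Shape) (x : 𝒳) (t : Labels 𝒴 s), lik Q g s x t ≤ labelProd (fun _ => b) s t
  | .nil, _, _ => le_rfl
  | .node l r, x, t => by
    have hmean : ∀ s (t : Labels 𝒴 s), (∀ z, lik Q g s z t ≤ labelProd (fun _ => b) s t) →
        meanLik Q g (Q x) s t ≤ labelProd (fun _ => b) s t := fun s t h =>
      (lintegral_mono h).trans_eq (by simp)
    exact mul_le_mul' (hb x t.1) (mul_le_mul'
      (hmean l _ fun z => lik_le_labelProd Q hb l z _)
      (hmean r _ fun z => lik_le_labelProd Q hb r z _))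

theorem meanLik_le_labelProd (Q : Kernel 𝒳 𝒳) [IsMarkovKernel Q] {g : 𝒳 → 𝒴 → ℝ≥0∞} {b : ℝ≥0∞}
    (hb : ∀ x y, g x y ≤ b) (m : Measure 𝒳) [IsProbabilityMeasure m] (s : Shape)
    (t : Labels 𝒴 s) : meanLik Q g m s t ≤ labelProd (fun _ => b) s t :=
  (lintegral_mono fun x => lik_le_labelProd Q hb s x t).trans_eq (by simp)

theorem labelProd_le_meanLik {Q : Kernel 𝒳 𝒳} [IsMarkovKernel Q] {lam : Measure 𝒳} {c : ℝ≥0}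
    (hQ : ∀ x, c • lam ≤ Q x) {g : 𝒳 → 𝒴 → ℝ≥0∞} (hg : ∀ y, Measurable fun x => g x y)
    {m : Measure 𝒳} [IsProbabilityMeasure m] (hm : c • lam ≤ m) :
    ∀ (s : Shape) (t : Labels 𝒴 s), labelProd (fun y => c * refLik lam g y) s t ≤ meanLik Q g m s t
  | .nil, _ => by simp [labelProd, meanLik, lik]
  | .node l r, t => by
    set L := labelProd (fun y => c * refLik lam g y) l t.2.1
    set R := labelProd (fun y => c * refLik lam g y) r t.2.2
    calc c * refLik lam g t.1 * (L * R)
        = (∫⁻ x, g x t.1 ∂(c • lam)) * (L * R) := by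
          rw [lintegral_smul_measure, refLik, ENNReal.smul_def, smul_eq_mul]
      _ ≤ (∫⁻ x, g x t.1 ∂m) * (L * R) := mul_le_mul_left (lintegral_mono' hm le_rfl) _
      _ = ∫⁻ x, g x t.1 * (L * R) ∂m := (lintegral_mul_const _ (hg t.1)).symm
      _ ≤ ∫⁻ x, lik Q g (.node l r) x t ∂m := lintegral_mono fun x => mul_le_mul_right
          (mul_le_mul' (labelProd_le_meanLik hQ hg (hQ x) l _)
            (labelProd_le_meanLik hQ hg (hQ x) r _)) _

end Bounds

section Mixing

theorem lintegral_ne_zero {α : Type*} [MeasurableSpace α] (m : Measure α) [IsProbabilityMeasure m]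
    {f : α → ℝ≥0∞} (hf : Measurable f) (h : ∀ x, f x ≠ 0) : ∫⁻ x, f x ∂m ≠ 0 := by
  have hsupp : Function.support f = Set.univ := Set.eq_univ_of_forall h
  rw [← pos_iff_ne_zero, lintegral_pos_iff_support hf, hsupp]
  simp

variable {𝒳 𝒴 : Type*} [MeasurableSpace 𝒳] [MeasurableSpace 𝒴]

/-- The transition kernel `Q` is comparable to `lam`, and the density `g` of the observations is
positive and bounded. -/
structure IsMixing (Q : Kernel 𝒳 𝒳) (g : 𝒳 → 𝒴 → ℝ≥0∞) (lam : Measure 𝒳) (σm σp b : ℝ≥0) :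
    Prop where
  measurable_g : Measurable fun p : 𝒳 × 𝒴 => g p.1 p.2
  g_ne_zero : ∀ x y, g x y ≠ 0
  g_le : ∀ x y, g x y ≤ b
  pos : 0 < σm
  lower : ∀ x, σm • lam ≤ Q x
  upper : ∀ x, Q x ≤ σp • lam

/-- The log-likelihood of the observations on a shape, when the hidden state at its root has law
`ν`. -/
noncomputable def logMeanLik (Q : Kernel 𝒳 𝒳) (g : 𝒳 → 𝒴 → ℝ≥0∞) (ν : Measure 𝒳) (s : Shape)
    (t : Labels 𝒴 s) : ℝ :=
  Real.log (meanLik Q g ν s t).toReal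

namespace IsMixing

variable {Q : Kernel 𝒳 𝒳} {g : 𝒳 → 𝒴 → ℝ≥0∞} {lam : Measure 𝒳} {σm σp b : ℝ≥0}

theorem measurable_g_left (h : IsMixing Q g lam σm σp b) (y : 𝒴) : Measurable fun x => g x y :=
  h.measurable_g.comp (measurable_id.prodMk measurable_const)

theorem meanLik_ne_top [IsMarkovKernel Q] (h : IsMixing Q g lam σm σp b)
    (m : Measure 𝒳) [IsProbabilityMeasure m] (s : Shape) (t : Labels 𝒴 s) : meanLik Q g m s t ≠ ∞ :=
  ne_top_of_le_ne_top (labelProd_ne_top (fun _ => ENNReal.coe_ne_top) s t)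
    (meanLik_le_labelProd Q h.g_le m s t)

theorem lik_ne_top [IsMarkovKernel Q] (h : IsMixing Q g lam σm σp b)
    (s : Shape) (x : 𝒳) (t : Labels 𝒴 s) : lik Q g s x t ≠ ∞ :=
  ne_top_of_le_ne_top (labelProd_ne_top (fun _ => ENNReal.coe_ne_top) s t)
    (lik_le_labelProd Q h.g_le s x t)

theorem lik_ne_zero [IsMarkovKernel Q] (h : IsMixing Q g lam σm σp b) :
    ∀ (s : Shape) (x : 𝒳) (t : Labels 𝒴 s), lik Q g s x t ≠ 0
  | .nil, _, _ => one_ne_zero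
  | .node l r, x, t => by
    have hmean : ∀ s (t : Labels 𝒴 s), (∀ z, lik Q g s z t ≠ 0) → meanLik Q g (Q x) s t ≠ 0 :=
      fun s t => lintegral_ne_zero _ (measurable_lik_left Q h.measurable_g s t)
    exact mul_ne_zero (h.g_ne_zero x t.1) (mul_ne_zero
      (hmean l _ fun z => h.lik_ne_zero l z _) (hmean r _ fun z => h.lik_ne_zero r z _))

theorem meanLik_ne_zero [IsMarkovKernel Q] (h : IsMixing Q g lam σm σp b) (m : Measure 𝒳)
    [IsProbabilityMeasure m] (s : Shape) (t : Labels 𝒴 s) : meanLik Q g m s t ≠ 0 :=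
  lintegral_ne_zero m (measurable_lik_left Q h.measurable_g s t) fun x => h.lik_ne_zero s x t

theorem measurable_logMeanLik [IsMarkovKernel Q] (h : IsMixing Q g lam σm σp b)
    (ν : Measure 𝒳) [SFinite ν] (s : Shape) : Measurable (logMeanLik Q g ν s) :=
  (measurable_meanLik Q h.measurable_g ν s).ennreal_toReal.log

variable [IsProbabilityMeasure lam]

theorem le (h : IsMixing Q g lam σm σp b) : σm ≤ σp := by
  obtain ⟨x⟩ := nonempty_of_isProbabilityMeasure lam
  have hmass := (h.lower x).trans (h.upper x) Set.univ
  simp only [Measure.smul_apply, measure_univ, ENNReal.smul_def, smul_eq_mul, mul_one] at hmass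
  exact_mod_cast hmass

theorem refLik_ne_zero (h : IsMixing Q g lam σm σp b) (y : 𝒴) : refLik lam g y ≠ 0 :=
  lintegral_ne_zero lam (h.measurable_g_left y) fun x => h.g_ne_zero x y

theorem refLik_le (h : IsMixing Q g lam σm σp b) (y : 𝒴) : refLik lam g y ≤ b :=
  (lintegral_mono fun x => h.g_le x y).trans_eq (by simp)

theorem refLik_ne_top (h : IsMixing Q g lam σm σp b) (y : 𝒴) : refLik lam g y ≠ ∞ :=
  ne_top_of_le_ne_top ENNReal.coe_ne_top (h.refLik_le y)

theorem toReal_refLik_pos (h : IsMixing Q g lam σm σp b) (y : 𝒴) : 0 < (refLik lam g y).toReal :=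
  ENNReal.toReal_pos (h.refLik_ne_zero y) (h.refLik_ne_top y)

end IsMixing

/-- The label-wise bound for the log-likelihood. -/
noncomputable def logBound (lam : Measure 𝒳) (g : 𝒳 → 𝒴 → ℝ≥0∞) (σm b : ℝ≥0) (y : 𝒴) : ℝ :=
  |Real.log (σm * (refLik lam g y).toReal)| + |Real.log b|

namespace IsMixing

variable {Q : Kernel 𝒳 𝒳} [IsMarkovKernel Q] {g : 𝒳 → 𝒴 → ℝ≥0∞} {lam : Measure 𝒳}
  [IsProbabilityMeasure lam] {σm σp b : ℝ≥0}

theorem abs_logMeanLik_le (h : IsMixing Q g lam σm σp b) {ν : Measure 𝒳} [IsProbabilityMeasure ν]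
    (hν : Kernel.Invariant Q ν) (s : Shape) (t : Labels 𝒴 s) :
    |logMeanLik Q g ν s t| ≤ labelSum (logBound lam g σm b) s t := by
  have hle := smul_le_of_invariant h.lower hν
  have hσ : ∀ y, (σm : ℝ≥0∞) * refLik lam g y ≠ 0 := fun y =>
    mul_ne_zero (ENNReal.coe_ne_zero.2 h.pos.ne') (h.refLik_ne_zero y)
  have hσ' : ∀ y, (σm : ℝ≥0∞) * refLik lam g y ≠ ∞ := fun y =>
    ENNReal.mul_ne_top ENNReal.coe_ne_top (h.refLik_ne_top y)
  have hb : ∀ _ : 𝒴, (b : ℝ≥0∞) ≠ 0 := fun y =>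
    (lt_of_lt_of_le (pos_iff_ne_zero.2 (h.refLik_ne_zero y)) (h.refLik_le y)).ne'
  have lower : -labelSum (logBound lam g σm b) s t ≤ logMeanLik Q g ν s t := by
    rw [← labelSum_neg]
    calc labelSum (fun y => -logBound lam g σm b y) s t
        ≤ labelSum (fun y => Real.log (σm * refLik lam g y).toReal) s t := by
          refine labelSum_mono (fun y => ?_) s t
          rw [ENNReal.toReal_mul, ENNReal.coe_toReal]
          exact (neg_le_neg (le_add_of_nonneg_right (abs_nonneg _))).trans (neg_abs_le _)
      _ = Real.log (labelProd (fun y => σm * refLik lam g y) s t).toReal :=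
          (log_toReal_labelProd hσ hσ' s t).symm
      _ ≤ logMeanLik Q g ν s t := Real.log_le_log
          (ENNReal.toReal_pos (labelProd_ne_zero hσ s t) (labelProd_ne_top hσ' s t))
          (ENNReal.toReal_mono (h.meanLik_ne_top ν s t)
            (labelProd_le_meanLik h.lower h.measurable_g_left hle s t))
  have upper : logMeanLik Q g ν s t ≤ labelSum (logBound lam g σm b) s t := by
    calc logMeanLik Q g ν s t ≤ Real.log (labelProd (fun _ => (b : ℝ≥0∞)) s t).toReal :=
          Real.log_le_log
            (ENNReal.toReal_pos (h.meanLik_ne_zero ν s t) (h.meanLik_ne_top ν s t))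
            (ENNReal.toReal_mono (labelProd_ne_top (fun _ => ENNReal.coe_ne_top) s t)
              (meanLik_le_labelProd Q h.g_le ν s t))
      _ = labelSum (fun _ => Real.log b) s t :=
          log_toReal_labelProd hb (fun _ => ENNReal.coe_ne_top) s t
      _ ≤ labelSum (logBound lam g σm b) s t := labelSum_mono
          (fun _ => (le_abs_self _).trans (le_add_of_nonneg_left (abs_nonneg _))) s t
  exact abs_le.2 ⟨lower, upper⟩

theorem integrable_logMeanLik (h : IsMixing Q g lam σm σp b) {ν : Measure 𝒳}
    [IsProbabilityMeasure ν] (hν : Kernel.Invariant Q ν) {Q' : Kernel 𝒳 𝒳} [IsMarkovKernel Q']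
    {G' : Kernel 𝒳 𝒴} [IsMarkovKernel G'] {ν' : Measure 𝒳} (hν' : Kernel.Invariant Q' ν')
    (hint : Integrable (logBound lam g σm b) (G' ∘ₘ ν')) (s : Shape) :
    Integrable (logMeanLik Q g ν s) (obsLaw Q' G' ν' s) :=
  (integrable_labelSum hν' hint s).mono' (h.measurable_logMeanLik ν s).aestronglyMeasurable
    (ae_of_all _ fun t => h.abs_logMeanLik_le hν s t)

end IsMixing

end Mixing

/-! ### The increments of the log-likelihood at the root -/

section Contraction

variable {𝒳 : Type*} [MeasurableSpace 𝒳] {lam m : Measure 𝒳} {σm σp : ℝ≥0}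

-- The excess `N - a D` is nonnegative, and the masses that `m` and `lam` give to a nonnegative
-- function are comparable.
theorem mul_integral_le_of_smul_le_of_le_smul (hσm : 0 < σm) (hσ : σm ≤ σp)
    (hm : σm • lam ≤ m) (hm' : m ≤ σp • lam) {N D : 𝒳 → ℝ} {a : ℝ} (hN : Integrable N lam)
    (hD : Integrable D lam) (hD₀ : ∀ x, 0 ≤ D x) (hDpos : 0 < ∫ x, D x ∂lam)
    (h : ∀ x, a * D x ≤ N x) :
    (a + σm / σp * ((∫ x, N x ∂lam) / (∫ x, D x ∂lam) - a)) * ∫ x, D x ∂m ≤ ∫ x, N x ∂m := by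
  have hσp : (0 : ℝ) < σp := NNReal.coe_pos.2 (hσm.trans_le hσ)
  have hN' : Integrable N m := (hN.smul_measure_nnreal).mono_measure hm'
  have hD' : Integrable D m := (hD.smul_measure_nnreal).mono_measure hm'
  have hsmul : ∀ (c : ℝ≥0) (f : 𝒳 → ℝ), ∫ x, f x ∂(c • lam) = c * ∫ x, f x ∂lam := fun c f =>
    integral_smul_nnreal_measure f c
  have excess : σm * ∫ x, (N x - a * D x) ∂lam ≤ ∫ x, (N x - a * D x) ∂m := by
    rw [← hsmul]
    exact integral_mono_measure hm (ae_of_all _ fun x => sub_nonneg.2 (h x))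
      (hN'.sub (hD'.const_mul a))
  have mass : ∫ x, D x ∂m ≤ σp * ∫ x, D x ∂lam := by
    rw [← hsmul]
    exact integral_mono_measure hm' (ae_of_all _ hD₀) hD.smul_measure_nnreal
  rw [integral_sub hN (hD.const_mul a), integral_sub hN' (hD'.const_mul a), integral_const_mul,
    integral_const_mul] at excess
  set n := ∫ x, N x ∂lam
  set d := ∫ x, D x ∂lam
  have hnd : 0 ≤ n / d - a := by
    rw [sub_nonneg, le_div_iff₀ hDpos, ← integral_const_mul]
    exact integral_mono (hD.const_mul a) hN h
  calc (a + σm / σp * (n / d - a)) * ∫ x, D x ∂m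
      = a * ∫ x, D x ∂m + σm / σp * (n / d - a) * ∫ x, D x ∂m := by ring
    _ ≤ a * ∫ x, D x ∂m + σm / σp * (n / d - a) * (σp * d) := by gcongr
    _ = a * ∫ x, D x ∂m + σm * (n - a * d) := by field_simp
    _ ≤ ∫ x, N x ∂m := by linarith

end Contraction

/-- The shape of `Δ_U(∂, k)`, seen from its root `p^k(∂)`. -/
def pastShape (U : ℕ → Bool) : ℕ → Shape
  | 0 => .node .nil .nil
  | k + 1 => .node (pastShape U k) (.full (if U k then k + 1 else k))

/-- The shape of `Δ*_U(∂, k)`, seen from its root `p^k(∂)`. -/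
def pastStarShape (U : ℕ → Bool) : ℕ → Shape
  | 0 => .nil
  | k + 1 => .node (pastStarShape U k) (.full (if U k then k + 1 else k))

/-- The labels under `y` of the vertices of a shape whose root is placed at a given vertex. -/
def readLabels {𝒴 : Type*} (y : Vertex → 𝒴) : ∀ s, Vertex → Labels 𝒴 s
  | .nil, _ => PUnit.unit
  | .node l r, v => (y v, readLabels y l (child v false), readLabels y r (child v true))

theorem parent_iterate_root_succ (k : ℕ) : parent^[k + 1] root = spine k := by
  induction k with
  | zero => rfl
  | succ k ih => rw [Function.iterate_succ_apply', ih]; rfl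

theorem child_parent_iterate_root (k : ℕ) :
    child (parent^[k + 1] root) false = parent^[k] root := by
  rw [parent_iterate_root_succ]
  cases k with
  | zero => rfl
  | succ k => rw [parent_iterate_root_succ]; rfl

section Increments

variable {𝒳 𝒴 : Type*} [MeasurableSpace 𝒳]

section Definitions

variable (Q : Kernel 𝒳 𝒳) (g : 𝒳 → 𝒴 → ℝ≥0∞) (U : ℕ → Bool) (y : Vertex → 𝒴) (k : ℕ)

/-- The likelihood of the observations on `Δ_U(∂, k)`, given the hidden state at `p^k(∂)`. -/
noncomputable def pastLik (x : 𝒳) : ℝ :=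
  (lik Q g (pastShape U k) x (readLabels y _ (parent^[k] root))).toReal

/-- The likelihood of the observations on `Δ*_U(∂, k)`, given the hidden state at `p^k(∂)`. -/
noncomputable def pastStarLik (x : 𝒳) : ℝ :=
  (lik Q g (pastStarShape U k) x (readLabels y _ (parent^[k] root))).toReal

/-- The likelihood of the observation at `p^(k+1)(∂)` and of those on the part of `Δ*_U(∂, k + 1)`
behind the sibling of `p^k(∂)`, given the hidden state at `p^(k+1)(∂)`. -/
noncomputable def siblingLik (x : 𝒳) : ℝ :=
  (g x (y (parent^[k + 1] root)) * meanLik Q g (Q x) (.full (if U k then k + 1 else k))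
    (readLabels y _ (child (parent^[k + 1] root) true))).toReal

/-- The increment `h_{∂,k}` of the log-likelihood at the root, when the hidden state at `p^k(∂)`
has law `m`; the increment `h_{∂,k,x}` is the case of the Dirac mass at `x`. -/
noncomputable def increment (m : Measure 𝒳) : ℝ :=
  logMeanLik Q g m (pastShape U k) (readLabels y _ (parent^[k] root)) -
    logMeanLik Q g m (pastStarShape U k) (readLabels y _ (parent^[k] root))

/-- The bounds `a ≤ pastLik / pastStarLik ≤ c`, written without division. -/
def RatioBounds (a c : ℝ) : Prop :=
  ∀ x, a * pastStarLik Q g U y k x ≤ pastLik Q g U y k x ∧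
    pastLik Q g U y k x ≤ c * pastStarLik Q g U y k x

end Definitions

variable [MeasurableSpace 𝒴] {Q : Kernel 𝒳 𝒳} [IsMarkovKernel Q] {g : 𝒳 → 𝒴 → ℝ≥0∞}
  {lam : Measure 𝒳} {σm σp b : ℝ≥0} {U : ℕ → Bool} {y : Vertex → 𝒴} {k : ℕ}

namespace IsMixing

theorem integral_toReal_lik (h : IsMixing Q g lam σm σp b) (m : Measure 𝒳) (s : Shape)
    (t : Labels 𝒴 s) : ∫ x, (lik Q g s x t).toReal ∂m = (meanLik Q g m s t).toReal :=
  integral_toReal (measurable_lik_left Q h.measurable_g s t).aemeasurable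
    (ae_of_all _ fun x => (h.lik_ne_top s x t).lt_top)

theorem integrable_toReal_lik (h : IsMixing Q g lam σm σp b) (m : Measure 𝒳)
    [IsProbabilityMeasure m] (s : Shape) (t : Labels 𝒴 s) :
    Integrable (fun x => (lik Q g s x t).toReal) m :=
  integrable_toReal_of_lintegral_ne_top (measurable_lik_left Q h.measurable_g s t).aemeasurable
    (h.meanLik_ne_top m s t)

theorem pastLik_succ (h : IsMixing Q g lam σm σp b) (U : ℕ → Bool) (y : Vertex → 𝒴) (k : ℕ)
    (x : 𝒳) : pastLik Q g U y (k + 1) x =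
      siblingLik Q g U y k x * ∫ z, pastLik Q g U y k z ∂Q x := by
  unfold pastLik siblingLik
  rw [h.integral_toReal_lik, ← ENNReal.toReal_mul, ← child_parent_iterate_root k]
  simp only [pastShape, lik_node, readLabels]
  ring_nf

theorem pastStarLik_succ (h : IsMixing Q g lam σm σp b) (U : ℕ → Bool) (y : Vertex → 𝒴) (k : ℕ)
    (x : 𝒳) : pastStarLik Q g U y (k + 1) x =
      siblingLik Q g U y k x * ∫ z, pastStarLik Q g U y k z ∂Q x := by
  unfold pastStarLik siblingLik
  rw [h.integral_toReal_lik, ← ENNReal.toReal_mul, ← child_parent_iterate_root k]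
  simp only [pastStarShape, lik_node, readLabels]
  ring_nf

theorem ratioBounds_succ (h : IsMixing Q g lam σm σp b) {a c : ℝ}
    (hac : ∀ x, a * ∫ z, pastStarLik Q g U y k z ∂Q x ≤ ∫ z, pastLik Q g U y k z ∂Q x ∧
      ∫ z, pastLik Q g U y k z ∂Q x ≤ c * ∫ z, pastStarLik Q g U y k z ∂Q x) :
    RatioBounds Q g U y (k + 1) a c := fun x => by
  have hsib : 0 ≤ siblingLik Q g U y k x := ENNReal.toReal_nonneg
  rw [h.pastLik_succ, h.pastStarLik_succ, mul_left_comm, mul_left_comm c]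
  exact ⟨mul_le_mul_of_nonneg_left (hac x).1 hsib, mul_le_mul_of_nonneg_left (hac x).2 hsib⟩

end IsMixing

namespace RatioBounds

variable {a c : ℝ}

theorem integral_le (hab : RatioBounds Q g U y k a c) (h : IsMixing Q g lam σm σp b)
    (m : Measure 𝒳) [IsProbabilityMeasure m] :
    a * ∫ z, pastStarLik Q g U y k z ∂m ≤ ∫ z, pastLik Q g U y k z ∂m ∧
      ∫ z, pastLik Q g U y k z ∂m ≤ c * ∫ z, pastStarLik Q g U y k z ∂m := by
  have hN : Integrable (pastLik Q g U y k) m := h.integrable_toReal_lik m _ _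
  have hD : Integrable (pastStarLik Q g U y k) m := h.integrable_toReal_lik m _ _
  rw [← integral_const_mul, ← integral_const_mul]
  exact ⟨integral_mono (hD.const_mul a) hN fun x => (hab x).1,
    integral_mono hN (hD.const_mul c) fun x => (hab x).2⟩

theorem of_le (hab : RatioBounds Q g U y k a c) (h : IsMixing Q g lam σm σp b) {k' : ℕ}
    (hk : k ≤ k') : RatioBounds Q g U y k' a c := by
  induction k', hk using Nat.le_induction with
  | base => exact hab
  | succ n _ ih => exact h.ratioBounds_succ fun x => ih.integral_le h (Q x)

theorem log_le_increment_le (hab : RatioBounds Q g U y k a c) (h : IsMixing Q g lam σm σp b)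
    (ha : 0 < a) (m : Measure 𝒳) [IsProbabilityMeasure m] :
    Real.log a ≤ increment Q g U y k m ∧ increment Q g U y k m ≤ Real.log c := by
  have hbounds := hab.integral_le h m
  unfold pastLik pastStarLik at hbounds
  rw [h.integral_toReal_lik, h.integral_toReal_lik] at hbounds
  have pos : ∀ s (t : Labels 𝒴 s), 0 < (meanLik Q g m s t).toReal := fun s t =>
    ENNReal.toReal_pos (h.meanLik_ne_zero m s t) (h.meanLik_ne_top m s t)
  rw [← le_div_iff₀ (pos _ _), ← div_le_iff₀ (pos _ _)] at hbounds
  unfold increment logMeanLik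
  rw [← Real.log_div (pos _ _).ne' (pos _ _).ne']
  exact ⟨Real.log_le_log ha hbounds.1,
    Real.log_le_log (div_pos (pos _ _) (pos _ _)) hbounds.2⟩

variable [IsProbabilityMeasure lam]

theorem contract {w : ℝ} (hab : RatioBounds Q g U y k a (a + w)) (h : IsMixing Q g lam σm σp b) :
    ∃ a', a ≤ a' ∧ a' + (1 - σm / σp) * w ≤ a + w ∧
      RatioBounds Q g U y (k + 1) a' (a' + (1 - σm / σp) * w) := by
  have hN : Integrable (pastLik Q g U y k) lam := h.integrable_toReal_lik lam _ _
  have hD : Integrable (pastStarLik Q g U y k) lam := h.integrable_toReal_lik lam _ _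
  have hD₀ : ∀ x, 0 ≤ pastStarLik Q g U y k x := fun x => ENNReal.toReal_nonneg
  have hDpos : 0 < ∫ x, pastStarLik Q g U y k x ∂lam := by
    unfold pastStarLik
    rw [h.integral_toReal_lik]
    exact ENNReal.toReal_pos (h.meanLik_ne_zero lam _ _) (h.meanLik_ne_top lam _ _)
  have hr := hab.integral_le h lam
  rw [← le_div_iff₀ hDpos, ← div_le_iff₀ hDpos] at hr
  set r := (∫ x, pastLik Q g U y k x ∂lam) / ∫ x, pastStarLik Q g U y k x ∂lam with hr_def
  have hκ : (0 : ℝ) ≤ σm / σp := by positivity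
  refine ⟨a + σm / σp * (r - a), ?_, ?_, h.ratioBounds_succ fun x => ⟨?_, ?_⟩⟩
  · nlinarith [hr.1]
  · nlinarith [hr.2]
  · exact mul_integral_le_of_smul_le_of_le_smul h.pos h.le (h.lower x) (h.upper x) hN hD hD₀ hDpos
      fun x => (hab x).1
  · have hneg := mul_integral_le_of_smul_le_of_le_smul (N := fun x => -pastLik Q g U y k x)
      (a := -(a + w)) h.pos h.le (h.lower x) (h.upper x) hN.neg hD hD₀ hDpos
      fun x => by linarith [(hab x).2]
    rw [integral_neg, integral_neg, neg_div, ← hr_def] at hneg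
    linarith

end RatioBounds

namespace IsMixing

variable [IsProbabilityMeasure lam]

theorem ratioBounds_one (h : IsMixing Q g lam σm σp b) (U : ℕ → Bool) (y : Vertex → 𝒴) :
    RatioBounds Q g U y 1 (σm * (refLik lam g (y root)).toReal)
      (σp * (refLik lam g (y root)).toReal) := by
  refine h.ratioBounds_succ fun x => ?_
  have hN : ∫ z, pastLik Q g U y 0 z ∂Q x = (∫⁻ z, g z (y root) ∂Q x).toReal := by
    unfold pastLik
    rw [h.integral_toReal_lik]
    simp [meanLik, pastShape, lik, readLabels]
  have hD : ∫ z, pastStarLik Q g U y 0 z ∂Q x = 1 := by simp [pastStarLik, pastStarShape, lik]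
  have hsmul : ∀ c : ℝ≥0, c * (refLik lam g (y root)).toReal =
      (∫⁻ z, g z (y root) ∂(c • lam)).toReal := fun c => by
    rw [lintegral_smul_measure, ENNReal.smul_def, smul_eq_mul, ENNReal.toReal_mul,
      ENNReal.coe_toReal, refLik]
  have hfin : ∀ c : ℝ≥0, ∫⁻ z, g z (y root) ∂(c • lam) ≠ ∞ := fun c => by
    rw [lintegral_smul_measure, ENNReal.smul_def, smul_eq_mul]
    exact ENNReal.mul_ne_top ENNReal.coe_ne_top (h.refLik_ne_top _)
  rw [hN, hD, mul_one, mul_one, hsmul, hsmul]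
  exact ⟨ENNReal.toReal_mono (ne_top_of_le_ne_top (hfin σp) (lintegral_mono' (h.upper x) le_rfl))
      (lintegral_mono' (h.lower x) le_rfl),
    ENNReal.toReal_mono (hfin σp) (lintegral_mono' (h.upper x) le_rfl)⟩

theorem exists_ratioBounds (h : IsMixing Q g lam σm σp b) (U : ℕ → Bool) (y : Vertex → 𝒴)
    (k : ℕ) : ∃ a w : ℝ, σm * (refLik lam g (y root)).toReal ≤ a ∧
      a + w ≤ σp * (refLik lam g (y root)).toReal ∧
      w = (1 - σm / σp) ^ k * ((σp - σm) * (refLik lam g (y root)).toReal) ∧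
      RatioBounds Q g U y (k + 1) a (a + w) := by
  induction k with
  | zero => exact ⟨_, _, le_rfl, by linarith, rfl, by convert h.ratioBounds_one U y using 1; ring⟩
  | succ k ih =>
    obtain ⟨a, w, ha, haw, hw, hbounds⟩ := ih
    obtain ⟨a', haa', ha', hbounds'⟩ := hbounds.contract h
    exact ⟨a', _, ha.trans haa', ha'.trans haw, by rw [hw, pow_succ']; ring, hbounds'⟩

theorem abs_increment_sub_le (h : IsMixing Q g lam σm σp b) (U : ℕ → Bool) (y : Vertex → 𝒴)
    {k k₁ k₂ : ℕ} (h₁ : k < k₁) (h₂ : k < k₂) (m₁ m₂ : Measure 𝒳) [IsProbabilityMeasure m₁]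
    [IsProbabilityMeasure m₂] :
    |increment Q g U y k₁ m₁ - increment Q g U y k₂ m₂| ≤
      (σp - σm) / σm * (1 - σm / σp) ^ k := by
  obtain ⟨a, w, ha, -, hw, hbounds⟩ := h.exists_ratioBounds U y k
  have hσm : (0 : ℝ) < σm := h.pos
  have hσ : (σm : ℝ) ≤ σp := h.le
  have hI := h.toReal_refLik_pos (y root)
  have ha₀ : 0 < a := (mul_pos hσm hI).trans_le ha
  have hw₀ : 0 ≤ w := by
    have : (σm : ℝ) / σp ≤ 1 := div_le_one_of_le₀ hσ (hσm.le.trans hσ)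
    rw [hw]
    exact mul_nonneg (pow_nonneg (by linarith) k) (mul_nonneg (by linarith) hI.le)
  have inc₁ := (hbounds.of_le h h₁).log_le_increment_le h ha₀ m₁
  have inc₂ := (hbounds.of_le h h₂).log_le_increment_le h ha₀ m₂
  calc |increment Q g U y k₁ m₁ - increment Q g U y k₂ m₂|
      ≤ Real.log (a + w) - Real.log a :=
        abs_sub_le_iff.2 ⟨by linarith, by linarith⟩
    _ = Real.log (1 + w / a) := by
      rw [← Real.log_div (by positivity) ha₀.ne', add_div, div_self ha₀.ne']
    _ ≤ w / a := by
      have := Real.log_le_sub_one_of_pos (show 0 < 1 + w / a by positivity)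
      linarith
    _ ≤ w / (σm * (refLik lam g (y root)).toReal) := by gcongr
    _ = (σp - σm) / σm * (1 - σm / σp) ^ k := by rw [hw]; field_simp

theorem abs_increment_le (h : IsMixing Q g lam σm σp b) (U : ℕ → Bool) (y : Vertex → 𝒴) (k : ℕ)
    (m : Measure 𝒳) [IsProbabilityMeasure m] :
    |increment Q g U y (k + 1) m| ≤ logBound lam g σm b (y root) + Real.log (σp / σm) := by
  have hσm : (0 : ℝ) < σm := h.pos
  have hσp : (0 : ℝ) < σp := hσm.trans_le h.le
  have hI := h.toReal_refLik_pos (y root)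
  have inc := ((h.ratioBounds_one U y).of_le h (Nat.le_add_left 1 k)).log_le_increment_le h
    (mul_pos hσm hI) m
  have hσ : 0 ≤ Real.log (σp / σm) := Real.log_nonneg ((one_le_div hσm).2 h.le)
  have hlog : Real.log (σp * (refLik lam g (y root)).toReal) =
      Real.log (σm * (refLik lam g (y root)).toReal) + Real.log (σp / σm) := by
    rw [← Real.log_mul (by positivity) (by positivity)]
    congr 1
    field_simp
  rw [hlog] at inc
  unfold logBound
  have := neg_abs_le (Real.log (σm * (refLik lam g (y root)).toReal))
  have := le_abs_self (Real.log (σm * (refLik lam g (y root)).toReal))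
  have := abs_nonneg (Real.log b)
  exact abs_le.2 ⟨by linarith, by linarith⟩

end IsMixing

end Increments

/-! ### The vertices of a shape -/

/-- The vertices of the shape `s` when its root is placed at the vertex `v`. -/
def verts : Shape → Vertex → Finset Vertex
  | .nil, _ => ∅
  | .node l r, v => insert v (verts l (child v false) ∪ verts r (child v true))

theorem child_injective (v : Vertex) : Function.Injective (child v) := by
  intro b b' h
  rcases v with ⟨j, w⟩ | ⟨_ | j⟩ <;> cases b <;> cases b' <;> simp_all [child, root]

theorem height_child (v : Vertex) (b : Bool) : height (child v b) = height v + 1 := by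
  have := height_parent (child v b)
  rw [parent_child] at this
  omega

theorem parent_ne (v : Vertex) : parent v ≠ v := fun h => by
  have := height_parent v
  rw [h] at this
  omega

theorem exists_parent_iterate_eq_of_mem_verts {s : Shape} {u v : Vertex} (h : u ∈ verts s v) :
    ∃ n : ℕ, parent^[n] u = v ∧ height u = height v + n := by
  induction s generalizing v with
  | nil => simp [verts] at h
  | node l r hl hr =>
    have of_child (b : Bool)
        (hb : ∃ n : ℕ, parent^[n] u = child v b ∧ height u = height (child v b) + n) :
        ∃ n : ℕ, parent^[n] u = v ∧ height u = height v + n := by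
      obtain ⟨n, h₁, h₂⟩ := hb
      refine ⟨n + 1, ?_, ?_⟩
      · rw [Function.iterate_succ_apply', h₁, parent_child]
      · rw [h₂, height_child]; push_cast; ring
    simp only [verts, Finset.mem_insert, Finset.mem_union] at h
    rcases h with rfl | h | h
    · exact ⟨0, rfl, by simp⟩
    · exact of_child _ (hl h)
    · exact of_child _ (hr h)

theorem notMem_verts_child (s : Shape) (v : Vertex) (b : Bool) : v ∉ verts s (child v b) :=
  fun h => by
    obtain ⟨n, -, hn⟩ := exists_parent_iterate_eq_of_mem_verts h
    rw [height_child] at hn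
    omega

theorem parent_notMem_verts (s : Shape) (v : Vertex) : parent v ∉ verts s v := fun h => by
  obtain ⟨n, -, hn⟩ := exists_parent_iterate_eq_of_mem_verts h
  rw [height_parent] at hn
  omega

theorem disjoint_verts_child (s s' : Shape) (v : Vertex) :
    Disjoint (verts s (child v false)) (verts s' (child v true)) := by
  refine Finset.disjoint_left.2 fun u h h' => ?_
  obtain ⟨n, h₁, h₂⟩ := exists_parent_iterate_eq_of_mem_verts h
  obtain ⟨n', h₁', h₂'⟩ := exists_parent_iterate_eq_of_mem_verts h'
  rw [height_child] at h₂ h₂'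
  obtain rfl : n = n' := by omega
  exact absurd (child_injective v (h₁.symm.trans h₁')) (by simp)

theorem notMem_verts_union (l r : Shape) (v : Vertex) :
    v ∉ verts l (child v false) ∪ verts r (child v true) := by
  simp [notMem_verts_child]

theorem parent_mem_verts_of_ne {s : Shape} {u v : Vertex} (h : u ∈ verts s v) (hu : u ≠ v) :
    parent u ∈ verts s v := by
  induction s generalizing v with
  | nil => simp [verts] at h
  | node l r hl hr =>
    simp only [verts, Finset.mem_insert, Finset.mem_union] at h ⊢
    rcases h with h | h | h
    · exact absurd h hu
    · by_cases e : u = child v false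
      · exact .inl (by rw [e, parent_child])
      · exact .inr (.inl (hl h e))
    · by_cases e : u = child v true
      · exact .inl (by rw [e, parent_child])
      · exact .inr (.inr (hr h e))

/-! ### Likelihoods as integrals over the hidden states -/

theorem lmarginal_mul_left {δ : Type*} [DecidableEq δ] {E : δ → Type*}
    [∀ i, MeasurableSpace (E i)] (μ : ∀ i, Measure (E i)) {S : Finset δ}
    {f h : (∀ i, E i) → ℝ≥0∞} (hf : DependsOn f (S : Set δ)ᶜ) (hh : Measurable h)
    (x : ∀ i, E i) :
    (∫⋯∫⁻_S, (fun z => f z * h z) ∂μ) x = f x * (∫⋯∫⁻_S, h ∂μ) x := by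
  have hfx (y : ∀ i : S, E i) : f (Function.updateFinset x S y) = f x :=
    hf fun i hi => by
      have : i ∉ S := hi
      simp [Function.updateFinset, this]
  simp only [lmarginal, hfx]
  exact lintegral_const_mul _ (hh.comp measurable_updateFinset)

section HiddenWeight

variable {𝒳 𝒴 : Type*}

/-- The joint density of the hidden states and of the observations `y` on a set `S` of vertices,
given the hidden states at the parents. -/
noncomputable def hiddenWeight (q : 𝒳 → 𝒳 → ℝ≥0∞) (g : 𝒳 → 𝒴 → ℝ≥0∞) (y : Vertex → 𝒴)
    (S : Finset Vertex) (z : Vertex → 𝒳) : ℝ≥0∞ :=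
  ∏ u ∈ S, q (z (parent u)) (z u) * g (z u) (y u)

theorem dependsOn_hiddenWeight_verts (q : 𝒳 → 𝒳 → ℝ≥0∞) (g : 𝒳 → 𝒴 → ℝ≥0∞) (y : Vertex → 𝒴)
    (s : Shape) (v : Vertex) :
    DependsOn (hiddenWeight q g y (verts s v)) (insert (parent v) ↑(verts s v)) := by
  intro z z' hz
  refine Finset.prod_congr rfl fun u hu => ?_
  have hparent : z (parent u) = z' (parent u) := by
    by_cases huv : u = v
    · exact hz _ (.inl (by rw [huv]))
    · exact hz _ (.inr (parent_mem_verts_of_ne hu huv))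
  rw [hz u (.inr hu), hparent]

variable [MeasurableSpace 𝒳] [MeasurableSpace 𝒴] {q : 𝒳 → 𝒳 → ℝ≥0∞} {g : 𝒳 → 𝒴 → ℝ≥0∞}

theorem measurable_hiddenWeight (hq : Measurable fun p : 𝒳 × 𝒳 => q p.1 p.2)
    (hg : Measurable fun p : 𝒳 × 𝒴 => g p.1 p.2) (y : Vertex → 𝒴) (S : Finset Vertex) :
    Measurable (hiddenWeight q g y S) :=
  Finset.measurable_fun_prod S fun u _ => by
    have hqu : Measurable fun z : Vertex → 𝒳 => q (z (parent u)) (z u) :=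
      hq.comp (f := fun z : Vertex → 𝒳 => (z (parent u), z u)) (by fun_prop)
    have hgu : Measurable fun z : Vertex → 𝒳 => g (z u) (y u) :=
      hg.comp (f := fun z : Vertex → 𝒳 => (z u, y u)) (by fun_prop)
    exact hqu.mul hgu

variable {Q : Kernel 𝒳 𝒳} {lam : Measure 𝒳} [IsProbabilityMeasure lam]

theorem lmarginal_hiddenWeight_children (hq : Measurable fun p : 𝒳 × 𝒳 => q p.1 p.2)
    (hg : Measurable fun p : 𝒳 × 𝒴 => g p.1 p.2) (y : Vertex → 𝒴) {l r : Shape} {c : Vertex}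
    {z : Vertex → 𝒳} {wl wr : 𝒳 → ℝ≥0∞}
    (hl : ∀ z, (∫⋯∫⁻_verts l (child c false), hiddenWeight q g y (verts l (child c false))
      ∂fun _ => lam) z = wl (z c))
    (hr : ∀ z, (∫⋯∫⁻_verts r (child c true), hiddenWeight q g y (verts r (child c true))
      ∂fun _ => lam) z = wr (z c)) :
    (∫⋯∫⁻_verts l (child c false) ∪ verts r (child c true),
      hiddenWeight q g y (verts l (child c false) ∪ verts r (child c true)) ∂fun _ => lam) z =
    wl (z c) * wr (z c) := by
  have hdisj := disjoint_verts_child l r c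
  have hl_dep := dependsOn_hiddenWeight_verts q g y l (child c false)
  set A := verts l (child c false)
  set B := verts r (child c true)
  have hA := measurable_hiddenWeight hq hg y A
  have hB := measurable_hiddenWeight hq hg y B
  have hAB : hiddenWeight q g y (A ∪ B) =
      fun z => hiddenWeight q g y A z * hiddenWeight q g y B z :=
    funext fun z => Finset.prod_union hdisj
  have hA_dep : DependsOn (hiddenWeight q g y A) (B : Set Vertex)ᶜ := by
    refine hl_dep.mono ?_
    rw [parent_child]
    exact Set.insert_subset (notMem_verts_child _ _ _)
      (Set.disjoint_left.1 (Finset.disjoint_coe.2 hdisj))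
  have hwr_dep : DependsOn (fun z : Vertex → 𝒳 => wr (z c)) (A : Set Vertex)ᶜ := fun z z' hz =>
    congr_arg wr (hz c (notMem_verts_child _ _ _))
  have hint : (∫⋯∫⁻_B, hiddenWeight q g y (A ∪ B) ∂fun _ => lam) =
      fun z => wr (z c) * hiddenWeight q g y A z := by
    funext z
    rw [hAB, lmarginal_mul_left _ hA_dep hB, hr, mul_comm]
  rw [lmarginal_union _ _ (measurable_hiddenWeight hq hg y _) hdisj, hint,
    lmarginal_mul_left _ hwr_dep hA, hl, mul_comm]

theorem lmarginal_hiddenWeight_verts [IsMarkovKernel Q]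
    (hq : Measurable fun p : 𝒳 × 𝒳 => q p.1 p.2)
    (hg : Measurable fun p : 𝒳 × 𝒴 => g p.1 p.2) (hQ : ∀ x, Q x = lam.withDensity (q x))
    (y : Vertex → 𝒴) (s : Shape) (v : Vertex) (z : Vertex → 𝒳) :
    (∫⋯∫⁻_verts s v, hiddenWeight q g y (verts s v) ∂fun _ => lam) z =
      meanLik Q g (Q (z (parent v))) s (readLabels y s v) := by
  induction s generalizing v z with
  | nil => simp [verts, hiddenWeight, meanLik, lik]
  | node l r hl hr =>
    have hv := notMem_verts_union l r v
    have hparent := parent_notMem_verts (.node l r) v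
    have hchildren (z : Vertex → 𝒳) := lmarginal_hiddenWeight_children (lam := lam) hq hg y
      (l := l) (r := r) (c := v) (z := z)
      (wl := fun x => meanLik Q g (Q x) l (readLabels y l (child v false)))
      (wr := fun x => meanLik Q g (Q x) r (readLabels y r (child v true)))
      (fun z => by rw [hl, parent_child]) (fun z => by rw [hr, parent_child])
    simp only [verts] at hparent ⊢
    set S := verts l (child v false) ∪ verts r (child v true)
    have hqv : Measurable (q (z (parent v))) := hq.comp (measurable_const.prodMk measurable_id)
    have hinsert : hiddenWeight q g y (insert v S) = fun z =>
        (q (z (parent v)) (z v) * g (z v) (y v)) * hiddenWeight q g y S z :=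
      funext fun z => Finset.prod_insert hv
    have hdep : DependsOn (fun z : Vertex → 𝒳 => q (z (parent v)) (z v) * g (z v) (y v))
        (S : Set Vertex)ᶜ := fun z z' hz => by
      simp only [hz v hv, hz _ fun h => hparent (Finset.mem_insert_of_mem h)]
    rw [lmarginal_insert _ (measurable_hiddenWeight hq hg y _) hv, meanLik, hQ,
      lintegral_withDensity_eq_lintegral_mul _ hqv (measurable_lik_left Q hg _ _)]
    refine lintegral_congr fun a => ?_
    rw [hinsert, lmarginal_mul_left _ hdep (measurable_hiddenWeight hq hg y _), hchildren]
    simp only [Function.update_self, Function.update_of_ne (parent_ne v), Pi.mul_apply, lik_node,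
      readLabels]
    ring

end HiddenWeight

section CondDensity

variable {𝒳 𝒴 : Type*} {q : 𝒳 → 𝒳 → ℝ} {g : 𝒳 → 𝒴 → ℝ}

theorem ofReal_prod_density (hq₀ : ∀ x x', 0 ≤ q x x') (hg₀ : ∀ x y, 0 ≤ g x y)
    (S : Finset Vertex) (x : 𝒳) (y : Vertex → 𝒴) (z : S → 𝒳) :
    ENNReal.ofReal (∏ v : S,
      q (if h : parent v ∈ S then z ⟨parent v, h⟩ else x) (z v) * g (z v) (y v)) =
    hiddenWeight (fun x x' => ENNReal.ofReal (q x x')) (fun x y => ENNReal.ofReal (g x y)) y S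
      (Function.updateFinset (fun _ => x) S z) := by
  rw [ENNReal.ofReal_prod_of_nonneg fun u _ => mul_nonneg (hq₀ _ _) (hg₀ _ _), hiddenWeight,
    ← Finset.prod_coe_sort S]
  refine Finset.prod_congr rfl fun u _ => ?_
  rw [ENNReal.ofReal_mul (hq₀ _ _)]
  simp [Function.updateFinset]

variable [MeasurableSpace 𝒳] [MeasurableSpace 𝒴] {lam : Measure 𝒳}

theorem measurable_prod_density (hq : Measurable fun p : 𝒳 × 𝒳 => q p.1 p.2)
    (hg : Measurable fun p : 𝒳 × 𝒴 => g p.1 p.2) (S : Finset Vertex) (x : 𝒳) (y : Vertex → 𝒴) :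
    Measurable fun z : S → 𝒳 => ∏ v : S,
      q (if h : parent v ∈ S then z ⟨parent v, h⟩ else x) (z v) * g (z v) (y v) := by
  refine Finset.measurable_fun_prod _ fun u _ => ?_
  have hparent : Measurable fun z : S → 𝒳 =>
      if h : parent (u : Vertex) ∈ S then z ⟨parent u, h⟩ else x := by
    by_cases h : parent (u : Vertex) ∈ S
    · simpa only [dif_pos h] using measurable_pi_apply _
    · simpa only [dif_neg h] using measurable_const
  have hgu : Measurable fun z : S → 𝒳 => g (z u) (y u) :=
    hg.comp (f := fun z : S → 𝒳 => (z u, y u)) (by fun_prop)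
  exact (hq.comp (hparent.prodMk (measurable_pi_apply u))).mul hgu

theorem condDensity_eq_toReal_lmarginal (hq₀ : ∀ x x', 0 ≤ q x x') (hg₀ : ∀ x y, 0 ≤ g x y)
    (hq : Measurable fun p : 𝒳 × 𝒳 => q p.1 p.2) (hg : Measurable fun p : 𝒳 × 𝒴 => g p.1 p.2)
    {Δ : Finset Vertex} (hΔ : Δ ≠ ∅) (w : Vertex) (x : 𝒳) (y : Vertex → 𝒴) :
    condDensity lam q g Δ w x y = g x (y w) *
      ((∫⋯∫⁻_Δ.erase w, hiddenWeight (fun x x' => ENNReal.ofReal (q x x'))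
        (fun x y => ENNReal.ofReal (g x y)) y (Δ.erase w) ∂fun _ => lam) fun _ => x).toReal := by
  rw [condDensity, if_neg hΔ, integral_eq_lintegral_of_nonneg_ae
    (ae_of_all _ fun z => Finset.prod_nonneg fun u _ => mul_nonneg (hq₀ _ _) (hg₀ _ _))
    (measurable_prod_density hq hg _ x y).aestronglyMeasurable]
  simp only [ofReal_prod_density hq₀ hg₀, lmarginal]

theorem condDensity_verts [IsProbabilityMeasure lam] {Q : Kernel 𝒳 𝒳} [IsMarkovKernel Q]
    (hq₀ : ∀ x x', 0 ≤ q x x') (hg₀ : ∀ x y, 0 ≤ g x y)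
    (hq : Measurable fun p : 𝒳 × 𝒳 => q p.1 p.2) (hg : Measurable fun p : 𝒳 × 𝒴 => g p.1 p.2)
    (hQ : ∀ x, Q x = lam.withDensity fun x' => ENNReal.ofReal (q x x'))
    (s : Shape) (v : Vertex) (x : 𝒳) (y : Vertex → 𝒴) :
    condDensity lam q g (verts s v) v x y =
      (lik Q (fun x y => ENNReal.ofReal (g x y)) s x (readLabels y s v)).toReal := by
  cases s with
  | nil => simp [verts, condDensity, lik]
  | node l r =>
    have herase : (verts (.node l r) v).erase v =
        verts l (child v false) ∪ verts r (child v true) :=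
      Finset.erase_insert (notMem_verts_union l r v)
    let G (x : 𝒳) (y : 𝒴) := ENNReal.ofReal (g x y)
    have hmarginal (s : Shape) := lmarginal_hiddenWeight_verts hq.ennreal_ofReal (g := G)
      hg.ennreal_ofReal hQ y s
    rw [condDensity_eq_toReal_lmarginal hq₀ hg₀ hq hg (by simp [verts]), herase,
      lmarginal_hiddenWeight_children hq.ennreal_ofReal hg.ennreal_ofReal y
        (wl := fun x => meanLik Q G (Q x) l (readLabels y l (child v false)))
        (wr := fun x => meanLik Q G (Q x) r (readLabels y r (child v true)))
        (fun z => by rw [hmarginal, parent_child]) (fun z => by rw [hmarginal, parent_child])]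
    simp only [lik_node, readLabels, ENNReal.toReal_mul, ENNReal.toReal_ofReal (hg₀ _ _), G]

end CondDensity

/-! ### The past of the root -/

theorem subtree_eq_verts (n : ℕ) (v : Vertex) : subtree n v = verts (.full (n + 1)) v := by
  induction n generalizing v with
  | zero => simp [subtree, Shape.full, verts]
  | succ n ih => rw [subtree, ih, ih]; rfl

theorem mem_verts_full {n j : ℕ} {w : List Bool} {u : Vertex} :
    u ∈ verts (.full n) (node j w) ↔ ∃ w' : List Bool, w'.length < n ∧ u = node j (w' ++ w) := by
  induction n generalizing w with
  | zero => simp [Shape.full, verts]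
  | succ n ih =>
    simp only [Shape.full, verts, Finset.mem_insert, Finset.mem_union, child, ih]
    constructor
    · rintro (rfl | ⟨w', h, rfl⟩ | ⟨w', h, rfl⟩)
      · exact ⟨[], by simp, rfl⟩
      · exact ⟨w' ++ [false], by simpa using h, by simp⟩
      · exact ⟨w' ++ [true], by simpa using h, by simp⟩
    · rintro ⟨w', h, rfl⟩
      rcases w'.eq_nil_or_concat with rfl | ⟨w'', b, rfl⟩
      · exact .inl rfl
      · right
        simp only [List.concat_eq_append, List.length_append, List.length_singleton] at h
        cases b
        · exact .inl ⟨w'', by omega, by simp⟩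
        · exact .inr ⟨w'', by omega, by simp⟩

theorem height_parent_iterate_root (k : ℕ) : height (parent^[k] root) = -k := by
  cases k with
  | zero => rfl
  | succ k => rw [parent_iterate_root_succ]; simp [height]

theorem label_parent_iterate_root (U : ℕ → Bool) (k : ℕ) : label U (parent^[k] root) = U k := by
  cases k with
  | zero => rfl
  | succ k => rw [parent_iterate_root_succ]; rfl

theorem parent_iterate_node (j n : ℕ) (w : List Bool) (h : n ≤ w.length) :
    parent^[n] (node j w) = node j (w.drop n) := by
  induction n generalizing w with
  | zero => rfl
  | succ n ih =>
    cases w with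
    | nil => simp at h
    | cons b w => exact ih w (by simpa using h)

theorem parent_iterate_sibling (k : ℕ) (w : List Bool) (h : w.length = k) (m : ℕ) :
    parent^[k + 1 + m] (node (k + 1) w) = parent^[k + 1 + m] root := by
  rw [add_comm _ m, Function.iterate_add_apply, Function.iterate_add_apply _ m,
    parent_iterate_root_succ, Function.iterate_succ_apply', parent_iterate_node _ _ _ h.ge]
  simp [← h, parent]

theorem bfsLT_sibling_iff (U : ℕ → Bool) (k : ℕ) (w : List Bool) (hw : w.length ≤ k) :
    bfsLT U (node (k + 1) w) root ↔ w.length < if U k then k + 1 else k := by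
  have height_sibling : height (node (k + 1) w) = w.length - k := rfl
  have height_root : height root = 0 := rfl
  rw [bfsLT, height_sibling, height_root]
  rcases hw.lt_or_eq with hlt | heq
  · have hneg : ((w.length : ℤ) - k < 0) := by omega
    have hlt' : w.length < if U k then k + 1 else k := by split_ifs <;> omega
    simp [hneg, hlt']
  · have parent_iterate : parent^[k] (node (k + 1) w) = node (k + 1) [] := by
      rw [parent_iterate_node _ _ _ heq.ge]; simp [← heq]
    constructor
    · rintro (h | ⟨-, n, hcommon, hleft, hright⟩)
      · omega
      · rcases lt_trichotomy n k with hn | rfl | hn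
        · rw [parent_iterate_node _ _ _ (by omega), parent_iterate_root_succ] at hcommon
          cases hcommon
        · rw [label_parent_iterate_root] at hright
          simp [hright, heq]
        · obtain ⟨m, rfl⟩ := Nat.exists_eq_add_of_lt hn
          rw [add_right_comm, parent_iterate_sibling k w heq] at hleft
          rw [add_right_comm, hleft] at hright
          cases hright
    · intro h
      have hU : U k = true := by
        by_contra hU
        simp [hU, heq] at h
      refine .inr ⟨by omega, k, parent_iterate_sibling k w heq 0, ?_, ?_⟩
      · rw [parent_iterate]; simp [label, hU]
      · rw [label_parent_iterate_root, hU]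

theorem child_parent_iterate_root_true (k : ℕ) :
    child (parent^[k + 1] root) true = node (k + 1) [] := by
  rw [parent_iterate_root_succ]
  cases k <;> rfl

theorem not_bfsLT_self (U : ℕ → Bool) (v : Vertex) : ¬ bfsLT U v v := by
  rintro (h | ⟨-, n, -, hleft, hright⟩)
  · exact lt_irrefl _ h
  · rw [hleft] at hright
    cases hright

theorem bfsLT_parent_iterate_succ_root (U : ℕ → Bool) (k : ℕ) :
    bfsLT U (parent^[k + 1] root) root := by
  left
  rw [height_parent_iterate_root, show height root = 0 from rfl]
  omega

theorem filter_subtree_sibling_eq_verts (U : ℕ → Bool) (k : ℕ)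
    [DecidablePred fun v => bfsLT U v root] :
    (subtree k (node (k + 1) [])).filter (fun v => bfsLT U v root) =
      verts (.full (if U k then k + 1 else k)) (node (k + 1) []) := by
  ext u
  rw [Finset.mem_filter, subtree_eq_verts, mem_verts_full, mem_verts_full]
  constructor
  · rintro ⟨⟨w, h, rfl⟩, hlt⟩
    rw [List.append_nil, bfsLT_sibling_iff U k w (by omega)] at hlt
    exact ⟨w, hlt, rfl⟩
  · rintro ⟨w, h, rfl⟩
    have hw : w.length ≤ k := by split_ifs at h <;> omega
    refine ⟨⟨w, by omega, rfl⟩, ?_⟩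
    rwa [List.append_nil, bfsLT_sibling_iff U k w hw]

theorem pastStar_root (U : ℕ → Bool) (k : ℕ) :
    pastStar U root k = verts (pastStarShape U k) (parent^[k] root) := by
  induction k with
  | zero => simp [pastStar, subtree, pastStarShape, verts, not_bfsLT_self]
  | succ k ih =>
    unfold pastStar at ih ⊢
    rw [subtree, Finset.filter_insert, if_pos (bfsLT_parent_iterate_succ_root U k),
      Finset.filter_union, child_parent_iterate_root, child_parent_iterate_root_true, ih,
      filter_subtree_sibling_eq_verts, pastStarShape, verts, child_parent_iterate_root,
      child_parent_iterate_root_true]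

theorem past_root (U : ℕ → Bool) (k : ℕ) :
    past U root k = verts (pastShape U k) (parent^[k] root) := by
  rw [past, pastStar_root]
  induction k with
  | zero => simp [pastShape, pastStarShape, verts]
  | succ k ih =>
    rw [pastShape, pastStarShape, verts, verts, child_parent_iterate_root, ← ih,
      Finset.insert_comm, Finset.insert_union]

/-! ### Reading and extending labellings -/

section Extend

variable {α : Type*}

theorem readLabels_congr {s : Shape} {v : Vertex} {y y' : Vertex → α}
    (h : ∀ u ∈ verts s v, y u = y' u) : readLabels y s v = readLabels y' s v := by
  induction s generalizing v with
  | nil => rfl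
  | node l r hl hr =>
    simp only [verts, Finset.forall_mem_insert, Finset.forall_mem_union] at h
    rw [readLabels, readLabels, h.1, hl h.2.1, hr h.2.2]

/-- The family of labels on the whole tree which is given by `t` on the vertices of the shape `s`
rooted at `v`, and is `d` elsewhere. -/
def extendLabels (d : α) : ∀ s, Vertex → Labels α s → Vertex → α
  | .nil, _, _, _ => d
  | .node l r, v, t, u =>
    if u = v then t.1 else
      if u ∈ verts l (child v false) then extendLabels d l (child v false) t.2.1 u
      else extendLabels d r (child v true) t.2.2 u

theorem extendLabels_of_notMem (d : α) {s : Shape} {v u : Vertex} (t : Labels α s)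
    (h : u ∉ verts s v) : extendLabels d s v t u = d := by
  induction s generalizing v with
  | nil => rfl
  | node l r _ hr =>
    simp only [verts, Finset.mem_insert, Finset.mem_union, not_or] at h
    rw [extendLabels, if_neg h.1, if_neg h.2.1, hr _ h.2.2]

theorem extendLabels_readLabels (d : α) (y : Vertex → α) {s : Shape} {v u : Vertex}
    (h : u ∈ verts s v) : extendLabels d s v (readLabels y s v) u = y u := by
  induction s generalizing v with
  | nil => simp [verts] at h
  | node l r hl hr =>
    simp only [verts, Finset.mem_insert, Finset.mem_union] at h
    simp only [extendLabels, readLabels]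
    split_ifs with hroot hleft
    · rw [hroot]
    · exact hl hleft
    · exact hr ((h.resolve_left hroot).resolve_left hleft)

theorem readLabels_extendLabels (d : α) (s : Shape) (v : Vertex) (t : Labels α s) :
    readLabels (extendLabels d s v t) s v = t := by
  induction s generalizing v with
  | nil => rfl
  | node l r hl hr =>
    have hleft : ∀ u ∈ verts l (child v false),
        extendLabels d (.node l r) v t u = extendLabels d l (child v false) t.2.1 u := by
      intro u hu
      have : u ≠ v := fun h => notMem_verts_child l v false (h ▸ hu)
      rw [extendLabels, if_neg this, if_pos hu]
    have hright : ∀ u ∈ verts r (child v true),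
        extendLabels d (.node l r) v t u = extendLabels d r (child v true) t.2.2 u := by
      intro u hu
      have : u ≠ v := fun h => notMem_verts_child r v true (h ▸ hu)
      rw [extendLabels, if_neg this,
        if_neg (Finset.disjoint_right.1 (disjoint_verts_child l r v) hu)]
    rw [readLabels, readLabels_congr hleft, readLabels_congr hright, hl, hr, extendLabels,
      if_pos rfl]

variable [MeasurableSpace α]

theorem measurable_readLabels {Ω : Type*} [MeasurableSpace Ω] {Y : Vertex → Ω → α}
    (hY : ∀ v, Measurable (Y v)) (s : Shape) (v : Vertex) :
    Measurable fun ω => readLabels (fun u => Y u ω) s v := by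
  induction s generalizing v with
  | nil => exact measurable_const
  | node l r hl hr => exact (hY v).prodMk ((hl _).prodMk (hr _))

theorem measurable_extendLabels (d : α) (s : Shape) (v u : Vertex) :
    Measurable fun t => extendLabels d s v t u := by
  induction s generalizing v with
  | nil => exact measurable_const
  | node l r hl hr =>
    simp only [extendLabels]
    split_ifs
    · exact measurable_fst
    · exact (hl _).comp measurable_snd.fst
    · exact (hr _).comp measurable_snd.snd

end Extend

/-! ### Measurable rectangles of labellings -/

section Rectangles

variable {α : Type*} [MeasurableSpace α]

/-- The set of labellings whose label at each vertex is in the set attached to that vertex. -/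
def labelRect : ∀ s, Labels {S : Set α // MeasurableSet S} s → Set (Labels α s)
  | .nil, _ => Set.univ
  | .node l r, B => (B.1 : Set α) ×ˢ (labelRect l B.2.1 ×ˢ labelRect r B.2.2)

theorem readLabels_mem_labelRect {s : Shape} {v : Vertex}
    {B : Vertex → {S : Set α // MeasurableSet S}} {y : Vertex → α} :
    readLabels y s v ∈ labelRect s (readLabels B s v) ↔ ∀ u ∈ verts s v, y u ∈ (B u : Set α) := by
  induction s generalizing v with
  | nil => simp [labelRect, verts]
  | node l r hl hr =>
    simp only [labelRect, readLabels, verts, Set.mem_prod, hl, hr, Finset.forall_mem_insert,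
      Finset.forall_mem_union]

theorem measurableSet_labelRect (s : Shape) (B : Labels {S : Set α // MeasurableSet S} s) :
    MeasurableSet (labelRect s B) := by
  induction s with
  | nil => exact MeasurableSet.univ
  | node l r hl hr => exact B.1.2.prod ((hl B.2.1).prod (hr B.2.2))

theorem range_labelRect_node (l r : Shape) :
    Set.range (labelRect (α := α) (.node l r)) = Set.image2 (· ×ˢ ·) {S | MeasurableSet S}
      (Set.image2 (· ×ˢ ·) (Set.range (labelRect l)) (Set.range (labelRect r))) := by
  ext R
  constructor
  · rintro ⟨B, rfl⟩
    exact ⟨B.1, B.1.2, _, ⟨_, ⟨B.2.1, rfl⟩, _, ⟨B.2.2, rfl⟩, rfl⟩, rfl⟩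
  · rintro ⟨S, hS, _, ⟨_, ⟨Bl, rfl⟩, _, ⟨Br, rfl⟩, rfl⟩, rfl⟩
    exact ⟨(⟨S, hS⟩, Bl, Br), rfl⟩

theorem univ_mem_range_labelRect (s : Shape) : Set.univ ∈ Set.range (labelRect (α := α) s) := by
  induction s with
  | nil => exact ⟨PUnit.unit, rfl⟩
  | node l r hl hr =>
    rw [range_labelRect_node]
    exact ⟨_, MeasurableSet.univ, _, ⟨_, hl, _, hr, Set.univ_prod_univ⟩, Set.univ_prod_univ⟩

theorem isPiSystem_range_labelRect (s : Shape) :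
    IsPiSystem (Set.range (labelRect (α := α) s)) := by
  induction s with
  | nil =>
    rintro _ ⟨B, rfl⟩ _ ⟨B', rfl⟩ -
    exact ⟨B, (Set.inter_self _).symm⟩
  | node l r hl hr =>
    rw [range_labelRect_node]
    exact MeasurableSpace.isPiSystem_measurableSet.prod (hl.prod hr)

theorem isCountablySpanning_range_labelRect (s : Shape) :
    IsCountablySpanning (Set.range (labelRect (α := α) s)) :=
  ⟨fun _ => Set.univ, fun _ => univ_mem_range_labelRect s, Set.iUnion_const _⟩

theorem generateFrom_range_labelRect (s : Shape) :
    MeasurableSpace.generateFrom (Set.range (labelRect (α := α) s)) =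
      Labels.measurableSpace α s := by
  induction s with
  | nil =>
    refine le_antisymm (MeasurableSpace.generateFrom_le fun _ ⟨B, hB⟩ =>
      hB ▸ measurableSet_labelRect _ B) fun S _ => ?_
    exact Subsingleton.set_cases (α := PUnit) (MeasurableSpace.measurableSet_empty _)
      (MeasurableSpace.measurableSet_generateFrom (univ_mem_range_labelRect _)) S
  | node l r hl hr =>
    rw [range_labelRect_node]
    exact generateFrom_eq_prod MeasurableSpace.generateFrom_measurableSet
      (generateFrom_eq_prod hl hr (isCountablySpanning_range_labelRect l)
        (isCountablySpanning_range_labelRect r)) isCountablySpanning_measurableSet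
      ((isCountablySpanning_range_labelRect l).prod (isCountablySpanning_range_labelRect r))

theorem ext_of_labelRect {s : Shape} {m m' : Measure (Labels α s)} [IsFiniteMeasure m]
    (h : ∀ B, m (labelRect s B) = m' (labelRect s B)) : m = m' := by
  refine ext_of_generate_finite _ (generateFrom_range_labelRect s).symm
    (isPiSystem_range_labelRect s) ?_ ?_
  · rintro _ ⟨B, rfl⟩
    exact h B
  · obtain ⟨B, hB⟩ := univ_mem_range_labelRect (α := α) s
    rw [← hB, h]

end Rectangles

/-! ### The law of a hidden Markov tree process on a shape -/

/-- The number of generations of a shape. -/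
def Shape.depth : Shape → ℕ
  | .nil => 0
  | .node l r => max l.depth r.depth + 1

theorem verts_subset_subtree {s : Shape} {n : ℕ} (h : s.depth ≤ n) (v : Vertex) :
    verts s v ⊆ subtree n v := by
  induction s generalizing n v with
  | nil => simp [verts]
  | node l r hl hr =>
    simp only [Shape.depth] at h
    obtain ⟨m, rfl⟩ : ∃ m, n = m + 1 := ⟨n - 1, by omega⟩
    rw [verts, subtree]
    exact Finset.insert_subset_insert _ (Finset.union_subset_union (hl (by omega) _)
      (hr (by omega) _))

section Laws

variable {𝒳 𝒴 : Type*} [MeasurableSpace 𝒳] [MeasurableSpace 𝒴]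
  (Q : Kernel 𝒳 𝒳) (G : Kernel 𝒳 𝒴)

theorem obsLaw_apply (m : Measure 𝒳) (s : Shape) {R : Set (Labels 𝒴 s)} (hR : MeasurableSet R) :
    obsLaw Q G m s R = ∫⁻ x, obsKernel Q G s x R ∂m :=
  Measure.bind_apply hR (Kernel.aemeasurable _)

variable [IsMarkovKernel Q]

theorem obsKernel_labelRect_node [IsMarkovKernel G] {l r : Shape} (x : 𝒳)
    (B : Labels {S : Set 𝒴 // MeasurableSet S} (.node l r)) :
    obsKernel Q G (.node l r) x (labelRect _ B) =
      G x B.1 * ((∫⁻ z, obsKernel Q G l z (labelRect l B.2.1) ∂Q x) *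
        ∫⁻ z, obsKernel Q G r z (labelRect r B.2.2) ∂Q x) := by
  rw [obsKernel_node_apply, labelRect, Measure.prod_prod, Measure.prod_prod,
    obsLaw_apply Q G _ _ (measurableSet_labelRect l _),
    obsLaw_apply Q G _ _ (measurableSet_labelRect r _)]

theorem branchMass_eq_one {A : Vertex → Set 𝒳} {n : ℕ} {v : Vertex}
    (h : ∀ u ∈ subtree n v, A u = Set.univ) (x : 𝒳) : branchMass Q A n v x = 1 := by
  induction n generalizing v x with
  | zero => simp [branchMass, h v (by simp [subtree])]
  | succ n ih =>
    simp only [subtree, Finset.mem_insert, Finset.mem_union] at h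
    simp [branchMass, h v (.inl rfl), ih fun u hu => h u (.inr (.inl hu)),
      ih fun u hu => h u (.inr (.inr hu))]

theorem mem_verts_child_of_mem_subtree {l r : Shape} {n : ℕ} {v u : Vertex} {b : Bool}
    (hu : u ∈ subtree n (child v b)) (h : u ∈ verts (.node l r) v) :
    u ∈ verts (if b then r else l) (child v b) := by
  rw [subtree_eq_verts] at hu
  simp only [verts, Finset.mem_insert, Finset.mem_union] at h
  rcases h with rfl | h | h
  · exact absurd hu (notMem_verts_child _ _ b)
  · cases b
    · exact h
    · exact absurd hu (Finset.disjoint_left.1 (disjoint_verts_child _ _ v) h)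
  · cases b
    · exact absurd h (Finset.disjoint_left.1 (disjoint_verts_child _ _ v) hu)
    · exact h

theorem branchMass_eq_obsKernel (A : Vertex → {S : Set 𝒳 // MeasurableSet S}) {s : Shape} {n : ℕ}
    (hn : s.depth ≤ n) {v : Vertex}
    (hA : ∀ u ∈ subtree n v, u ∉ verts s v → (A u : Set 𝒳) = Set.univ) (x : 𝒳) :
    branchMass Q (fun u => A u) n v x =
      obsKernel Q Kernel.id s x (labelRect s (readLabels A s v)) := by
  induction s generalizing n v x with
  | nil =>
    rw [branchMass_eq_one Q fun u hu => hA u hu (by simp [verts])]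
    simp [obsKernel, labelRect]
  | node l r hl hr =>
    simp only [Shape.depth] at hn
    obtain ⟨m, rfl⟩ : ∃ m, n = m + 1 := ⟨n - 1, by omega⟩
    have hleft := fun z => hl (n := m) (by omega) (v := child v false)
      (fun u hu hu' => hA u (by simp [subtree, hu]) fun h =>
        hu' (mem_verts_child_of_mem_subtree hu h)) z
    have hright := fun z => hr (n := m) (by omega) (v := child v true)
      (fun u hu hu' => hA u (by simp [subtree, hu]) fun h =>
        hu' (mem_verts_child_of_mem_subtree hu h)) z
    rw [obsKernel_labelRect_node, readLabels, Kernel.id_apply, Measure.dirac_apply' _ (A v).2,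
      branchMass, Fintype.prod_bool, mul_comm (∫⁻ _, _ ∂_)]
    simp only [hleft, hright]

section RectProb

variable {Q G}

/-- The conditional probability, given the hidden states, that the observations lie in a
measurable rectangle: the product of the `G (x_u) (B_u)` over the vertices `u` of the shape. -/
noncomputable def rectProb (G : Kernel 𝒳 𝒴) :
    ∀ s, Labels {S : Set 𝒴 // MeasurableSet S} s → Labels 𝒳 s → ℝ≥0∞
  | .nil, _, _ => 1
  | .node l r, B, t => G t.1 B.1 * (rectProb G l B.2.1 t.2.1 * rectProb G r B.2.2 t.2.2)

theorem measurable_rectProb (s : Shape) (B : Labels {S : Set 𝒴 // MeasurableSet S} s) :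
    Measurable (rectProb G s B) := by
  induction s with
  | nil => exact measurable_const
  | node l r hl hr =>
    exact ((Kernel.measurable_coe G B.1.2).comp measurable_fst).mul
      (((hl _).comp measurable_snd.fst).mul ((hr _).comp measurable_snd.snd))

theorem rectProb_readLabels (A : Vertex → {S : Set 𝒴 // MeasurableSet S}) (s : Shape) (v : Vertex)
    (x : Vertex → 𝒳) :
    rectProb G s (readLabels A s v) (readLabels x s v) = ∏ u ∈ verts s v, G (x u) (A u) := by
  induction s generalizing v with
  | nil => simp [rectProb, verts]
  | node l r hl hr =>
    rw [verts, Finset.prod_insert (notMem_verts_union l r v),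
      Finset.prod_union (disjoint_verts_child l r v), rectProb, readLabels, readLabels, hl, hr]

variable (Q G) in
theorem lintegral_rectProb [IsMarkovKernel G] (s : Shape)
    (B : Labels {S : Set 𝒴 // MeasurableSet S} s) (x : 𝒳) :
    ∫⁻ t, rectProb G s B t ∂obsKernel Q Kernel.id s x = obsKernel Q G s x (labelRect s B) := by
  induction s generalizing x with
  | nil => simp [obsKernel, labelRect, rectProb]
  | node l r hl hr =>
    have mG := Kernel.measurable_coe G B.1.2
    have ml := measurable_rectProb (G := G) l B.2.1
    have mr := measurable_rectProb (G := G) r B.2.2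
    calc
      _ = (∫⁻ z, G z B.1 ∂Measure.dirac x) *
          ((∫⁻ t, rectProb G l B.2.1 t ∂obsLaw Q Kernel.id (Q x) l) *
            ∫⁻ t, rectProb G r B.2.2 t ∂obsLaw Q Kernel.id (Q x) r) := by
        rw [obsKernel_node_apply, Kernel.id_apply,
          ← lintegral_prod_mul ml.aemeasurable mr.aemeasurable]
        exact lintegral_prod_mul mG.aemeasurable
          ((ml.comp measurable_fst).mul (mr.comp measurable_snd)).aemeasurable
      _ = _ := by
        rw [lintegral_dirac' _ mG, obsKernel_labelRect_node, obsLaw, obsLaw,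
          Measure.lintegral_bind (Kernel.aemeasurable _) ml.aemeasurable,
          Measure.lintegral_bind (Kernel.aemeasurable _) mr.aemeasurable]
        simp only [hl, hr]

end RectProb

/-- The family of measurable sets which is given by `B` on the vertices of the shape `s` rooted at
`v`, and is the whole space elsewhere. -/
def extendRect (s : Shape) (v : Vertex) (B : Labels {S : Set 𝒴 // MeasurableSet S} s) :
    Vertex → {S : Set 𝒴 // MeasurableSet S} :=
  extendLabels ⟨Set.univ, MeasurableSet.univ⟩ s v B

theorem extendRect_of_notMem {s : Shape} {v u : Vertex}
    (B : Labels {S : Set 𝒴 // MeasurableSet S} s) (h : u ∉ verts s v) :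
    (extendRect s v B u : Set 𝒴) = Set.univ := by
  rw [extendRect, extendLabels_of_notMem _ _ h]

theorem forall_mem_extendRect_iff (s : Shape) (v : Vertex)
    (B : Labels {S : Set 𝒴 // MeasurableSet S} s) (y : Vertex → 𝒴) :
    (∀ u ∈ subtree s.depth v, y u ∈ (extendRect s v B u : Set 𝒴)) ↔
      readLabels y s v ∈ labelRect s B := by
  rw [← readLabels_extendLabels ⟨Set.univ, MeasurableSet.univ⟩ s v B, readLabels_mem_labelRect,
    readLabels_extendLabels]
  refine ⟨fun h u hu => h u (verts_subset_subtree le_rfl v hu), fun h u _ => ?_⟩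
  by_cases hu : u ∈ verts s v
  · exact h u hu
  · rw [extendRect_of_notMem B hu]
    trivial

variable {Q G} {Ω : Type*} [MeasurableSpace Ω] {ν : Measure 𝒳} {P : Measure Ω} [IsFiniteMeasure P]
  {X : Vertex → Ω → 𝒳} {Y : Vertex → Ω → 𝒴} {v : Vertex}

theorem IsBranchingMarkov.map_readLabels (h : IsBranchingMarkov v Q ν X P) (s : Shape) :
    P.map (fun ω => readLabels (fun u => X u ω) s v) = obsLaw Q Kernel.id ν s := by
  refine ext_of_labelRect fun B => ?_
  rw [Measure.map_apply (measurable_readLabels h.measurable s v) (measurableSet_labelRect s B),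
    obsLaw_apply _ _ _ _ (measurableSet_labelRect s B)]
  calc
    _ = P {ω | ∀ u ∈ subtree s.depth v, X u ω ∈ (extendRect s v B u : Set 𝒳)} := by
      simp only [forall_mem_extendRect_iff]
      rfl
    _ = ∫⁻ x, branchMass Q (fun u => extendRect s v B u) s.depth v x ∂ν :=
      h.law _ _ fun u => (extendRect s v B u).2
    _ = _ := lintegral_congr fun x => by
      rw [branchMass_eq_obsKernel Q _ le_rfl fun u _ => extendRect_of_notMem B, extendRect,
        readLabels_extendLabels]

theorem IsHMT.map_readLabels [IsMarkovKernel G] (h : IsHMT v Q G ν X Y P) (s : Shape) :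
    P.map (fun ω => readLabels (fun u => Y u ω) s v) = obsLaw Q G ν s := by
  refine ext_of_labelRect fun B => ?_
  have hprod : ∀ ω, ∏ u ∈ subtree s.depth v,
      (Set.univ : Set 𝒳).indicator 1 (X u ω) * G (X u ω) (extendRect s v B u) =
        rectProb G s B (readLabels (fun u => X u ω) s v) := fun ω => by
    rw [← readLabels_extendLabels ⟨Set.univ, MeasurableSet.univ⟩ s v B, rectProb_readLabels,
      readLabels_extendLabels,
      ← Finset.prod_subset (verts_subset_subtree le_rfl v) fun u _ hu => by
        simp [extendRect_of_notMem B hu]]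
    simp [extendRect]
  rw [Measure.map_apply (measurable_readLabels h.measurable s v) (measurableSet_labelRect s B),
    obsLaw_apply _ _ _ _ (measurableSet_labelRect s B)]
  calc
    _ = P {ω | ∀ u ∈ subtree s.depth v,
        X u ω ∈ Set.univ ∧ Y u ω ∈ (extendRect s v B u : Set 𝒴)} := by
      simp only [Set.mem_univ, true_and, forall_mem_extendRect_iff]
      rfl
    _ = ∫⁻ ω, rectProb G s B (readLabels (fun u => X u ω) s v) ∂P := by
      simp only [← hprod]
      exact h.observed _ _ _ (fun _ => MeasurableSet.univ) fun u => (extendRect s v B u).2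
    _ = ∫⁻ x, ∫⁻ t, rectProb G s B t ∂obsKernel Q Kernel.id s x ∂ν := by
      rw [← Measure.lintegral_bind (Kernel.aemeasurable _) (measurable_rectProb s B).aemeasurable,
        ← obsLaw, ← h.hidden.map_readLabels,
        lintegral_map (measurable_rectProb s B) (measurable_readLabels h.hidden.measurable s v)]
    _ = _ := lintegral_congr fun x => lintegral_rectProb Q G s B x

end Laws

/-! ### Averages over the random plane order -/

section SpineAverage

theorem pastShape_congr {k : ℕ} {U U' : ℕ → Bool} (h : ∀ i < k, U i = U' i) :
    pastShape U k = pastShape U' k ∧ pastStarShape U k = pastStarShape U' k := by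
  induction k with
  | zero => exact ⟨rfl, rfl⟩
  | succ k ih =>
    obtain ⟨hpast, hstar⟩ := ih fun i hi => h i (hi.trans k.lt_succ_self)
    simp only [pastShape, pastStarShape, hpast, hstar, h k k.lt_succ_self, and_self]

theorem exists_pastShape_eq (k : ℕ) : ∃ S S' : (Fin k → Bool) → Shape, ∀ U : ℕ → Bool,
    pastShape U k = S (fun i => U i) ∧ pastStarShape U k = S' fun i => U i := by
  let extend (b : Fin k → Bool) (i : ℕ) : Bool := if h : i < k then b ⟨i, h⟩ else false
  exact ⟨fun b => pastShape (extend b) k, fun b => pastStarShape (extend b) k, fun U =>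
    pastShape_congr fun i hi => by simp [extend, hi]⟩

theorem measurable_pastShape_comp {α β : Type*} [MeasurableSpace α] [MeasurableSpace β] (k : ℕ)
    {F : Shape → Shape → β → α} (hF : ∀ s s', Measurable (F s s')) :
    Measurable fun p : (ℕ → Bool) × β => F (pastShape p.1 k) (pastStarShape p.1 k) p.2 := by
  obtain ⟨S, S', h⟩ := exists_pastShape_eq k
  simp only [h]
  have hprefix : Measurable fun p : (ℕ → Bool) × β => ((fun i : Fin k => p.1 i), p.2) := by fun_prop
  exact (measurable_from_prod_countable_right (f := fun q : (Fin k → Bool) × β =>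
    F (S q.1) (S' q.1) q.2) fun b => hF (S b) (S' b)).comp hprefix

theorem integrable_pastShape_comp (k : ℕ) (D : Shape → Shape → ℝ) :
    Integrable (fun U => D (pastShape U k) (pastStarShape U k)) spineLaw := by
  obtain ⟨S, S', h⟩ := exists_pastShape_eq k
  simp only [h]
  have hprefix : Measurable fun (U : ℕ → Bool) (i : Fin k) => U i := by fun_prop
  have := Measure.isProbabilityMeasure_map (μ := spineLaw) hprefix.aemeasurable
  exact (Integrable.of_finite (f := fun b => D (S b) (S' b))).comp_measurable hprefix

/-- The exchange of the two children of the `(k + 1)`-st ancestor of the root. -/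
def flipBit (k : ℕ) (U : ℕ → Bool) (i : ℕ) : Bool := if i = k then !U i else U i

theorem measurePreserving_flipBit (k : ℕ) : MeasurePreserving (flipBit k) spineLaw spineLaw := by
  have hm : ∀ i, Measurable (fun b : Bool => if i = k then !b else b) := fun i =>
    measurable_of_countable _
  refine ⟨measurable_pi_iff.2 fun i => (hm i).comp (measurable_pi_apply i), ?_⟩
  unfold spineLaw
  refine (Measure.infinitePi_map_pi (μ := fun _ : ℕ => (PMF.uniformOfFintype Bool).toMeasure)
    hm).trans ?_
  congr 1
  funext i
  split_ifs
  · rw [PMF.toMeasure_map _ _ (measurable_of_countable _)]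
    congr 1
    ext b
    cases b <;> simp [PMF.map_apply]
  · exact Measure.map_id

theorem integral_add_flipBit (k : ℕ) {f : (ℕ → Bool) → ℝ} (hf : Integrable f spineLaw) :
    ∫ U, (f U + f (flipBit k U)) ∂spineLaw = 2 * ∫ U, f U ∂spineLaw := by
  have hflip := measurePreserving_flipBit k
  have hf' : Integrable (fun U => f (flipBit k U)) spineLaw :=
    hflip.integrable_comp_of_integrable hf
  rw [integral_add hf hf', two_mul]
  congr 1
  conv_rhs => rw [← hflip.map_eq]
  exact (integral_map hflip.aemeasurable
    (by rw [hflip.map_eq]; exact hf.aestronglyMeasurable)).symm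

theorem integral_pastShape_succ (k : ℕ) (D : Shape → Shape → ℝ) :
    2 * ∫ U, D (pastShape U (k + 1)) (pastStarShape U (k + 1)) ∂spineLaw =
      ∫ U, D (.node (pastShape U k) (.full (k + 1)))
        (.node (pastStarShape U k) (.full (k + 1))) ∂spineLaw +
      ∫ U, D (.node (pastShape U k) (.full k)) (.node (pastStarShape U k) (.full k)) ∂spineLaw := by
  rw [← integral_add_flipBit k (integrable_pastShape_comp (k + 1) D), ← integral_add
    (integrable_pastShape_comp k fun s s' => D (.node s (.full (k + 1))) (.node s' (.full (k + 1))))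
    (integrable_pastShape_comp k fun s s' => D (.node s (.full k)) (.node s' (.full k)))]
  congr 1
  funext U
  have hflip : flipBit k U k = !U k := if_pos rfl
  obtain ⟨hpast, hstar⟩ := pastShape_congr (U := flipBit k U) (U' := U) (k := k)
    fun i hi => if_neg hi.ne
  simp only [pastShape, pastStarShape, hpast, hstar, hflip]
  cases U k
  · simp [add_comm]
  · simp

-- Each of the `2 ^ k` positions of the last generation of `full (k + 1)` is equally likely, and the
-- increments along that generation telescope.
theorem integral_pastShape_sub (k : ℕ) {A : Shape → ℝ} (hA : ∀ s s', s.Swap s' → A s = A s') :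
    ∫ U, (A (pastShape U k) - A (pastStarShape U k)) ∂spineLaw =
      (2 ^ k)⁻¹ * (A (.full (k + 1)) - A (.full k)) := by
  induction k generalizing A with
  | zero => simp [pastShape, pastStarShape, Shape.full]
  | succ k ih =>
    have h := integral_pastShape_succ k fun s s' => A s - A s'
    rw [ih (A := fun s => A (.node s (.full (k + 1)))) fun s s' h => hA _ _ (.left _ h),
      ih (A := fun s => A (.node s (.full k))) fun s s' h => hA _ _ (.left _ h),
      hA (.node (.full (k + 1)) (.full k)) _ (.swap _ _), ← mul_add, sub_add_sub_cancel] at h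
    change _ = (2 ^ (k + 1))⁻¹ *
      (A (.node (.full (k + 1)) (.full (k + 1))) - A (.node (.full k) (.full k)))
    rw [pow_succ', mul_inv, mul_assoc, ← h, inv_mul_cancel_left₀ two_ne_zero]

end SpineAverage

/-! ### The increment with infinite past -/

/-- The limit of the increments at the root, when the hidden state at the ancestor `p^k(∂)` has law
`m` for every `k`. -/
noncomputable def incrementLimit {𝒳 𝒴 : Type*} [MeasurableSpace 𝒳] (Q : Kernel 𝒳 𝒳)
    (g : 𝒳 → 𝒴 → ℝ≥0∞) (U : ℕ → Bool) (y : Vertex → 𝒴) (m : Measure 𝒳) : ℝ :=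
  limUnder atTop fun k => increment Q g U y k m

/-- The expected log-likelihood, on a shape, of the model `(Q, g, ν)` under the law of the model
`(Q', G', ν')`. -/
noncomputable def expLogLik {𝒳 𝒴 : Type*} [MeasurableSpace 𝒳] [MeasurableSpace 𝒴]
    (Q : Kernel 𝒳 𝒳) (g : 𝒳 → 𝒴 → ℝ≥0∞) (ν : Measure 𝒳)
    (Q' : Kernel 𝒳 𝒳) (G' : Kernel 𝒳 𝒴) (ν' : Measure 𝒳) (s : Shape) : ℝ :=
  ∫ t, logMeanLik Q g ν s t ∂obsLaw Q' G' ν' s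

section StationaryLaw

variable {𝒳 𝒴 Ω : Type*} [MeasurableSpace 𝒳] [MeasurableSpace 𝒴] [MeasurableSpace Ω]
  {Q : Kernel 𝒳 𝒳} {G : Kernel 𝒳 𝒴} {ν : Measure 𝒳} {X : Vertex → Ω → 𝒳} {Y : Vertex → Ω → 𝒴}
  {P : Measure Ω}

theorem IsStationaryHMT.measurable_obs (h : IsStationaryHMT Q G ν X Y P) (v : Vertex) :
    Measurable (Y v) :=
  (h.isHMT 0).measurable v

variable [IsMarkovKernel Q] [IsMarkovKernel G] [IsFiniteMeasure P]

theorem IsStationaryHMT.measurePreserving_readLabels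
    (h : IsStationaryHMT Q G ν X Y P) (k : ℕ) (s : Shape) :
    MeasurePreserving (fun ω => readLabels (fun u => Y u ω) s (parent^[k] root)) P
      (obsLaw Q G ν s) :=
  ⟨measurable_readLabels h.measurable_obs s _, (h.isHMT k).map_readLabels s⟩

theorem IsStationaryHMT.measurePreserving_root
    (h : IsStationaryHMT Q G ν X Y P) : MeasurePreserving (Y root) P (G ∘ₘ ν) :=
  (measurePreserving_root_obsLaw Q G .nil .nil ν).comp
    (h.measurePreserving_readLabels 0 (.node .nil .nil))

end StationaryLaw

namespace IsMixing

section Limit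

variable {𝒳 𝒴 Ω : Type*} [MeasurableSpace 𝒳] [MeasurableSpace 𝒴] [MeasurableSpace Ω]
  {Q : Kernel 𝒳 𝒳} {g : 𝒳 → 𝒴 → ℝ≥0∞} {lam : Measure 𝒳} {σm σp b : ℝ≥0}
  {m m' : Measure 𝒳} {Y : Vertex → Ω → 𝒴}

theorem measurable_increment [IsMarkovKernel Q] (h : IsMixing Q g lam σm σp b)
    (hY : ∀ v, Measurable (Y v)) (k : ℕ) (m : Measure 𝒳) [SFinite m] :
    Measurable fun s : (ℕ → Bool) × Ω => increment Q g s.1 (fun v => Y v s.2) k m :=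
  measurable_pastShape_comp k (F := fun s s' ω =>
    logMeanLik Q g m s (readLabels (fun v => Y v ω) s (parent^[k] root)) -
      logMeanLik Q g m s' (readLabels (fun v => Y v ω) s' (parent^[k] root))) fun s s' =>
    ((h.measurable_logMeanLik m s).comp (measurable_readLabels hY s _)).sub
      ((h.measurable_logMeanLik m s').comp (measurable_readLabels hY s' _))

variable [IsProbabilityMeasure lam]

theorem measurable_logBound (h : IsMixing Q g lam σm σp b) : Measurable (logBound lam g σm b) := by
  have href : Measurable (refLik lam g) := h.measurable_g.lintegral_prod_left'
  unfold logBound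
  fun_prop

theorem tendsto_rate (h : IsMixing Q g lam σm σp b) :
    Tendsto (fun k : ℕ => ((σp : ℝ) - σm) / σm * (1 - σm / σp) ^ k) atTop (𝓝 0) := by
  have hσm : (0 : ℝ) < σm := h.pos
  have hσ : (σm : ℝ) ≤ σp := h.le
  have hpos : (0 : ℝ) < σm / σp := div_pos hσm (hσm.trans_le hσ)
  have hle : (σm : ℝ) / σp ≤ 1 := div_le_one_of_le₀ hσ (hσm.le.trans hσ)
  simpa using (tendsto_pow_atTop_nhds_zero_of_lt_one (r := 1 - (σm : ℝ) / σp) (by linarith)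
    (by linarith)).const_mul (((σp : ℝ) - σm) / σm)

variable [IsMarkovKernel Q] [IsProbabilityMeasure m] [IsProbabilityMeasure m']

theorem cauchySeq_increment (h : IsMixing Q g lam σm σp b) (U : ℕ → Bool) (y : Vertex → 𝒴)
    (m : Measure 𝒳) [IsProbabilityMeasure m] :
    CauchySeq fun k => increment Q g U y (k + 1) m :=
  cauchySeq_of_le_tendsto_0 _ (fun _ _ _ h₁ h₂ =>
    h.abs_increment_sub_le U y (Nat.lt_succ_of_le h₁) (Nat.lt_succ_of_le h₂) m m) h.tendsto_rate

theorem abs_increment_sub_incrementLimit_le (h : IsMixing Q g lam σm σp b) (U : ℕ → Bool)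
    (y : Vertex → 𝒴) (k : ℕ) :
    |increment Q g U y (k + 1) m' - incrementLimit Q g U y m| ≤
      (σp - σm) / σm * (1 - σm / σp) ^ k := by
  have hlim : Tendsto (fun k => increment Q g U y k m) atTop (𝓝 (incrementLimit Q g U y m)) :=
    (cauchySeq_tendsto_of_complete (h.cauchySeq_increment U y m)).elim fun L hL =>
      tendsto_nhds_limUnder ⟨L, (tendsto_add_atTop_iff_nat 1).1 hL⟩
  refine le_of_tendsto (tendsto_const_nhds.sub hlim).abs ?_
  filter_upwards [eventually_gt_atTop k] with n hn
  exact h.abs_increment_sub_le U y k.lt_succ_self hn m' m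

theorem tendsto_increment (h : IsMixing Q g lam σm σp b) (U : ℕ → Bool) (y : Vertex → 𝒴) :
    Tendsto (fun k => increment Q g U y k m') atTop (𝓝 (incrementLimit Q g U y m)) := by
  rw [← tendsto_add_atTop_iff_nat 1, tendsto_iff_dist_tendsto_zero]
  exact squeeze_zero (fun _ => dist_nonneg) (h.abs_increment_sub_incrementLimit_le U y)
    h.tendsto_rate

theorem measurable_incrementLimit (h : IsMixing Q g lam σm σp b) (hY : ∀ v, Measurable (Y v)) :
    Measurable fun s : (ℕ → Bool) × Ω => incrementLimit Q g s.1 (fun v => Y v s.2) m :=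
  measurable_of_tendsto_metrizable (fun k => h.measurable_increment hY k m)
    (tendsto_pi_nhds.2 fun _ => h.tendsto_increment _ _)

variable {P : Measure Ω} [IsProbabilityMeasure P]

theorem integrable_increment (h : IsMixing Q g lam σm σp b) (hY : ∀ v, Measurable (Y v))
    (hint : Integrable (fun ω => logBound lam g σm b (Y root ω)) P) (k : ℕ) (m : Measure 𝒳)
    [IsProbabilityMeasure m] :
    Integrable (fun s : (ℕ → Bool) × Ω => increment Q g s.1 (fun v => Y v s.2) (k + 1) m)
      (spineLaw.prod P) :=
  ((hint.comp_snd spineLaw).add (integrable_const (Real.log (σp / σm)))).mono'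
    (h.measurable_increment hY _ m).aestronglyMeasurable
    (ae_of_all _ fun s => h.abs_increment_le s.1 (fun v => Y v s.2) k m)

theorem integrable_incrementLimit (h : IsMixing Q g lam σm σp b) (hY : ∀ v, Measurable (Y v))
    (hint : Integrable (fun ω => logBound lam g σm b (Y root ω)) P) :
    Integrable (fun s : (ℕ → Bool) × Ω => incrementLimit Q g s.1 (fun v => Y v s.2) m)
      (spineLaw.prod P) :=
  ((hint.comp_snd spineLaw).add (integrable_const (Real.log (σp / σm)))).mono'
    (h.measurable_incrementLimit hY).aestronglyMeasurable
    (ae_of_all _ fun s => le_of_tendsto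
      ((tendsto_add_atTop_iff_nat 1).2 (h.tendsto_increment (m := m) (m' := m) s.1 _)).abs
      (Eventually.of_forall fun k => h.abs_increment_le s.1 (fun v => Y v s.2) k m))

theorem tendsto_eLpNorm_increment_sub (h : IsMixing Q g lam σm σp b) (Y : Vertex → Ω → 𝒴) :
    Tendsto (fun k : ℕ => eLpNorm (fun s : (ℕ → Bool) × Ω =>
      increment Q g s.1 (fun v => Y v s.2) k m' -
        incrementLimit Q g s.1 (fun v => Y v s.2) m) 1 (spineLaw.prod P)) atTop (𝓝 0) := by
  rw [← tendsto_add_atTop_iff_nat 1]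
  have hrate : Tendsto (fun k : ℕ => ENNReal.ofReal ((σp - σm) / σm * (1 - σm / σp) ^ k)) atTop
      (𝓝 0) := by
    simpa using ENNReal.tendsto_ofReal h.tendsto_rate
  refine tendsto_of_tendsto_of_tendsto_of_le_of_le tendsto_const_nhds hrate (fun _ => zero_le)
    fun k => ?_
  simpa using eLpNorm_le_of_ae_bound (p := 1) (μ := spineLaw.prod P) (ae_of_all _
    fun s : (ℕ → Bool) × Ω =>
      h.abs_increment_sub_incrementLimit_le (m := m) (m' := m') s.1 (fun v => Y v s.2) k)

theorem tendsto_integral_increment (h : IsMixing Q g lam σm σp b) (hY : ∀ v, Measurable (Y v))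
    (hint : Integrable (fun ω => logBound lam g σm b (Y root ω)) P) :
    Tendsto (fun k : ℕ => ∫ s, increment Q g s.1 (fun v => Y v s.2) k m' ∂(spineLaw.prod P)) atTop
      (𝓝 (∫ s, incrementLimit Q g s.1 (fun v => Y v s.2) m ∂(spineLaw.prod P))) := by
  rw [← tendsto_add_atTop_iff_nat 1]
  exact tendsto_integral_of_L1' _ (h.integrable_incrementLimit hY hint).aestronglyMeasurable
    (Eventually.of_forall fun k => h.integrable_increment hY hint k m')
    ((tendsto_add_atTop_iff_nat 1).2 (h.tendsto_eLpNorm_increment_sub Y))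

end Limit

section Expectation

variable {𝒳 𝒴 Ω : Type*} [MeasurableSpace 𝒳] [MeasurableSpace 𝒴] [MeasurableSpace Ω]
  {Q : Kernel 𝒳 𝒳} [IsMarkovKernel Q] {g : 𝒳 → 𝒴 → ℝ≥0∞} {lam : Measure 𝒳}
  {σm σp b : ℝ≥0} {ν : Measure 𝒳} [IsProbabilityMeasure ν]
  {Q' : Kernel 𝒳 𝒳} [IsMarkovKernel Q'] {G' : Kernel 𝒳 𝒴} [IsMarkovKernel G'] {ν' : Measure 𝒳}

theorem expLogLik_swap (h : IsMixing Q g lam σm σp b) {s s' : Shape} (hs : s.Swap s') :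
    expLogLik Q g ν Q' G' ν' s = expLogLik Q g ν Q' G' ν' s' := by
  obtain ⟨σ, hσ⟩ := hs.exists_isSwapMap (𝒴 := 𝒴) 𝒳
  rw [expLogLik, expLogLik, ← hσ.map_obsLaw Q' G' ν', integral_map hσ.measurable.aemeasurable
    (h.measurable_logMeanLik ν s').aestronglyMeasurable]
  simp only [logMeanLik, hσ.meanLik_comp]

variable [IsProbabilityMeasure lam] {X : Vertex → Ω → 𝒳} {Y : Vertex → Ω → 𝒴} {P : Measure Ω}
  [IsProbabilityMeasure P]

theorem integral_increment (h : IsMixing Q g lam σm σp b) (hν : Kernel.Invariant Q ν)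
    (h' : IsStationaryHMT Q' G' ν' X Y P)
    (hint : Integrable (fun ω => logBound lam g σm b (Y root ω)) P) (k : ℕ) :
    ∫ s, increment Q g s.1 (fun v => Y v s.2) (k + 1) ν ∂(spineLaw.prod P) =
      (2 ^ (k + 1))⁻¹ * (expLogLik Q g ν Q' G' ν' (.full (k + 2)) -
        expLogLik Q g ν Q' G' ν' (.full (k + 1))) := by
  have hread := fun s => h'.measurePreserving_readLabels (k + 1) s
  have hint' : Integrable (logBound lam g σm b) (G' ∘ₘ ν') :=
    (h'.measurePreserving_root.integrable_comp
      h.measurable_logBound.aestronglyMeasurable).1 hint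
  have hmeas := fun s => (h.measurable_logMeanLik ν s).aestronglyMeasurable
    (μ := obsLaw Q' G' ν' s)
  have hlog : ∀ s, Integrable (fun ω => logMeanLik Q g ν s
      (readLabels (fun u => Y u ω) s (parent^[k + 1] root))) P := fun s =>
    (hread s).integrable_comp_of_integrable (h.integrable_logMeanLik hν h'.invariant hint' s)
  have hexp : ∀ s, ∫ ω, logMeanLik Q g ν s (readLabels (fun u => Y u ω) s (parent^[k + 1] root)) ∂P
      = expLogLik Q g ν Q' G' ν' s := fun s => by
    rw [expLogLik, ← (hread s).map_eq, integral_map (hread s).aemeasurable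
      (by rw [(hread s).map_eq]; exact hmeas s)]
  rw [integral_prod _ (h.integrable_increment h'.measurable_obs hint k ν),
    ← integral_pastShape_sub (k + 1) fun s s' hs => h.expLogLik_swap hs]
  congr 1
  funext U
  simp only [increment]
  rw [integral_sub (hlog _) (hlog _), hexp, hexp]

theorem tendsto_expLogLik_sub (h : IsMixing Q g lam σm σp b) (hν : Kernel.Invariant Q ν)
    (h' : IsStationaryHMT Q' G' ν' X Y P)
    (hint : Integrable (fun ω => logBound lam g σm b (Y root ω)) P) (m : Measure 𝒳)
    [IsProbabilityMeasure m] :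
    Tendsto (fun k : ℕ => ((2 : ℝ) ^ k)⁻¹ * (expLogLik Q g ν Q' G' ν' (.full (k + 1)) -
      expLogLik Q g ν Q' G' ν' (.full k))) atTop
      (𝓝 (∫ s, incrementLimit Q g s.1 (fun v => Y v s.2) m ∂(spineLaw.prod P))) := by
  rw [← tendsto_add_atTop_iff_nat 1]
  refine ((tendsto_add_atTop_iff_nat 1).2
    (h.tendsto_integral_increment (m' := ν) h'.measurable_obs hint)).congr fun k => ?_
  exact h.integral_increment hν h' hint k

end Expectation

end IsMixing

/-! ### Relative entropy -/

section RelativeEntropy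

open InformationTheory

variable {α : Type*} [MeasurableSpace α]

-- Gibbs' inequality for `μ` and the tilting of `ν` by `f`.
theorem integral_le_toReal_klDiv_add_log {μ ν : Measure α} [IsProbabilityMeasure μ]
    [IsProbabilityMeasure ν] (hμν : μ ≪ ν) (hllr : Integrable (llr μ ν) μ) {f : α → ℝ}
    (hf : Integrable f μ) (hexp : Integrable (fun t => Real.exp (f t)) ν) :
    ∫ t, f t ∂μ ≤ (klDiv μ ν).toReal + Real.log (∫ t, Real.exp (f t) ∂ν) := by
  have := isProbabilityMeasure_tilted hexp
  have hac : μ ≪ ν.tilted f := hμν.trans (absolutelyContinuous_tilted hexp)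
  have hgibbs := integral_llr_add_sub_measure_univ_nonneg hac
    (integrable_llr_tilted_right hμν hf hllr hexp)
  rw [probReal_univ, probReal_univ, add_sub_cancel_right,
    integral_llr_tilted_right hμν hf hexp hllr] at hgibbs
  rw [toReal_klDiv_of_measure_eq hμν (by simp)]
  linarith

theorem integral_le_toReal_klDiv_add_log_of_lintegral_le {μ ν : Measure α}
    [IsProbabilityMeasure μ] [IsProbabilityMeasure ν] (hμν : μ ≪ ν)
    (hllr : Integrable (llr μ ν) μ) {f : α → ℝ} (hfm : Measurable f) (hf : Integrable f μ)
    {C : ℝ≥0} (hexp : ∫⁻ t, ENNReal.ofReal (Real.exp (f t)) ∂ν ≤ C) :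
    ∫ t, f t ∂μ ≤ (klDiv μ ν).toReal + Real.log C := by
  have hint : Integrable (fun t => Real.exp (f t)) ν :=
    (lintegral_ofReal_ne_top_iff_integrable hfm.exp.aestronglyMeasurable
      (ae_of_all _ fun t => (Real.exp_pos _).le)).1 (ne_top_of_le_ne_top ENNReal.coe_ne_top hexp)
  have hle : ∫ t, Real.exp (f t) ∂ν ≤ C := by
    rw [integral_eq_lintegral_of_nonneg_ae (ae_of_all _ fun t => (Real.exp_pos _).le)
      hfm.exp.aestronglyMeasurable]
    exact ENNReal.toReal_le_coe_of_le_coe hexp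
  have hlog := Real.log_le_log (integral_exp_pos hint) hle
  linarith [integral_le_toReal_klDiv_add_log hμν hllr hf hint]

variable {ρ : Measure α} {p p' : α → ℝ≥0∞}

theorem withDensity_withDensity_div (hp : Measurable p) (hp' : Measurable p')
    (h0 : ∀ t, p t ≠ 0) (htop : ∀ t, p t ≠ ∞) :
    (ρ.withDensity p).withDensity (p' / p) = ρ.withDensity p' := by
  rw [← withDensity_mul _ hp (hp'.div hp)]
  congr 1
  funext t
  exact ENNReal.mul_div_cancel (h0 t) (htop t)

theorem llr_withDensity_ae_eq (hp : Measurable p) (hp' : Measurable p')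
    (h0 : ∀ t, p t ≠ 0) (htop : ∀ t, p t ≠ ∞) (h0' : ∀ t, p' t ≠ 0) (htop' : ∀ t, p' t ≠ ∞)
    [SigmaFinite (ρ.withDensity p)] :
    llr (ρ.withDensity p') (ρ.withDensity p) =ᵐ[ρ.withDensity p] fun t =>
      Real.log (p' t).toReal - Real.log (p t).toReal := by
  rw [← withDensity_withDensity_div hp hp' h0 htop]
  filter_upwards [Measure.rnDeriv_withDensity (ρ.withDensity p) (hp'.div hp)] with t ht
  rw [llr, ht, Pi.div_apply, ENNReal.toReal_div, Real.log_div
    (ENNReal.toReal_pos (h0' t) (htop' t)).ne' (ENNReal.toReal_pos (h0 t) (htop t)).ne']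

theorem lintegral_exp_log_sub_log (hp : Measurable p) (hp' : Measurable p')
    (h0 : ∀ t, p t ≠ 0) (htop : ∀ t, p t ≠ ∞) (h0' : ∀ t, p' t ≠ 0) (htop' : ∀ t, p' t ≠ ∞) :
    ∫⁻ t, ENNReal.ofReal (Real.exp (Real.log (p' t).toReal - Real.log (p t).toReal))
      ∂ρ.withDensity p = ρ.withDensity p' Set.univ := by
  rw [← withDensity_withDensity_div hp hp' h0 htop, withDensity_apply _ .univ,
    Measure.restrict_univ]
  refine lintegral_congr fun t => ?_
  rw [Real.exp_sub, Real.exp_log (ENNReal.toReal_pos (h0' t) (htop' t)),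
    Real.exp_log (ENNReal.toReal_pos (h0 t) (htop t)), ← ENNReal.toReal_div,
    ENNReal.ofReal_toReal (ENNReal.div_ne_top (htop' t) (h0 t)), Pi.div_apply]

end RelativeEntropy

/-! ### Convergence to the invariant law -/

section Doeblin

variable {𝒳 𝒴 : Type*} [MeasurableSpace 𝒳] [MeasurableSpace 𝒴] {Q : Kernel 𝒳 𝒳}
  {ν : Measure 𝒳} [IsProbabilityMeasure ν]

theorem comp_le_smul {lam : Measure 𝒳} {c : ℝ≥0} (h : ∀ x, Q x ≤ c • lam) (m : Measure 𝒳)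
    [IsProbabilityMeasure m] : Q ∘ₘ m ≤ c • lam := by
  refine Measure.le_iff.2 fun S hS => ?_
  calc (Q ∘ₘ m) S = ∫⁻ x, Q x S ∂m := Measure.bind_apply hS Q.aemeasurable
    _ ≤ ∫⁻ _, (c • lam) S ∂m := lintegral_mono fun x => h x S
    _ = (c • lam) S := by simp

-- The part of `Q x` which is not minorized by `κ • ν` has a nonnegative density, so the bound
-- `m ≤ c • ν` only matters for the remaining mass `1 - κ`.
theorem comp_le_smul_of_le_smul (hν : Kernel.Invariant Q ν) {κ : ℝ≥0} (hκ : ∀ x, κ • ν ≤ Q x)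
    {m : Measure 𝒳} [IsProbabilityMeasure m] {c : ℝ≥0} (hm : m ≤ c • ν) :
    Q ∘ₘ m ≤ (κ + c * (1 - κ)) • ν := by
  refine Measure.le_iff.2 fun S hS => ?_
  have hmeas : Measurable fun x => Q x S - κ * ν S := (Q.measurable_coe hS).sub_const _
  have hsplit : ∀ (m : Measure 𝒳) [IsProbabilityMeasure m],
      (Q ∘ₘ m) S = κ * ν S + ∫⁻ x, (Q x S - κ * ν S) ∂m := fun m _ => by
    calc (Q ∘ₘ m) S = ∫⁻ x, (κ * ν S + (Q x S - κ * ν S)) ∂m := by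
          rw [Measure.bind_apply hS Q.aemeasurable]
          exact lintegral_congr fun x => (add_tsub_cancel_of_le (hκ x S)).symm
      _ = _ := by rw [lintegral_add_right _ hmeas]; simp
  have hrest : ∫⁻ x, (Q x S - κ * ν S) ∂ν = (1 - κ) * ν S := by
    rw [ENNReal.sub_mul fun _ _ => measure_ne_top ν S, one_mul]
    refine ENNReal.eq_sub_of_add_eq' (measure_ne_top ν S) ?_
    rw [add_comm, ← hsplit ν, hν.def]
  calc (Q ∘ₘ m) S = κ * ν S + ∫⁻ x, (Q x S - κ * ν S) ∂m := hsplit m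
    _ ≤ κ * ν S + c * ∫⁻ x, (Q x S - κ * ν S) ∂ν := by
      gcongr
      exact (lintegral_mono' hm le_rfl).trans_eq (lintegral_smul_measure _ _)
    _ = ((κ + c * (1 - κ)) • ν) S := by
      rw [hrest, Measure.smul_apply, ENNReal.smul_def, smul_eq_mul]
      push_cast
      ring

instance isProbabilityMeasure_iterate_comp (Q : Kernel 𝒳 𝒳) [IsMarkovKernel Q] (m : Measure 𝒳)
    [IsProbabilityMeasure m] : ∀ j, IsProbabilityMeasure ((fun m => Q ∘ₘ m)^[j] m)
  | 0 => ‹_›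
  | j + 1 => by
    have := isProbabilityMeasure_iterate_comp Q m j
    rw [Function.iterate_succ_apply']
    infer_instance

theorem IsMixing.iterate_comp_le [IsMarkovKernel Q] {g : 𝒳 → 𝒴 → ℝ≥0∞} {lam : Measure 𝒳}
    [IsProbabilityMeasure lam] {σm σp b : ℝ≥0} (h : IsMixing Q g lam σm σp b)
    (hν : Kernel.Invariant Q ν) (m : Measure 𝒳) [IsProbabilityMeasure m] (j : ℕ) :
    (fun m => Q ∘ₘ m)^[j + 1] m ≤ (1 + (σp / σm - 1) * (1 - σm / σp) ^ j) • ν := by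
  have hσm : σm ≠ 0 := h.pos.ne'
  have hσp : σp ≠ 0 := (h.pos.trans_le h.le).ne'
  have hupper : ∀ x, Q x ≤ (σp / σm) • ν := fun x => by
    calc Q x ≤ σp • lam := h.upper x
      _ = (σp / σm) • σm • lam := by rw [smul_smul, div_mul_cancel₀ _ hσm]
      _ ≤ (σp / σm) • ν := by gcongr; exact smul_le_of_invariant h.lower hν
  have hlower : ∀ x, (σm / σp) • ν ≤ Q x := fun x => by
    have hνle : ν ≤ σp • lam := hν.def.symm.trans_le (comp_le_smul h.upper ν)
    calc (σm / σp) • ν ≤ (σm / σp) • σp • lam := by gcongr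
      _ = σm • lam := by rw [smul_smul, div_mul_cancel₀ _ hσp]
      _ ≤ Q x := h.lower x
  induction j with
  | zero =>
    rw [pow_zero, mul_one, add_tsub_cancel_of_le (one_le_div₀ h.pos |>.2 h.le)]
    exact comp_le_smul hupper m
  | succ j ih =>
    have := isProbabilityMeasure_iterate_comp Q m (j + 1)
    rw [Function.iterate_succ_apply']
    refine (comp_le_smul_of_le_smul hν hlower ih).trans_eq ?_
    congr 1
    have hκ : σm / σp ≤ 1 := div_le_one_of_le₀ h.le zero_le
    rw [add_mul, one_mul, ← add_assoc, add_tsub_cancel_of_le hκ, pow_succ, mul_assoc]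

end Doeblin

/-! ### Independent blocks -/

/-- The shape with `j` complete generations followed by a copy of `s` below each of the `2 ^ j`
vertices of the next one. -/
def Shape.graft (s : Shape) : ℕ → Shape
  | 0 => s
  | j + 1 => .node (graft s j) (graft s j)

theorem Shape.full_graft (n : ℕ) : ∀ j, (full n).graft j = full (n + j)
  | 0 => rfl
  | j + 1 => by rw [graft, full_graft n j]; rfl

section Blocks

variable {𝒳 𝒴 : Type*} [MeasurableSpace 𝒳] [MeasurableSpace 𝒴]

/-- The labels of the leftmost of the grafted copies. -/
def leftmostLabels (s : Shape) : ∀ j, Labels 𝒴 (s.graft j) → Labels 𝒴 s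
  | 0, t => t
  | j + 1, t => leftmostLabels s j t.2.1

/-- The sum of `f` over the labellings of the `2 ^ m` grafted copies. -/
def blockSum {s : Shape} (f : Labels 𝒴 s → ℝ) : ∀ m, Labels 𝒴 (s.graft m) → ℝ
  | 0, t => f t
  | m + 1, t => blockSum f m t.2.1 + blockSum f m t.2.2

theorem measurable_blockSum {s : Shape} {f : Labels 𝒴 s → ℝ} (hf : Measurable f) :
    ∀ m, Measurable (blockSum f m)
  | 0 => hf
  | m + 1 => ((measurable_blockSum hf m).comp measurable_snd.fst).add
      ((measurable_blockSum hf m).comp measurable_snd.snd)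

theorem obsLaw_le_smul_of_le_smul {Q : Kernel 𝒳 𝒳} {G : Kernel 𝒳 𝒴} {m ν : Measure 𝒳} {c : ℝ≥0}
    (hm : m ≤ c • ν) (s : Shape) : obsLaw Q G m s ≤ c • obsLaw Q G ν s := by
  refine Measure.le_iff.2 fun S hS => ?_
  rw [obsLaw, obsLaw, Measure.smul_apply, Measure.bind_apply hS (Kernel.aemeasurable _),
    Measure.bind_apply hS (Kernel.aemeasurable _), ← lintegral_smul_measure]
  exact lintegral_mono' hm le_rfl

variable (Q : Kernel 𝒳 𝒳) [IsMarkovKernel Q] (G : Kernel 𝒳 𝒴) [IsMarkovKernel G]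

theorem measurePreserving_leftmostLabels (s : Shape) (j : ℕ) (ν : Measure 𝒳) :
    MeasurePreserving (leftmostLabels s j) (obsLaw Q G ν (s.graft j))
      (obsLaw Q G ((fun m => Q ∘ₘ m)^[j] ν) s) := by
  induction j generalizing ν with
  | zero => exact .id _
  | succ j ih => exact (ih (Q ∘ₘ ν)).comp (measurePreserving_left_obsLaw Q G _ _ ν)

variable {Q} {ν : Measure 𝒳} {s : Shape} {f : Labels 𝒴 s → ℝ}

theorem integrable_blockSum_and_integral_eq (hν : Kernel.Invariant Q ν)
    (hf : Integrable f (obsLaw Q G ν s)) (m : ℕ) :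
    Integrable (blockSum f m) (obsLaw Q G ν (s.graft m)) ∧
      ∫ t, blockSum f m t ∂obsLaw Q G ν (s.graft m) = 2 ^ m * ∫ t, f t ∂obsLaw Q G ν s := by
  induction m with
  | zero => exact ⟨hf, by rw [pow_zero, one_mul]; rfl⟩
  | succ m ih =>
    obtain ⟨hint, hintegral⟩ := ih
    have hleft := measurePreserving_left_obsLaw Q G (s.graft m) (s.graft m) ν
    have hright := measurePreserving_right_obsLaw Q G (s.graft m) (s.graft m) ν
    rw [hν.def] at hleft hright
    have hcomp : ∀ {p : Labels 𝒴 (s.graft (m + 1)) → Labels 𝒴 (s.graft m)},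
        MeasurePreserving p (obsLaw Q G ν (s.graft (m + 1))) (obsLaw Q G ν (s.graft m)) →
        Integrable (fun t => blockSum f m (p t)) (obsLaw Q G ν (s.graft (m + 1))) ∧
          ∫ t, blockSum f m (p t) ∂obsLaw Q G ν (s.graft (m + 1)) =
            2 ^ m * ∫ t, f t ∂obsLaw Q G ν s := fun hp => by
      refine ⟨hp.integrable_comp_of_integrable hint, ?_⟩
      rw [← hintegral, ← hp.map_eq, integral_map hp.aemeasurable
        (by rw [hp.map_eq]; exact hint.aestronglyMeasurable)]
    refine ⟨(hcomp hleft).1.add (hcomp hright).1, ?_⟩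
    refine (integral_add (hcomp hleft).1 (hcomp hright).1).trans ?_
    rw [(hcomp hleft).2, (hcomp hright).2, pow_succ]
    ring

-- Given the states at the roots, the copies are independent.
theorem lintegral_exp_blockSum_le (hf : Measurable f) {c : ℝ≥0}
    (hc : ∀ (m : Measure 𝒳) [IsProbabilityMeasure m],
      ∫⁻ t, ENNReal.ofReal (Real.exp (f t)) ∂obsLaw Q G m s ≤ c)
    (n : ℕ) (m : Measure 𝒳) [IsProbabilityMeasure m] :
    ∫⁻ t, ENNReal.ofReal (Real.exp (blockSum f n t)) ∂obsLaw Q G m (s.graft n) ≤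
      (c ^ 2 ^ n : ℝ≥0) := by
  induction n generalizing m with
  | zero => simpa using! hc m
  | succ n ih =>
    set F : Labels 𝒴 (s.graft n) → ℝ≥0∞ := fun t => ENNReal.ofReal (Real.exp (blockSum f n t))
    have hF : Measurable F := (measurable_blockSum hf n).exp.ennreal_ofReal
    have hexp : ∀ t : Labels 𝒴 (s.graft (n + 1)),
        ENNReal.ofReal (Real.exp (blockSum f (n + 1) t)) = F t.2.1 * F t.2.2 := fun t => by
      rw [blockSum, Real.exp_add, ENNReal.ofReal_mul (Real.exp_pos _).le]
    have hkernel : ∀ x, ∫⁻ t, F t.2.1 * F t.2.2 ∂obsKernel Q G (s.graft (n + 1)) x =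
        (∫⁻ t, F t ∂obsLaw Q G (Q x) (s.graft n)) ^ 2 := fun x => by
      change ∫⁻ t, F t.2.1 * F t.2.2 ∂obsKernel Q G (.node _ _) x = _
      rw [obsKernel_node_apply, lintegral_prod _ (by fun_prop)]
      simp only [lintegral_const, measure_univ, mul_one]
      rw [lintegral_prod_mul hF.aemeasurable hF.aemeasurable, sq]
    calc ∫⁻ t, ENNReal.ofReal (Real.exp (blockSum f (n + 1) t)) ∂obsLaw Q G m (s.graft (n + 1))
        = ∫⁻ x, (∫⁻ t, F t ∂obsLaw Q G (Q x) (s.graft n)) ^ 2 ∂m := by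
          simp only [hexp]
          rw [obsLaw, Measure.lintegral_bind (Kernel.aemeasurable _)
            (by exact ((hF.comp measurable_snd.fst).mul
              (hF.comp measurable_snd.snd)).aemeasurable)]
          exact lintegral_congr hkernel
      _ ≤ ∫⁻ _, (c ^ 2 ^ n : ℝ≥0) ^ 2 ∂m := lintegral_mono fun x => pow_le_pow_left' (ih (Q x)) 2
      _ = (c ^ 2 ^ (n + 1) : ℝ≥0) := by
          rw [lintegral_const, measure_univ, mul_one, ← ENNReal.coe_pow, ← pow_mul, ← pow_succ]

end Blocks

/-! ### The relative entropy of two models -/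

/-- A stationary mixing hidden Markov model: `IsMixing` with invariant initial law `ν`, where `g x`
is the density with respect to `μ` of the law of an observation at a vertex with hidden state
`x`. -/
structure IsMixingModel {𝒳 𝒴 : Type*} [MeasurableSpace 𝒳] [MeasurableSpace 𝒴] (Q : Kernel 𝒳 𝒳)
    (G : Kernel 𝒳 𝒴) (ν : Measure 𝒳) (g : 𝒳 → 𝒴 → ℝ≥0∞) (lam : Measure 𝒳) (μ : Measure 𝒴)
    (σm σp b : ℝ≥0) : Prop extends IsMixing Q g lam σm σp b where
  invariant : Kernel.Invariant Q ν
  eq_withDensity : ∀ x, G x = μ.withDensity (g x)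

namespace IsMixingModel

open InformationTheory

variable {𝒳 𝒴 : Type*} [MeasurableSpace 𝒳] [MeasurableSpace 𝒴]
  {Q Q' : Kernel 𝒳 𝒳} [IsMarkovKernel Q] [IsMarkovKernel Q']
  {G G' : Kernel 𝒳 𝒴} [IsMarkovKernel G'] {ν ν' : Measure 𝒳} [IsProbabilityMeasure ν]
  [IsProbabilityMeasure ν'] {g g' : 𝒳 → 𝒴 → ℝ≥0∞} {lam lam' : Measure 𝒳} {μ : Measure 𝒴}
  {σm σp b σm' σp' b' : ℝ≥0}

theorem integrable_logMeanLik_sub [IsProbabilityMeasure lam] [IsProbabilityMeasure lam']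
    (h : IsMixingModel Q G ν g lam μ σm σp b) (h' : IsMixingModel Q' G' ν' g' lam' μ σm' σp' b')
    (hint : Integrable (logBound lam g σm b) (G' ∘ₘ ν'))
    (hint' : Integrable (logBound lam' g' σm' b') (G' ∘ₘ ν')) (s : Shape) :
    Integrable (fun t => logMeanLik Q' g' ν' s t - logMeanLik Q g ν s t) (obsLaw Q' G' ν' s) :=
  (h'.integrable_logMeanLik h'.invariant h'.invariant hint' s).sub
    (h.integrable_logMeanLik h.invariant h'.invariant hint s)

variable [IsMarkovKernel G] [SigmaFinite μ]

theorem obsLaw_absolutelyContinuous (h : IsMixingModel Q G ν g lam μ σm σp b)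
    (h' : IsMixingModel Q' G' ν' g' lam' μ σm' σp' b') (s : Shape) :
    obsLaw Q' G' ν' s ≪ obsLaw Q G ν s := by
  rw [obsLaw_eq_withDensity Q h.measurable_g h.eq_withDensity,
    obsLaw_eq_withDensity Q' h'.measurable_g h'.eq_withDensity,
    ← withDensity_withDensity_div (measurable_meanLik Q h.measurable_g ν s)
      (measurable_meanLik Q' h'.measurable_g ν' s) (h.meanLik_ne_zero ν s) (h.meanLik_ne_top ν s)]
  exact withDensity_absolutelyContinuous _ _

theorem llr_obsLaw_ae_eq (h : IsMixingModel Q G ν g lam μ σm σp b)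
    (h' : IsMixingModel Q' G' ν' g' lam' μ σm' σp' b') (s : Shape) :
    llr (obsLaw Q' G' ν' s) (obsLaw Q G ν s) =ᵐ[obsLaw Q' G' ν' s] fun t =>
      logMeanLik Q' g' ν' s t - logMeanLik Q g ν s t := by
  refine (h.obsLaw_absolutelyContinuous h' s).ae_le ?_
  have := obsLaw.isProbabilityMeasure Q G ν s
  rw [obsLaw_eq_withDensity Q h.measurable_g h.eq_withDensity] at this ⊢
  rw [obsLaw_eq_withDensity Q' h'.measurable_g h'.eq_withDensity]
  exact llr_withDensity_ae_eq (measurable_meanLik Q h.measurable_g ν s)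
    (measurable_meanLik Q' h'.measurable_g ν' s) (h.meanLik_ne_zero ν s) (h.meanLik_ne_top ν s)
    (h'.meanLik_ne_zero ν' s) (h'.meanLik_ne_top ν' s)

theorem lintegral_exp_logMeanLik_sub (h : IsMixingModel Q G ν g lam μ σm σp b)
    (h' : IsMixingModel Q' G' ν' g' lam' μ σm' σp' b') (s : Shape) :
    ∫⁻ t, ENNReal.ofReal (Real.exp (logMeanLik Q' g' ν' s t - logMeanLik Q g ν s t))
      ∂obsLaw Q G ν s = 1 := by
  rw [obsLaw_eq_withDensity Q h.measurable_g h.eq_withDensity]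
  refine (lintegral_exp_log_sub_log (measurable_meanLik Q h.measurable_g ν s)
    (measurable_meanLik Q' h'.measurable_g ν' s) (h.meanLik_ne_zero ν s) (h.meanLik_ne_top ν s)
    (h'.meanLik_ne_zero ν' s) (h'.meanLik_ne_top ν' s)).trans ?_
  rw [← obsLaw_eq_withDensity Q' h'.measurable_g h'.eq_withDensity, measure_univ]

theorem toReal_klDiv_obsLaw_eq_integral (h : IsMixingModel Q G ν g lam μ σm σp b)
    (h' : IsMixingModel Q' G' ν' g' lam' μ σm' σp' b') (s : Shape) :
    (klDiv (obsLaw Q' G' ν' s) (obsLaw Q G ν s)).toReal =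
      ∫ t, (logMeanLik Q' g' ν' s t - logMeanLik Q g ν s t) ∂obsLaw Q' G' ν' s := by
  rw [toReal_klDiv_of_measure_eq (h.obsLaw_absolutelyContinuous h' s) (by simp)]
  exact integral_congr_ae (h.llr_obsLaw_ae_eq h' s)

theorem lintegral_exp_logMeanLik_sub_leftmostLabels_le [IsProbabilityMeasure lam]
    (h : IsMixingModel Q G ν g lam μ σm σp b) (h' : IsMixingModel Q' G' ν' g' lam' μ σm' σp' b')
    (s : Shape) (j : ℕ) (m : Measure 𝒳) [IsProbabilityMeasure m] :
    ∫⁻ t, ENNReal.ofReal (Real.exp (logMeanLik Q' g' ν' s (leftmostLabels s (j + 1) t) -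
      logMeanLik Q g ν s (leftmostLabels s (j + 1) t))) ∂obsLaw Q G m (s.graft (j + 1)) ≤
      (1 + (σp / σm - 1) * (1 - σm / σp) ^ j : ℝ≥0) := by
  have hmeas : Measurable fun t =>
      ENNReal.ofReal (Real.exp (logMeanLik Q' g' ν' s t - logMeanLik Q g ν s t)) :=
    ((h'.measurable_logMeanLik ν' s).sub (h.measurable_logMeanLik ν s)).exp.ennreal_ofReal
  rw [(measurePreserving_leftmostLabels Q G s (j + 1) m).lintegral_comp hmeas]
  refine (lintegral_mono' (obsLaw_le_smul_of_le_smul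
    (h.iterate_comp_le h.invariant m j) s) le_rfl).trans_eq ?_
  rw [lintegral_smul_measure, h.lintegral_exp_logMeanLik_sub h', ENNReal.smul_def, smul_eq_mul,
    mul_one]

variable [IsProbabilityMeasure lam] [IsProbabilityMeasure lam']

theorem integrable_llr_obsLaw (h : IsMixingModel Q G ν g lam μ σm σp b)
    (h' : IsMixingModel Q' G' ν' g' lam' μ σm' σp' b')
    (hint : Integrable (logBound lam g σm b) (G' ∘ₘ ν'))
    (hint' : Integrable (logBound lam' g' σm' b') (G' ∘ₘ ν')) (s : Shape) :
    Integrable (llr (obsLaw Q' G' ν' s) (obsLaw Q G ν s)) (obsLaw Q' G' ν' s) :=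
  (h.integrable_logMeanLik_sub h' hint hint' s).congr (h.llr_obsLaw_ae_eq h' s).symm

theorem toReal_klDiv_obsLaw (h : IsMixingModel Q G ν g lam μ σm σp b)
    (h' : IsMixingModel Q' G' ν' g' lam' μ σm' σp' b')
    (hint : Integrable (logBound lam g σm b) (G' ∘ₘ ν'))
    (hint' : Integrable (logBound lam' g' σm' b') (G' ∘ₘ ν')) (s : Shape) :
    (klDiv (obsLaw Q' G' ν' s) (obsLaw Q G ν s)).toReal =
      expLogLik Q' g' ν' Q' G' ν' s - expLogLik Q g ν Q' G' ν' s := by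
  rw [h.toReal_klDiv_obsLaw_eq_integral h', integral_sub
    (h'.integrable_logMeanLik h'.invariant h'.invariant hint' s)
    (h.integrable_logMeanLik h.invariant h'.invariant hint s)]
  rfl

-- The Donsker–Varadhan inequality for the sum of the log-likelihood ratios of `2 ^ m` copies of
-- `s`: the exponential moment of each of them is at most `1` up to the mixing error.
theorem two_pow_mul_toReal_klDiv_obsLaw_le (h : IsMixingModel Q G ν g lam μ σm σp b)
    (h' : IsMixingModel Q' G' ν' g' lam' μ σm' σp' b')
    (hint : Integrable (logBound lam g σm b) (G' ∘ₘ ν'))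
    (hint' : Integrable (logBound lam' g' σm' b') (G' ∘ₘ ν')) (s : Shape) (j m : ℕ) :
    2 ^ m * (klDiv (obsLaw Q' G' ν' s) (obsLaw Q G ν s)).toReal ≤
      (klDiv (obsLaw Q' G' ν' ((s.graft (j + 1)).graft m))
        (obsLaw Q G ν ((s.graft (j + 1)).graft m))).toReal +
      2 ^ m * Real.log (1 + (σp / σm - 1) * (1 - σm / σp) ^ j : ℝ≥0) := by
  set f : Labels 𝒴 s → ℝ := fun t => logMeanLik Q' g' ν' s t - logMeanLik Q g ν s t
  set c : ℝ≥0 := 1 + (σp / σm - 1) * (1 - σm / σp) ^ j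
  have hfm : Measurable f := (h'.measurable_logMeanLik ν' s).sub (h.measurable_logMeanLik ν s)
  have hread := measurePreserving_leftmostLabels Q' G' s (j + 1) ν'
  rw [Function.iterate_fixed h'.invariant.def] at hread
  have hf : Integrable (f ∘ leftmostLabels s (j + 1)) (obsLaw Q' G' ν' (s.graft (j + 1))) :=
    hread.integrable_comp_of_integrable (h.integrable_logMeanLik_sub h' hint hint' s)
  have hf_eq : ∫ t, (f ∘ leftmostLabels s (j + 1)) t ∂obsLaw Q' G' ν' (s.graft (j + 1)) =
      (klDiv (obsLaw Q' G' ν' s) (obsLaw Q G ν s)).toReal := by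
    rw [h.toReal_klDiv_obsLaw_eq_integral h', ← hread.map_eq, integral_map hread.aemeasurable
      hfm.aestronglyMeasurable]
    rfl
  have hfm' := hfm.comp hread.measurable
  obtain ⟨hblock, hblock_eq⟩ := integrable_blockSum_and_integral_eq G' h'.invariant hf m
  have hdv := integral_le_toReal_klDiv_add_log_of_lintegral_le
    (h.obsLaw_absolutelyContinuous h' _) (h.integrable_llr_obsLaw h' hint hint' _)
    (measurable_blockSum hfm' m) hblock (lintegral_exp_blockSum_le G hfm'
      (fun m => h.lintegral_exp_logMeanLik_sub_leftmostLabels_le h' s j m) m ν)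
  rw [NNReal.coe_pow, Real.log_pow] at hdv
  rw [← hf_eq, ← hblock_eq]
  exact_mod_cast hdv

theorem toReal_klDiv_obsLaw_full_eq_zero (h : IsMixingModel Q G ν g lam μ σm σp b)
    (h' : IsMixingModel Q' G' ν' g' lam' μ σm' σp' b')
    (hint : Integrable (logBound lam g σm b) (G' ∘ₘ ν'))
    (hint' : Integrable (logBound lam' g' σm' b') (G' ∘ₘ ν'))
    (hlim : Tendsto (fun k : ℕ => ((2 : ℝ) ^ k)⁻¹ *
      (klDiv (obsLaw Q' G' ν' (.full k)) (obsLaw Q G ν (.full k))).toReal) atTop (𝓝 0)) (n : ℕ) :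
    (klDiv (obsLaw Q' G' ν' (.full n)) (obsLaw Q G ν (.full n))).toReal = 0 := by
  set D : ℕ → ℝ := fun k => (klDiv (obsLaw Q' G' ν' (.full k)) (obsLaw Q G ν (.full k))).toReal
  have hblocks : ∀ j, D n ≤ Real.log (1 + (σp / σm - 1) * (1 - σm / σp) ^ j : ℝ≥0) := fun j => by
    set C := Real.log (1 + (σp / σm - 1) * (1 - σm / σp) ^ j : ℝ≥0)
    have hlarge : Tendsto (fun m => 2 ^ (n + (j + 1)) *
        (((2 : ℝ) ^ (m + (n + (j + 1))))⁻¹ * D (m + (n + (j + 1)))) + C) atTop (𝓝 C) := by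
      simpa using! (((tendsto_add_atTop_iff_nat (n + (j + 1))).2 hlim).const_mul _).add_const C
    refine ge_of_tendsto' hlarge fun m => ?_
    have hle := h.two_pow_mul_toReal_klDiv_obsLaw_le h' hint hint' (.full n) j m
    rw [Shape.full_graft, Shape.full_graft, add_comm _ m] at hle
    have hpow : (0 : ℝ) < 2 ^ m := by positivity
    rw [pow_add _ m, mul_inv]
    field_simp
    linarith
  have hmixed : Tendsto (fun j : ℕ => Real.log (1 + (σp / σm - 1) * (1 - σm / σp) ^ j : ℝ≥0)) atTop
      (𝓝 0) := by
    have hκ : 1 - σm / σp < 1 :=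
      tsub_lt_self one_pos (div_pos h.pos (h.pos.trans_le h.le))
    have :=
      ((tendsto_pow_atTop_nhds_zero_of_lt_one zero_le hκ).const_mul (σp / σm - 1)).const_add 1
    rw [mul_zero, add_zero] at this
    simpa using (NNReal.tendsto_coe.2 this).log one_ne_zero
  exact le_antisymm (ge_of_tendsto' hmixed hblocks) ENNReal.toReal_nonneg

end IsMixingModel

theorem tendsto_inv_pow_mul_of_tendsto_sub {a : ℕ → ℝ} {r l : ℝ} (hr : 1 < r)
    (h : Tendsto (fun k => (r ^ k)⁻¹ * (a (k + 1) - a k)) atTop (𝓝 l)) :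
    Tendsto (fun k => (r ^ k)⁻¹ * a k) atTop (𝓝 (l / (r - 1))) := by
  have hr0 : r ≠ 0 := by positivity
  have hr1 : r - 1 ≠ 0 := (sub_pos.2 hr).ne'
  have hgeom : ∀ n, ∑ k ∈ Finset.range n, r ^ k = (r ^ n - 1) / (r - 1) := geom_sum_eq hr.ne'
  have hpow : Tendsto (fun n : ℕ => (r ^ n)⁻¹) atTop (𝓝 0) :=
    tendsto_inv_atTop_zero.comp (tendsto_pow_atTop_atTop_of_one_lt hr)
  have herror : (fun k => a (k + 1) - a k - l * r ^ k) =o[atTop] fun k => r ^ k := by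
    refine (Asymptotics.isLittleO_iff_tendsto fun k hk => absurd hk (pow_ne_zero k hr0)).2 ?_
    refine (sub_self l ▸ h.sub_const l).congr fun k => ?_
    field_simp
  have hdiv : Tendsto (fun n : ℕ => ∑ k ∈ Finset.range n, r ^ k) atTop atTop := by
    simp only [hgeom]
    exact (tendsto_atTop_add_const_right _ _
      (tendsto_pow_atTop_atTop_of_one_lt hr)).atTop_div_const (sub_pos.2 hr)
  have hsum := (herror.sum_range (fun k => by positivity) hdiv).tendsto_div_nhds_zero
  have hratio : Tendsto (fun n : ℕ => (r ^ n)⁻¹ * ∑ k ∈ Finset.range n, r ^ k) atTop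
      (𝓝 (1 / (r - 1))) := by
    have := (hpow.const_sub 1).div_const (r - 1)
    rw [sub_zero] at this
    refine this.congr fun n => ?_
    rw [hgeom]
    field_simp
  have hlim := ((hratio.mul hsum).add (hpow.mul_const (a 0))).add (hratio.const_mul l)
  simp only [mul_zero, zero_mul, zero_add, mul_one_div] at hlim
  refine hlim.congr' ((eventually_gt_atTop 0).mono fun n hn => ?_)
  have hne : ∑ k ∈ Finset.range n, r ^ k ≠ 0 :=
    (Finset.sum_pos (fun k _ => by positivity) (Finset.nonempty_range_iff.2 hn.ne')).ne'
  rw [mul_assoc, mul_div_cancel₀ _ hne, Finset.sum_sub_distrib, Finset.sum_range_sub,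
    ← Finset.mul_sum]
  ring

namespace IsMixingModel

section Contrast

open InformationTheory

variable {𝒳 𝒴 Ω : Type*} [MeasurableSpace 𝒳] [MeasurableSpace 𝒴] [MeasurableSpace Ω]
  {Q Q' : Kernel 𝒳 𝒳} [IsMarkovKernel Q'] {G G' : Kernel 𝒳 𝒴} [IsMarkovKernel G']
  {ν ν' : Measure 𝒳} {g g' : 𝒳 → 𝒴 → ℝ≥0∞} {lam lam' : Measure 𝒳} [IsProbabilityMeasure lam]
  {μ : Measure 𝒴} {σm σp b σm' σp' b' : ℝ≥0} {X : Vertex → Ω → 𝒳} {Y : Vertex → Ω → 𝒴}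
  {P : Measure Ω} [IsProbabilityMeasure P]

theorem integrable_logBound_comp (h : IsMixingModel Q G ν g lam μ σm σp b)
    (hY : IsStationaryHMT Q' G' ν' X Y P)
    (hint : Integrable (fun ω => logBound lam g σm b (Y root ω)) P) :
    Integrable (logBound lam g σm b) (G' ∘ₘ ν') :=
  (hY.measurePreserving_root.integrable_comp h.measurable_logBound.aestronglyMeasurable).1 hint

variable [IsMarkovKernel Q] [IsMarkovKernel G] [IsProbabilityMeasure ν] [IsProbabilityMeasure ν']
  [IsProbabilityMeasure lam'] [SigmaFinite μ]

theorem tendsto_toReal_klDiv_obsLaw_full (h : IsMixingModel Q G ν g lam μ σm σp b)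
    (h' : IsMixingModel Q' G' ν' g' lam' μ σm' σp' b') (hY : IsStationaryHMT Q' G' ν' X Y P)
    (hint : Integrable (fun ω => logBound lam g σm b (Y root ω)) P)
    (hint' : Integrable (fun ω => logBound lam' g' σm' b' (Y root ω)) P) (m : Measure 𝒳)
    [IsProbabilityMeasure m] :
    Tendsto (fun k : ℕ => ((2 : ℝ) ^ k)⁻¹ *
      (klDiv (obsLaw Q' G' ν' (.full k)) (obsLaw Q G ν (.full k))).toReal) atTop
      (𝓝 (∫ s, incrementLimit Q' g' s.1 (fun v => Y v s.2) m ∂(spineLaw.prod P) -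
        ∫ s, incrementLimit Q g s.1 (fun v => Y v s.2) m ∂(spineLaw.prod P))) := by
  have hklDiv := h.toReal_klDiv_obsLaw h' (h.integrable_logBound_comp hY hint)
    (h'.integrable_logBound_comp hY hint')
  have hincrements := (h'.tendsto_expLogLik_sub h'.invariant hY hint' m).sub
    (h.tendsto_expLogLik_sub h.invariant hY hint m)
  have hsum := tendsto_inv_pow_mul_of_tendsto_sub (r := 2)
    (a := fun k => (klDiv (obsLaw Q' G' ν' (.full k)) (obsLaw Q G ν (.full k))).toReal)
    one_lt_two (hincrements.congr fun k => by simp only [hklDiv]; ring)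
  rwa [show (2 : ℝ) - 1 = 1 by norm_num, div_one] at hsum

theorem integral_incrementLimit_le (h : IsMixingModel Q G ν g lam μ σm σp b)
    (h' : IsMixingModel Q' G' ν' g' lam' μ σm' σp' b') (hY : IsStationaryHMT Q' G' ν' X Y P)
    (hint : Integrable (fun ω => logBound lam g σm b (Y root ω)) P)
    (hint' : Integrable (fun ω => logBound lam' g' σm' b' (Y root ω)) P) (m : Measure 𝒳)
    [IsProbabilityMeasure m] :
    ∫ s, incrementLimit Q g s.1 (fun v => Y v s.2) m ∂(spineLaw.prod P) ≤
      ∫ s, incrementLimit Q' g' s.1 (fun v => Y v s.2) m ∂(spineLaw.prod P) :=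
  sub_nonneg.1 (ge_of_tendsto' (h.tendsto_toReal_klDiv_obsLaw_full h' hY hint hint' m) fun _ =>
    mul_nonneg (by positivity) ENNReal.toReal_nonneg)

theorem integral_incrementLimit_eq_iff (h : IsMixingModel Q G ν g lam μ σm σp b)
    (h' : IsMixingModel Q' G' ν' g' lam' μ σm' σp' b') (hY : IsStationaryHMT Q' G' ν' X Y P)
    (hint : Integrable (fun ω => logBound lam g σm b (Y root ω)) P)
    (hint' : Integrable (fun ω => logBound lam' g' σm' b' (Y root ω)) P) (m : Measure 𝒳)
    [IsProbabilityMeasure m] :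
    ∫ s, incrementLimit Q g s.1 (fun v => Y v s.2) m ∂(spineLaw.prod P) =
        ∫ s, incrementLimit Q' g' s.1 (fun v => Y v s.2) m ∂(spineLaw.prod P) ↔
      ∀ n, obsLaw Q G ν (.full n) = obsLaw Q' G' ν' (.full n) := by
  have hlim := h.tendsto_toReal_klDiv_obsLaw_full h' hY hint hint' m
  have hlaw := h.integrable_logBound_comp hY hint
  have hlaw' := h'.integrable_logBound_comp hY hint'
  constructor
  · intro heq n
    rw [heq, sub_self] at hlim
    have htop := klDiv_ne_top (h.obsLaw_absolutelyContinuous h' (.full n))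
      (h.integrable_llr_obsLaw h' hlaw hlaw' (.full n))
    have hzero := h.toReal_klDiv_obsLaw_full_eq_zero h' hlaw hlaw' hlim n
    exact (klDiv_eq_zero_iff.1 (((ENNReal.toReal_eq_zero_iff _).1 hzero).resolve_right htop)).symm
  · intro heq
    simp only [heq, klDiv_self, ENNReal.toReal_zero, mul_zero] at hlim
    exact (sub_eq_zero.1 (tendsto_nhds_unique tendsto_const_nhds hlim).symm).symm

end Contrast

end IsMixingModel

/-! ### The law of the observed process -/

/-- The word of a vertex of `T` or of one of its copies, and the empty word for an ancestor of
`∂`; it turns a family indexed by words into one indexed by vertices. -/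
def Vertex.word : Vertex → List Bool
  | node _ w => w
  | spine _ => []

section ObservedLaw

variable {𝒴 Ω : Type*} [MeasurableSpace 𝒴] [MeasurableSpace Ω] {Y : Vertex → Ω → 𝒴}

theorem map_readLabels_full (hY : ∀ v, Measurable (Y v)) (P : Measure Ω) (n : ℕ) :
    P.map (fun ω => readLabels (fun u => Y u ω) (.full n) root) =
      (P.map fun ω (w : List Bool) => Y (node 0 w) ω).map fun z =>
        readLabels (fun u => z u.word) (.full n) root := by
  rw [Measure.map_map (measurable_readLabels (fun v => measurable_pi_apply v.word) _ _)
    (measurable_pi_iff.2 fun w => hY (node 0 w))]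
  congr 1
  funext ω
  refine readLabels_congr fun u hu => ?_
  obtain ⟨w, -, rfl⟩ := mem_verts_full.1 hu
  rfl

theorem map_restrict_words (hY : ∀ v, Measurable (Y v)) (P : Measure Ω) (d : 𝒴)
    (I : Finset (List Bool)) :
    (P.map fun ω (w : List Bool) => Y (node 0 w) ω).map I.restrict =
      (P.map fun ω => readLabels (fun u => Y u ω) (.full (I.sup List.length + 1)) root).map
        fun t (w : I) => extendLabels d _ root t (node 0 w) := by
  rw [Measure.map_map (Finset.measurable_restrict I) (measurable_pi_iff.2 fun w => hY (node 0 w)),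
    Measure.map_map (measurable_pi_iff.2 fun w => measurable_extendLabels d _ _ _)
      (measurable_readLabels hY _ _)]
  congr 1
  funext ω w
  have hw : node 0 w ∈ verts (.full (I.sup List.length + 1)) root :=
    mem_verts_full.2 ⟨w, Nat.lt_succ_of_le (Finset.le_sup (f := List.length) w.2), by simp⟩
  exact (extendLabels_readLabels d (fun u => Y u ω) hw).symm

theorem sameObservedLaw_iff (hY : ∀ v, Measurable (Y v)) {P P' : Measure Ω}
    [IsProbabilityMeasure P] [IsProbabilityMeasure P'] :
    SameObservedLaw Y P P' ↔ ∀ n,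
      P.map (fun ω => readLabels (fun u => Y u ω) (.full n) root) =
        P'.map fun ω => readLabels (fun u => Y u ω) (.full n) root := by
  have hwords : Measurable fun ω (w : List Bool) => Y (node 0 w) ω :=
    measurable_pi_iff.2 fun w => hY (node 0 w)
  refine ⟨fun h n => ?_, fun h => ?_⟩
  · rw [SameObservedLaw] at h
    rw [map_readLabels_full hY, map_readLabels_full hY, h]
  · obtain ⟨ω₀⟩ := nonempty_of_isProbabilityMeasure P
    have := Measure.isProbabilityMeasure_map (μ := P) hwords.aemeasurable
    refine IsProjectiveLimit.unique
      (P := fun I => (P.map fun ω (w : List Bool) => Y (node 0 w) ω).map I.restrict)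
      (fun _ => rfl) fun I => ?_
    simp only [map_restrict_words hY _ (Y root ω₀), h]

theorem IsStationaryHMT.sameObservedLaw_iff {𝒳 : Type*} [MeasurableSpace 𝒳]
    {Q Q' : Kernel 𝒳 𝒳} [IsMarkovKernel Q] [IsMarkovKernel Q'] {G G' : Kernel 𝒳 𝒴}
    [IsMarkovKernel G] [IsMarkovKernel G'] {ν ν' : Measure 𝒳} {X X' : Vertex → Ω → 𝒳}
    {P P' : Measure Ω} [IsProbabilityMeasure P] [IsProbabilityMeasure P']
    (h : IsStationaryHMT Q G ν X Y P) (h' : IsStationaryHMT Q' G' ν' X' Y P') :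
    SameObservedLaw Y P P' ↔ ∀ n, obsLaw Q G ν (.full n) = obsLaw Q' G' ν' (.full n) := by
  simp only [HMT.sameObservedLaw_iff h.measurable_obs,
    ← (h.measurePreserving_readLabels 0 _).map_eq, ← (h'.measurePreserving_readLabels 0 _).map_eq,
    Function.iterate_zero_apply]

end ObservedLaw

/-! ### Regular dominated families of models -/

namespace FullyDominated

variable {Θ 𝒳 𝒴 Ω : Type*} [MeasurableSpace 𝒳] [MeasurableSpace 𝒴]
  {Q : Θ → Kernel 𝒳 𝒳} {G : Θ → Kernel 𝒳 𝒴} {lam : Measure 𝒳} {μ : Measure 𝒴}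
  {q : Θ → 𝒳 → 𝒳 → ℝ} {g : Θ → 𝒳 → 𝒴 → ℝ}

theorem isMixing (hdom : FullyDominated Q G lam μ q g) (hpos : ∀ θ x y, 0 < g θ x y)
    {σm σp b : ℝ≥0} (hσ : 0 < σm) (hq : ∀ θ x x', σm ≤ q θ x x' ∧ q θ x x' ≤ σp)
    (hb : ∀ θ x y, g θ x y ≤ b) (θ : Θ) :
    IsMixing (Q θ) (fun x y => ENNReal.ofReal (g θ x y)) lam σm σp b where
  measurable_g := (hdom.measurable_g θ).ennreal_ofReal
  g_ne_zero x y := (ENNReal.ofReal_pos.2 (hpos θ x y)).ne'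
  g_le x y := ENNReal.ofReal_le_coe.2 (hb θ x y)
  pos := hσ
  lower x := by
    rw [hdom.density_q, ENNReal.smul_def, ← withDensity_const]
    exact withDensity_mono (ae_of_all _ fun x' =>
      (ENNReal.ofReal_coe_nnreal.symm.trans_le (ENNReal.ofReal_le_ofReal (hq θ x x').1)))
  upper x := by
    rw [hdom.density_q, ENNReal.smul_def, ← withDensity_const]
    exact withDensity_mono (ae_of_all _ fun x' => ENNReal.ofReal_le_coe.2 (hq θ x x').2)

theorem toReal_refLik (hdom : FullyDominated Q G lam μ q g) (θ : Θ) (y : 𝒴) :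
    (refLik lam (fun x y => ENNReal.ofReal (g θ x y)) y).toReal = ∫ x, g θ x y ∂lam := by
  rw [integral_eq_lintegral_of_nonneg_ae (ae_of_all _ fun x => hdom.nonneg_g θ x y)
    ((hdom.measurable_g θ).comp (measurable_id.prodMk measurable_const)).aestronglyMeasurable]
  rfl

theorem logBound_le_abs_log_bMinus [IsProbabilityMeasure lam]
    (hdom : FullyDominated Q G lam μ q g) (hreg : Regular lam q g)
    {σm σp b : ℝ≥0} {θ : Θ}
    (hmix : IsMixing (Q θ) (fun x y => ENNReal.ofReal (g θ x y)) lam σm σp b) (y : 𝒴) :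
    logBound lam (fun x y => ENNReal.ofReal (g θ x y)) σm b y ≤
      |Real.log (bMinus lam g y)| + (|Real.log σm| + 2 * |Real.log b|) := by
  obtain ⟨c, C, hc, hcC⟩ := hreg.integral_g y
  have : Nonempty Θ := ⟨θ⟩
  set r := (refLik lam (fun x y => ENNReal.ofReal (g θ x y)) y).toReal
  have hr : 0 < r := hmix.toReal_refLik_pos y
  have hinf_pos : 0 < bMinus lam g y := hc.trans_le (le_ciInf fun θ' => (hcC θ').1)
  have hinf_le : bMinus lam g y ≤ r :=
    (ciInf_le ⟨c, Set.forall_mem_range.2 fun θ' => (hcC θ').1⟩ θ).trans_eq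
      (hdom.toReal_refLik θ y).symm
  have hle : r ≤ b := ENNReal.toReal_le_coe_of_le_coe (hmix.refLik_le y)
  have hlog : |Real.log r| ≤ max |Real.log (bMinus lam g y)| |Real.log b| :=
    abs_le_max_abs_abs (Real.log_le_log hinf_pos hinf_le) (Real.log_le_log hr hle)
  rw [logBound, Real.log_mul (NNReal.coe_pos.2 hmix.pos).ne' hr.ne']
  linarith [abs_add_le (Real.log σm) (Real.log r),
    max_le_add_of_nonneg (abs_nonneg (Real.log (bMinus lam g y))) (abs_nonneg (Real.log b))]

theorem exists_isMixingModel [MeasurableSpace Ω] [IsProbabilityMeasure lam]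
    (hdom : FullyDominated Q G lam μ q g) (hreg : Regular lam q g) {P : Measure Ω}
    [IsProbabilityMeasure P] {Y₀ : Ω → 𝒴} (hY : Measurable Y₀) (hL1 : L1Regular lam g Y₀ P)
    {ν : Θ → Measure 𝒳} (hν : ∀ θ, Kernel.Invariant (Q θ) (ν θ)) :
    ∃ σm σp b : ℝ≥0, ∀ θ,
      IsMixingModel (Q θ) (G θ) (ν θ) (fun x y => ENNReal.ofReal (g θ x y)) lam μ σm σp b ∧
      Integrable (fun ω => logBound lam (fun x y => ENNReal.ofReal (g θ x y)) σm b (Y₀ ω)) P := by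
  obtain ⟨σm, σp, hσ, hq⟩ := hreg.bounded_q
  obtain ⟨b, hb⟩ := hL1.bounded_g
  refine ⟨σm.toNNReal, σp.toNNReal, b.toNNReal, fun θ => ?_⟩
  have hmix := hdom.isMixing hreg.pos_g (σm := σm.toNNReal) (σp := σp.toNNReal)
    (b := b.toNNReal) (Real.toNNReal_pos.2 hσ) (fun θ x x' =>
      ⟨(Real.coe_toNNReal σm hσ.le).trans_le (hq θ x x').1,
        (hq θ x x').2.trans (Real.le_coe_toNNReal σp)⟩)
    (fun θ x y => (hb θ x y).trans (Real.le_coe_toNNReal b)) θ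
  refine ⟨⟨hmix, hν θ, hdom.density_g θ⟩, (hL1.integrable_log.abs.add <|
    integrable_const (|Real.log σm.toNNReal| + 2 * |Real.log b.toNNReal|)).mono'
    (hmix.measurable_logBound.comp hY).aestronglyMeasurable (ae_of_all _ fun ω => ?_)⟩
  rw [Real.norm_of_nonneg (by unfold logBound; positivity)]
  exact hdom.logBound_le_abs_log_bMinus hreg hmix (Y₀ ω)

variable [∀ θ, IsMarkovKernel (Q θ)] [IsProbabilityMeasure lam]

theorem rootIncrement_eq (hdom : FullyDominated Q G lam μ q g) {θ : Θ} {σm σp b : ℝ≥0}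
    (hmix : IsMixing (Q θ) (fun x y => ENNReal.ofReal (g θ x y)) lam σm σp b)
    (Y : Vertex → Ω → 𝒴) (k : ℕ) (x : 𝒳) (s : (ℕ → Bool) × Ω) :
    rootIncrement lam (q θ) (g θ) Y k x s =
      increment (Q θ) (fun x y => ENNReal.ofReal (g θ x y)) s.1 (fun v => Y v s.2) k
        (Measure.dirac x) := by
  have hdensity := condDensity_verts (Q := Q θ) (hdom.nonneg_q θ) (hdom.nonneg_g θ)
    (hdom.measurable_q θ) (hdom.measurable_g θ) (hdom.density_q θ)
  have hne (s : Shape) t :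
      (lik (Q θ) (fun x y => ENNReal.ofReal (g θ x y)) s x t).toReal ≠ 0 :=
    ENNReal.toReal_ne_zero.2 ⟨hmix.lik_ne_zero s x t, hmix.lik_ne_top s x t⟩
  have hdirac (s : Shape) t :
      ∫⁻ z, lik (Q θ) (fun x y => ENNReal.ofReal (g θ x y)) s z t ∂Measure.dirac x =
        lik (Q θ) (fun x y => ENNReal.ofReal (g θ x y)) s x t :=
    lintegral_dirac' x <| measurable_lik_left (g := fun x y => ENNReal.ofReal (g θ x y)) (Q θ)
      hmix.measurable_g s t
  rw [rootIncrement, smallH, bigH, past_root, pastStar_root, hdensity, hdensity,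
    Real.log_div (hne _ _) (hne _ _)]
  simp only [increment, logMeanLik, meanLik, hdirac]

theorem limitIncrement_eq (hdom : FullyDominated Q G lam μ q g) {θ : Θ} {σm σp b : ℝ≥0}
    (hmix : IsMixing (Q θ) (fun x y => ENNReal.ofReal (g θ x y)) lam σm σp b)
    (Y : Vertex → Ω → 𝒴) (x : 𝒳) :
    limitIncrement lam (q θ) (g θ) Y x = fun s =>
      incrementLimit (Q θ) (fun x y => ENNReal.ofReal (g θ x y)) s.1 (fun v => Y v s.2)
        (Measure.dirac x) := by
  funext s
  simp only [limitIncrement, hdom.rootIncrement_eq hmix, incrementLimit]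

end FullyDominated

end HMT

open HMT in
theorem mainTheorem8_general
    {Θ 𝒳 𝒴 Ω : Type*} [MeasurableSpace 𝒳] [MeasurableSpace 𝒴] [MeasurableSpace Ω] (θs : Θ)
    (Q : Θ → Kernel 𝒳 𝒳) [∀ θ, IsMarkovKernel (Q θ)]
    (G : Θ → Kernel 𝒳 𝒴) [∀ θ, IsMarkovKernel (G θ)]
    (ν : Θ → Measure 𝒳) [∀ θ, IsProbabilityMeasure (ν θ)]
    (P : Θ → Measure Ω) [∀ θ, IsProbabilityMeasure (P θ)]
    (X : Vertex → Ω → 𝒳) (Y : Vertex → Ω → 𝒴)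
    (hstat : ∀ θ, IsStationaryHMT (Q θ) (G θ) (ν θ) X Y (P θ))
    (lam : Measure 𝒳) [IsProbabilityMeasure lam] (μ : Measure 𝒴) [SigmaFinite μ]
    (q : Θ → 𝒳 → 𝒳 → ℝ) (g : Θ → 𝒳 → 𝒴 → ℝ)
    (hdom : FullyDominated Q G lam μ q g) (hreg : Regular lam q g)
    (hL1 : L1Regular lam g (Y Vertex.root) (P θs)) (x : 𝒳) :
    (∀ θ, Integrable (limitIncrement lam (q θ) (g θ) Y x) (spineLaw.prod (P θs)) ∧
      ∀ x' : 𝒳,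
        (∀ᵐ s ∂(spineLaw.prod (P θs)),
          Tendsto (fun k : ℕ => rootIncrement lam (q θ) (g θ) Y k x' s) atTop
            (𝓝 (limitIncrement lam (q θ) (g θ) Y x s))) ∧
        Tendsto (fun k : ℕ =>
          eLpNorm (fun s => rootIncrement lam (q θ) (g θ) Y k x' s -
            limitIncrement lam (q θ) (g θ) Y x s) 1 (spineLaw.prod (P θs))) atTop (𝓝 0)) ∧
    ∀ θ : Θ,
      (∀ θ' : Θ, contrast lam (q θ') (g θ') Y (P θs) x ≤
          contrast lam (q θ) (g θ) Y (P θs) x) ↔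
        SameObservedLaw Y (P θ) (P θs) := by
  obtain ⟨σm, σp, b, hmodel⟩ := hdom.exists_isMixingModel hreg ((hstat θs).measurable_obs _) hL1
    fun θ => (hstat θ).invariant
  choose hmodel hint using hmodel
  have hmix θ := (hmodel θ).toIsMixing
  simp only [contrast, hdom.limitIncrement_eq (hmix _), hdom.rootIncrement_eq (hmix _)]
  refine ⟨fun θ => ⟨(hmix θ).integrable_incrementLimit (hstat θs).measurable_obs (hint θ),
    fun x' => ⟨ae_of_all _ fun s => (hmix θ).tendsto_increment s.1 _,
      (hmix θ).tendsto_eLpNorm_increment_sub Y⟩⟩, fun θ => ?_⟩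
  have hle θ := (hmodel θ).integral_incrementLimit_le (hmodel θs) (hstat θs) (hint θ) (hint θs)
    (Measure.dirac x)
  rw [(hstat θ).sameObservedLaw_iff (hstat θs), ← (hmodel θ).integral_incrementLimit_eq_iff
    (hmodel θs) (hstat θs) (hint θ) (hint θs) (Measure.dirac x)]
  exact ⟨fun hmax => le_antisymm (hle θ) (hmax θs), fun heq θ' => (hle θ').trans_eq heq.symm⟩

theorem mainTheorem8
    {𝒳 𝒴 Ω : Type*}
    [MetricSpace 𝒳] [MeasurableSpace 𝒳] [BorelSpace 𝒳]
    [MetricSpace 𝒴] [MeasurableSpace 𝒴] [BorelSpace 𝒴]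
    [MeasurableSpace Ω]
    {d : ℕ} (Θ : Set (EuclideanSpace ℝ (Fin d))) (θs : Θ)
    (Q : Θ → Kernel 𝒳 𝒳) [∀ θ, IsMarkovKernel (Q θ)]
    (G : Θ → Kernel 𝒳 𝒴) [∀ θ, IsMarkovKernel (G θ)]
    (ν : Θ → Measure 𝒳) [∀ θ, IsProbabilityMeasure (ν θ)]
    (P : Θ → Measure Ω) [∀ θ, IsProbabilityMeasure (P θ)]
    (X : HMT.Vertex → Ω → 𝒳) (Y : HMT.Vertex → Ω → 𝒴)
    (hstat : ∀ θ, HMT.IsStationaryHMT (Q θ) (G θ) (ν θ) X Y (P θ))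
    (lam : Measure 𝒳) [IsProbabilityMeasure lam]
    (μ : Measure 𝒴) [SigmaFinite μ]
    (q : Θ → 𝒳 → 𝒳 → ℝ) (g : Θ → 𝒳 → 𝒴 → ℝ)
    (hdom : HMT.FullyDominated Q G lam μ q g)
    (hreg : HMT.Regular lam q g)
    (hL1 : HMT.L1Regular lam g (Y HMT.Vertex.root) (P θs))
    (hL2 : HMT.L2Regular lam g (Y HMT.Vertex.root) (P θs))
    (x : 𝒳) :
    -- the limit `h_{∂,∞}(θ)` exists, is integrable and does not depend on the base point,
    (∀ θ, Integrable (HMT.limitIncrement lam (q θ) (g θ) Y x) (HMT.spineLaw.prod (P θs)) ∧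
      ∀ x' : 𝒳,
        (∀ᵐ s ∂(HMT.spineLaw.prod (P θs)),
          Tendsto (fun k : ℕ => HMT.rootIncrement lam (q θ) (g θ) Y k x' s) atTop
            (𝓝 (HMT.limitIncrement lam (q θ) (g θ) Y x s))) ∧
        Tendsto (fun k : ℕ =>
          eLpNorm (fun s => HMT.rootIncrement lam (q θ) (g θ) Y k x' s -
            HMT.limitIncrement lam (q θ) (g θ) Y x s) 1 (HMT.spineLaw.prod (P θs))) atTop (𝓝 0)) ∧
    -- and the global maxima of the contrast are the parameters equivalent to the true one
    ∀ θ : Θ,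
      (∀ θ' : Θ, HMT.contrast lam (q θ') (g θ') Y (P θs) x ≤
          HMT.contrast lam (q θ) (g θ) Y (P θs) x) ↔
        HMT.SameObservedLaw Y (P θ) (P θs) :=
  mainTheorem8_general θs Q G ν P X Y hstat lam μ q g hdom hreg hL1 x
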